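/- Let $p\equiv 1 \pmod 8$ be prime, $N=2^n$ with $N/2<p<N$, and $\theta=\arccos\bigl(1-\frac{N}{p-1}\bigr)$. A \emph{QNR} is an $x\in\{0,\dots,p-1\}$ that is not a square modulo $p$. Put $f(x)=1$ if $\left(\frac{x}{p}\right)=-1$ and $0\le x<p$, $f(x)=0$ otherwise, let $x_0=x \bmod 2$, and set $$\beta_x=\tfrac{1}{\sqrt N}\bigl(1-e^{i\theta f(x)(1-2x_0)}\bigr).$$ A quantum circuit is a list of gates, each a one-qubit unitary with at most two control qubits; its cost is its number of gates. A reversible circuit uses only NOT, CNOT and Toffoli gates. (1) Start from the uniform superposition of $|0\rangle,\dots,|N-1\rangle$ and multiply the amplitudes of the even QNRs by $e^{i\theta}$ and of the odd QNRs by $e^{-i\theta}$. The mean of the amplitudes is then $\bar\alpha=\frac{1}{2\sqrt N}$, and the inversion about the mean $\alpha_x\mapsto 2\bar\alpha-\alpha_x$ yields the amplitudes $\beta_x$. Moreover $|\beta_x|^2=\frac{2}{p-1}$ for every QNR $x$, $\beta_x=0$ for all other $x$, and there are exactly $\frac{p-1}{2}$ QNRs. (2) Let $J$ and $K$ be any reversible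 circuits computing, with clean scratch qubits, $[\left(\frac{x}{p}\right)=-1]$ and $[x<p]$ into one qubit each, and let $Z$ be any circuit which negates $|0^n\rangle$ and fixes the other $|x\rangle$ (scratch qubits returning to $0$). Algorithm 1 is the circuit: $H^{\otimes n}$; $J$; $K$; a phase rotation by $-2\theta$ controlled on $x_0$ and both indicator qubits; a phase rotation by $\theta$ controlled on both indicator qubits; $K^{-1}$; $J^{-1}$; $H^{\otimes n}$; $Z$; $H^{\otimes n}$. Started in $|0\cdots0\rangle$ it ends exactly in $-\sum_{x<N}\beta_x|x\rangle|0\cdots 0\rangle$, so that measuring the first $n$ qubits returns a QNR with probability $1$, each QNR having probability $\frac{2}{p-1}$. (3) There is an absolute constant $c$ such that for all such $p,n$ and every reversible Jacobi circuit $J$ as in (2) with $|J|$ gates there are $K$ and $Z$ (after adding scratch qubits if necessary) for which Algorithm 1 has at most $2|J|+cn$ gates. Consequently, for every function $M$ with $M(n)\ge n$ (such as the time to multiply two $n$-bit numbers): if there are reversible Jacobi circuits with $O(M(n)\log n)$ gates for all such $p$, then Algorithm 1 can be run with $O(M(n)\log n)$ gates for all such $p$. (4) Algorithm 1 is a polynomial-time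 uniform exact quantum algorithm: there is a Turing machine which, given $p$ in binary, writes down in time polynomial in $n$ a complete circuit of the form in (2), with all the subcircuits $J$, $K$, $Z$ and with every matrix entry given exactly (as the only root of an integer polynomial in a rational rectangle), for every prime $p\equiv1\pmod 8$. (5) The problem of finding a quadratic nonresidue modulo a given odd prime is in $\mathrm{EQP}_{\mathbb C}$: there is a Turing machine as in (4), which for every odd prime $p$ writes in polynomial time a circuit of unitary gates as above such that measuring its output qubits gives a quadratic nonresidue modulo $p$ with probability exactly $1$. -/

import Mathlib

open scoped BigOperators

noncomputable section

namespace QNR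

/-! ### Quadratic nonresidues and the parameters of the algorithm -/

/-- `x` is one of the quadratic nonresidues modulo `p` in `{0, …, p - 1}`. -/
def IsNonresidue (p x : ℕ) : Prop := x < p ∧ ¬ IsSquare (x : ZMod p)

/-- `p` is a prime with `p ≡ 1 mod 8` and `N / 2 < p < N` for `N = 2 ^ n`. -/
def Admissible (p n : ℕ) : Prop := p.Prime ∧ p % 8 = 1 ∧ 2 ^ n < 2 * p ∧ p < 2 ^ n

/-- The rotation angle `θ = arccos (1 - N / (p - 1))`, where `N = 2 ^ n`. -/
def angle (p n : ℕ) : ℝ := Real.arccos (1 - 2 ^ n / ((p : ℝ) - 1))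

/-- The indicator of `(x / p) = -1`. -/
def jacobiIndicator (p x : ℕ) : ℕ := if jacobiSym (x : ℤ) p = -1 then 1 else 0

/-- The indicator of `x < p`. -/
def ltIndicator (p x : ℕ) : ℕ := if x < p then 1 else 0

/-- The indicator `f` of "`(x / p) = -1` and `x < p`". -/
def indicator (p x : ℕ) : ℕ := jacobiIndicator p x * ltIndicator p x

/-- The amplitude `(1 / √N) (1 - exp (i θ f(x) (1 - 2 x₀)))`, with `x₀` the low bit of `x`. -/
def finalAmplitude (p n x : ℕ) : ℂ :=
  (1 / (Real.sqrt (2 ^ n) : ℂ)) *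
    (1 - Complex.exp (Complex.I * (angle p n : ℂ) * (indicator p x : ℂ) *
      (1 - 2 * ((x % 2 : ℕ) : ℂ))))

/-! ### The transformations of the amplitude vector -/

/-- The uniform superposition of `N = 2 ^ n` states. -/
def uniformState (n : ℕ) : Fin (2 ^ n) → ℂ := fun _ => 1 / (Real.sqrt (2 ^ n) : ℂ)

open Classical in
/-- Rotate the phase of even nonresidues below `p` by `θ` and of odd ones by `-θ`. -/
def rotateNonresidues (p n : ℕ) (θ : ℝ) (ψ : Fin (2 ^ n) → ℂ) : Fin (2 ^ n) → ℂ := fun x =>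
  if IsNonresidue p x then
    if Even (x : ℕ) then Complex.exp (Complex.I * θ) * ψ x
    else Complex.exp (-(Complex.I * θ)) * ψ x
  else ψ x

/-- The mean of the amplitudes. -/
def mean (n : ℕ) (ψ : Fin (2 ^ n) → ℂ) : ℂ := (1 / (2 ^ n : ℂ)) * ∑ x, ψ x

/-- Inversion about the mean. -/
def invertAboutMean (n : ℕ) (ψ : Fin (2 ^ n) → ℂ) : Fin (2 ^ n) → ℂ :=
  fun x => 2 * mean n ψ - ψ x

/-! ### Quantum circuits over controlled one-qubit gates

Qubits are numbered `0, 1, 2, …`; qubit `j` carries the bit of weight `2 ^ j`.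
A state of `W` qubits is a function on bit configurations `Fin W → Bool`. -/

/-- The one-qubit gate `U` on `target`, applied when all the qubits in `controls` are `1`. -/
structure Gate where
  controls : List ℕ
  target : ℕ
  U : Matrix Bool Bool ℂ

/-- A legitimate gate on `W` qubits: unitary, with at most two controls. -/
def Gate.WellFormed (W : ℕ) (g : Gate) : Prop :=
  g.target < W ∧ (∀ c ∈ g.controls, c < W ∧ c ≠ g.target) ∧ g.controls.length ≤ 2 ∧
    g.U ∈ Matrix.unitaryGroup Bool ℂ

def getBit {W : ℕ} (s : Fin W → Bool) (i : ℕ) : Bool := if h : i < W then s ⟨i, h⟩ else false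

def setBit {W : ℕ} (s : Fin W → Bool) (i : ℕ) (b : Bool) : Fin W → Bool :=
  fun j => if (j : ℕ) = i then b else s j

/-- The action of a gate on a state of `W` qubits. -/
def Gate.apply (W : ℕ) (g : Gate) (ψ : (Fin W → Bool) → ℂ) : (Fin W → Bool) → ℂ := fun s =>
  if ∀ c ∈ g.controls, getBit s c = true then
    ∑ b : Bool, g.U (getBit s g.target) b * ψ (setBit s g.target b)
  else ψ s

/-- A circuit is a list of gates, applied from left to right; its cost is its length. -/
abbrev Circuit := List Gate

/-- The action of a circuit on a state of `W` qubits. -/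
def Circuit.run (W : ℕ) (C : Circuit) (ψ : (Fin W → Bool) → ℂ) : (Fin W → Bool) → ℂ :=
  C.foldl (fun φ g => g.apply W φ) ψ

def Circuit.WellFormed (W : ℕ) (C : Circuit) : Prop := ∀ g ∈ C, g.WellFormed W

/-- The inverse circuit: the adjoint gates in reverse order. -/
def Circuit.inverse (C : Circuit) : Circuit :=
  C.reverse.map fun g => ⟨g.controls, g.target, g.U.conjTranspose⟩

/-- The basis state of `W` qubits given by the binary digits of `x`. -/
def ket (W x : ℕ) : (Fin W → Bool) → ℂ := Pi.single (fun j : Fin W => x.testBit (j : ℕ)) 1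

/-- The number read off the first `m` qubits. -/
def outputValue {W : ℕ} (m : ℕ) (s : Fin W → Bool) : ℕ :=
  ∑ j : Fin W, if (j : ℕ) < m ∧ s j = true then 2 ^ (j : ℕ) else 0

open Classical in
/-- The probability that measuring the first `m` qubits of `ψ` gives a number in `S`. -/
def outputProb (W m : ℕ) (ψ : (Fin W → Bool) → ℂ) (S : Set ℕ) : ℝ :=
  ∑ s : Fin W → Bool, if outputValue m s ∈ S then ‖ψ s‖ ^ 2 else 0

/-- The NOT matrix. -/
def notMatrix : Matrix Bool Bool ℂ := fun a b => if a = b then 0 else 1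

/-- The Hadamard matrix. -/
def hadamardMatrix : Matrix Bool Bool ℂ := fun a b =>
  (1 / (Real.sqrt 2 : ℂ)) * if a = true ∧ b = true then -1 else 1

/-- The phase rotation `|0⟩ ↦ |0⟩`, `|1⟩ ↦ exp (i φ) |1⟩`. -/
def phaseMatrix (φ : ℝ) : Matrix Bool Bool ℂ := fun a b =>
  if a = b then (if a = true then Complex.exp (Complex.I * φ) else 1) else 0

/-- A reversible circuit: NOT, CNOT and Toffoli gates on `W` qubits. -/
def Circuit.Reversible (W : ℕ) (C : Circuit) : Prop :=
  C.WellFormed W ∧ ∀ g ∈ C, g.U = notMatrix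

/-- A Hadamard gate on each of the qubits `0, …, n - 1`. -/
def hadamards (n : ℕ) : Circuit := (List.range n).map fun i => ⟨[], i, hadamardMatrix⟩

/-! ### The algorithm as a circuit

Qubits `0, …, n - 1` hold `x`, qubit `n` the Jacobi symbol indicator, qubit `n + 1` the indicator
of `x < p`, and the qubits from `n + 2` on are scratch space. -/

/-- `|x⟩|0⟩|0⟩|0…0⟩ ↦ |x⟩|(x / p) = -1⟩|0⟩|0…0⟩` -/
def IsJacobiCircuit (p n W : ℕ) (J : Circuit) : Prop :=
  J.Reversible W ∧ ∀ x < 2 ^ n, J.run W (ket W x) = ket W (x + jacobiIndicator p x * 2 ^ n)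

/-- `|x⟩|b⟩|0⟩|0…0⟩ ↦ |x⟩|b⟩|x < p⟩|0…0⟩` -/
def IsComparatorCircuit (p n W : ℕ) (K : Circuit) : Prop :=
  K.Reversible W ∧ ∀ x < 2 ^ n, ∀ b < 2,
    K.run W (ket W (x + b * 2 ^ n)) =
      ket W (x + b * 2 ^ n + ltIndicator p x * 2 ^ (n + 1))

/-- `|0⟩|0⟩|0⟩|0…0⟩ ↦ -|0⟩|0⟩|0⟩|0…0⟩`, and `|x⟩|0⟩|0⟩|0…0⟩` is fixed for `x ≠ 0`. -/
def IsZeroFlipCircuit (n W : ℕ) (Z : Circuit) : Prop :=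
  Z.WellFormed W ∧ ∀ x < 2 ^ n,
    Z.run W (ket W x) = (if x = 0 then (-1 : ℂ) else 1) • ket W x

/-- The circuits `J`, `K`, `Z` are subcircuits on `W` qubits with which the algorithm can be run. -/
def IsInstance (p n W : ℕ) (J K Z : Circuit) : Prop :=
  n + 2 ≤ W ∧ IsJacobiCircuit p n W J ∧ IsComparatorCircuit p n W K ∧ IsZeroFlipCircuit n W Z

/-- The algorithm: Hadamard transform; compute the two indicators; rotate the odd nonresidues below
`p` by `-2θ`, then all nonresidues below `p` by `θ`; uncompute the indicators; Hadamard transform,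
phase flip of the zero state, Hadamard transform. -/
def algorithm (p n : ℕ) (J K Z : Circuit) : Circuit :=
  hadamards n ++ J ++ K ++
    [⟨[n, n + 1], 0, phaseMatrix (-2 * angle p n)⟩, ⟨[n + 1], n, phaseMatrix (angle p n)⟩] ++
    Circuit.inverse K ++ Circuit.inverse J ++
    hadamards n ++ Z ++ hadamards n

/-! ### Uniform circuit families and the class `EQP K`

A classical machine writes a circuit down as a finite string.  Matrix entries are written down
exactly, as roots of integer polynomials isolated by rational rectangles. -/

/-- A finite description of an algebraic number. -/
structure EntryDesc where
  /-- the coefficients, constant coefficient first -/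
  coeffs : List ℤ
  reLo : ℚ
  reHi : ℚ
  imLo : ℚ
  imHi : ℚ

/-- The value at `z` of the polynomial with the given coefficients. -/
def EntryDesc.eval (d : EntryDesc) (z : ℂ) : ℂ := d.coeffs.foldr (fun (a : ℤ) (r : ℂ) => (a : ℂ) + z * r) 0

/-- `z` is the only root in the rectangle. -/
def EntryDesc.Denotes (d : EntryDesc) (z : ℂ) : Prop :=
  (∃ a ∈ d.coeffs, a ≠ 0) ∧
    {w : ℂ | d.eval w = 0 ∧ (d.reLo : ℝ) ≤ w.re ∧ w.re ≤ (d.reHi : ℝ) ∧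
      (d.imLo : ℝ) ≤ w.im ∧ w.im ≤ (d.imHi : ℝ)} = {z}

/-- A finite description of a gate. -/
structure GateDesc where
  controls : List ℕ
  target : ℕ
  u00 : EntryDesc
  u01 : EntryDesc
  u10 : EntryDesc
  u11 : EntryDesc

def GateDesc.Denotes (d : GateDesc) (g : Gate) : Prop :=
  g.controls = d.controls ∧ g.target = d.target ∧
    d.u00.Denotes (g.U false false) ∧ d.u01.Denotes (g.U false true) ∧
    d.u10.Denotes (g.U true false) ∧ d.u11.Denotes (g.U true true)

/-- A finite description of a circuit on `width` qubits, whose first `outputs` qubits are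
measured at the end. -/
structure CircuitDesc where
  width : ℕ
  outputs : ℕ
  gates : List GateDesc

/-- `d` describes the circuit `C`, all of whose gates are legitimate and have entries in `K`. -/
def CircuitDesc.Denotes (K : Set ℂ) (d : CircuitDesc) (C : Circuit) : Prop :=
  d.outputs ≤ d.width ∧ List.Forall₂ GateDesc.Denotes d.gates C ∧ C.WellFormed d.width ∧
    ∀ g ∈ C, ∀ a b, g.U a b ∈ K

open Computability (Γ')

/-- Qubit numbers are written in unary. -/
def encodeUnary (i : ℕ) : List Γ' := List.replicate i (Γ'.bit true) ++ [Γ'.comma]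

/-- Integers are written in binary, the symbol `blank` being the minus sign. -/
def encodeInt (z : ℤ) : List Γ' :=
  (if z < 0 then [Γ'.blank] else []) ++ (Computability.encodeNat z.natAbs).map Γ'.bit ++ [Γ'.comma]

def encodeRat (q : ℚ) : List Γ' := encodeInt q.num ++ encodeInt q.den

def encodeList {α : Type} (e : α → List Γ') (l : List α) : List Γ' :=
  [Γ'.bra] ++ l.flatMap e ++ [Γ'.ket]

def EntryDesc.encode (d : EntryDesc) : List Γ' :=
  encodeList encodeInt d.coeffs ++ encodeRat d.reLo ++ encodeRat d.reHi ++
    encodeRat d.imLo ++ encodeRat d.imHi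

def GateDesc.encode (d : GateDesc) : List Γ' :=
  encodeList encodeUnary d.controls ++ encodeUnary d.target ++
    d.u00.encode ++ d.u01.encode ++ d.u10.encode ++ d.u11.encode

def CircuitDesc.encode (d : CircuitDesc) : List Γ' :=
  encodeUnary d.width ++ encodeUnary d.outputs ++ encodeList GateDesc.encode d.gates

/-- A Turing machine writes the circuit for input `x` (in binary) in time polynomial in the
length of `x`. -/
def PolyTimeUniform (D : ℕ → CircuitDesc) : Prop :=
  Nonempty (Turing.TM2ComputableInPolyTime Computability.encodeNat CircuitDesc.encode D)

/-- A search problem on natural numbers: for an instance `x`, find some `y` with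
`solution x y`. -/
structure SearchProblem where
  instances : Set ℕ
  solution : ℕ → ℕ → Prop

/-- Exact quantum polynomial time with matrix entries in `K`: on every instance `x`, the circuit
written for `x`, started in `|0…0⟩`, outputs a solution with probability `1`. -/
def EQP (K : Set ℂ) : Set SearchProblem :=
  {P | ∃ D : ℕ → CircuitDesc, PolyTimeUniform D ∧ ∀ x ∈ P.instances, ∃ C : Circuit,
    (D x).Denotes K C ∧
      outputProb (D x).width (D x).outputs (C.run (D x).width (ket (D x).width 0))
        {y | P.solution x y} = 1}

/-- Given an odd prime `p`, find a quadratic nonresidue modulo `p`. -/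
def nonresidueProblem : SearchProblem where
  instances := {p | p.Prime ∧ p ≠ 2}
  solution := IsNonresidue

end QNR

end

open scoped BigOperators
noncomputable section
namespace QNR
open Computability (Γ')
open Turing

/-! ### Stack programs and their Turing machines -/

/-! Exactness. Since p ≡ 1 mod 8, -1 is a square modulo p, so x ↦ p - x permutes the nonresidues; as
p is odd it exchanges the even and the odd ones, and there are (p - 1)/4 of each
(`card_even_nonresidues`). Rotating the two halves by opposite angles therefore keeps the sum of the
amplitudes real: it is (1/√N)(N + (p - 1)/2 · (cos θ - 1)). The choice cos θ = 1 - N/(p - 1),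
possible because N ≤ 2(p - 1), turns this into half of the original sum. So twice the mean is the
original amplitude 1/√N, and inversion about the mean annihilates every amplitude that was not
rotated. Conjugating the sign flip of |0⟩ by Hadamard transforms gives the identity minus twice the
projection onto the uniform state, which is the negative of the inversion about the mean
(`run_diffusion`); this explains the global sign.

Circuits. A classical computation is written as a straight-line program in which every fresh bit
receives a sum modulo 2 of products of at most two earlier bits, hence NOT, CNOT and Toffoli gates.
The result is copied out and the program is run backwards to clean the scratch bits
(`actAll_computeCopy`). The comparison with p is a chain of borrows, the zero test a chain of
conjunctions, and the Jacobi symbol is found by 2n steps of a binary gcd algorithm that keeps track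
of a sign; each step at least halves the product of the two numbers (`jacobiStep_spec`).

Exact matrix entries. The number cos θ · (p - 1)/2 is an integer, so e^{iθ} and e^{-2iθ} are roots
of palindromic integer quadratics. Both lie in the closed upper half plane because cos θ ≤ 0, so one
fixed rectangle isolates them from their conjugates (`unitDesc_denotes`).

Uniformity. No Turing machine is written by hand. Structured programs over stacks carry a timed
semantics and compile to stack machines (`Exec.steps`). The functions that they compute in
polynomial time (`PT`) are closed under concatenation, case distinction and bounded iteration with
an accumulator of polynomial length (`PT.iterate`). Unary and binary arithmetic and the writing of
all gate lists follow from these closure properties alone.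

For odd primes p with p mod 8 ≠ 1 the supplementary laws make -1 or 2 a nonresidue, and the circuit
merely writes that constant. -/

/-- Structured programs over stacks (registers) numbered by `ℕ`. -/
inductive Prog
  | skip
  | push (k : ℕ) (a : Γ')
  | seq (c d : Prog)
  /-- pop from the stack `k` and branch on the symbol found -/
  | pop (k : ℕ) (n : Prog) (c : Γ' → Prog)
  /-- pop from the stack `k` until it is empty, running the body on each symbol -/
  | loop (k : ℕ) (c : Γ' → Prog)

abbrev Store := ℕ → List Γ'

/-- `Exec c S S' t`: the program `c` takes the store `S` to `S'` in `t` steps. -/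
inductive Exec : Prog → Store → Store → ℕ → Prop
  | skip (S) : Exec .skip S S 1
  | push (k a S) : Exec (.push k a) S (Function.update S k (a :: S k)) 1
  | seq {c d S S' S'' t t'} : Exec c S S' t → Exec d S' S'' t' → Exec (.seq c d) S S'' (t + t')
  | popNil {k n c S S' t} : S k = [] → Exec n S S' t → Exec (.pop k n c) S S' (t + 1)
  | popCons {k n c S S' t a l} : S k = a :: l → Exec (c a) (Function.update S k l) S' t →
      Exec (.pop k n c) S S' (t + 1)
  | loopNil {k c S} : S k = [] → Exec (.loop k c) S S 1
  | loopCons {k c S S' S'' t t' a l} : S k = a :: l → Exec (c a) (Function.update S k l) S' t →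
      Exec (.loop k c) S' S'' t' → Exec (.loop k c) S S'' (t + t' + 1)

/-- All registers of the program are below `m`. -/
def Prog.Below (m : ℕ) : Prog → Prop
  | .skip => True
  | .push k _ => k < m
  | .seq c d => c.Below m ∧ d.Below m
  | .pop k n c => k < m ∧ n.Below m ∧ ∀ a, (c a).Below m
  | .loop k c => k < m ∧ ∀ a, (c a).Below m

theorem Prog.Below.mono {m m' : ℕ} (h : m ≤ m') {c : Prog} (hc : c.Below m) : c.Below m' := by
  induction c with
  | skip => trivial
  | push k a => exact lt_of_lt_of_le hc h
  | seq c d ihc ihd => exact ⟨ihc hc.1, ihd hc.2⟩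
  | pop k n c ihn ihc => exact ⟨hc.1.trans_le h, ihn hc.2.1, fun a => ihc a (hc.2.2 a)⟩
  | loop k c ihc => exact ⟨hc.1.trans_le h, fun a => ihc a (hc.2 a)⟩

/-- A step adds at most one symbol to any stack, so the running time controls the length of what is
written; `PT.bdd` rests on this. -/
theorem Exec.length_le {c S S' t} (h : Exec c S S' t) (k : ℕ) :
    (S' k).length ≤ (S k).length + t := by
  induction h with
  | skip S => simp
  | push k' a S => by_cases h : k = k' <;> simp [Function.update, h]
  | seq _ _ ih ih' => omega
  | popNil _ _ ih => omega
  | @popCons k' n c S S' t a l hS _ ih =>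
    by_cases h : k = k'
    · subst h; simp [hS] at ih ⊢; omega
    · simp [Function.update, h] at ih; omega
  | loopNil _ => simp
  | @loopCons k' c S S' S'' t t' a l hS _ _ ih ih' =>
    by_cases h : k = k'
    · subst h; simp [hS] at ih ⊢; omega
    · simp [Function.update, h] at ih; omega

/-! ### Compilation of stack programs to Turing machines. -/

/-- The program points of a program. -/
def Prog.Label : Prog → Type
  | .skip => Unit
  | .push _ _ => Unit
  | .seq c d => c.Label ⊕ d.Label
  | .pop _ n c => Unit ⊕ n.Label ⊕ Σ a, (c a).Label
  | .loop _ c => Unit ⊕ Σ a, (c a).Label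

theorem Prog.finite_label (c : Prog) : Finite c.Label := by
  induction c with
  | skip => exact inferInstanceAs (Finite Unit)
  | push k a => exact inferInstanceAs (Finite Unit)
  | seq c d ihc ihd => exact inferInstanceAs (Finite (c.Label ⊕ d.Label))
  | pop k n c ihn ihc => exact inferInstanceAs (Finite (Unit ⊕ n.Label ⊕ Σ a, (c a).Label))
  | loop k c ihc => exact inferInstanceAs (Finite (Unit ⊕ Σ a, (c a).Label))

/-- The first program point. -/
def Prog.entry : (c : Prog) → c.Label
  | .skip => ()
  | .push _ _ => ()
  | .seq c _ => .inl c.entry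
  | .pop _ _ _ => .inl ()
  | .loop _ _ => .inl ()

/-- The stack alphabets of the machine: an input stack over `Bool`, and `m` registers. -/
abbrev StackSym (m : ℕ) : Option (Fin m) → Type
  | none => Bool
  | some _ => Γ'

/-- The machine statements of the program points, with `nxt` as the exit. -/
def Prog.code (m : ℕ) [NeZero m] {Λ : Type} : (c : Prog) → (c.Label → Λ) → Λ → c.Label →
    TM2.Stmt (StackSym m) Λ (Option Γ')
  | .skip, _, nxt => fun _ => .goto fun _ => nxt
  | .push k a, _, nxt => fun _ => .push (some (Fin.ofNat m k)) (fun _ => a) (.goto fun _ => nxt)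
  | .seq c d, f, nxt => Sum.elim
      (c.code m (fun l => f (.inl l)) (f (.inr d.entry)))
      (d.code m (fun l => f (.inr l)) nxt)
  | .pop k n c, f, nxt => Sum.elim
      (fun _ => .pop (some (Fin.ofNat m k)) (fun _ (o : Option Γ') => o) (.goto fun v => match v with
        | none => f (.inr (.inl n.entry))
        | some a => f (.inr (.inr ⟨a, (c a).entry⟩))))
      (Sum.elim (n.code m (fun l => f (.inr (.inl l))) nxt)
        (fun x => (c x.1).code m (fun l => f (.inr (.inr ⟨x.1, l⟩))) nxt x.2))
  | .loop k c, f, nxt => Sum.elim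
      (fun _ => .pop (some (Fin.ofNat m k)) (fun _ (o : Option Γ') => o) (.goto fun v => match v with
        | none => nxt
        | some a => f (.inr ⟨a, (c a).entry⟩)))
      (fun x => (c x.1).code m (fun l => f (.inr ⟨x.1, l⟩)) (f (.inl ())) x.2)

/-- The stacks hold the store `S`, and the input stack holds `u`. -/
def machineStk (m : ℕ) (u : List Bool) (S : Store) : ∀ k, List (StackSym m k)
  | none => u
  | some k => S k

/-- Registers are addressed by `Fin.ofNat m k`, which reduces modulo `m`; the bound `k < m` keeps
this from hitting a different register. -/
theorem update_machineStk {m : ℕ} [NeZero m] (u : List Bool) (S : Store) {k : ℕ} (hk : k < m)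
    (l : List Γ') :
    Function.update (machineStk m u S) (some (Fin.ofNat m k)) l
      = machineStk m u (Function.update S k l) := by
  funext j
  rcases j with _ | j
  · rw [Function.update_of_ne (by simp)]; rfl
  · by_cases hj : (j : ℕ) = k
    · have : j = Fin.ofNat m k := by ext; simp [hj, Nat.mod_eq_of_lt hk]
      subst this
      rw [Function.update_self]
      simp [machineStk, Nat.mod_eq_of_lt hk]
    · have : some j ≠ some (Fin.ofNat m k) := by
        intro h; apply hj; rw [Option.some.inj h]; simp [Nat.mod_eq_of_lt hk]
      rw [Function.update_of_ne this]
      simp [machineStk, hj]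

theorem machineStk_ofNat {m : ℕ} [NeZero m] (u : List Bool) (S : Store) {k : ℕ} (hk : k < m) :
    machineStk m u S (some (Fin.ofNat m k)) = S k := by
  simp [machineStk, Nat.mod_eq_of_lt hk]

/-- `t` steps of the machine `M` take the configuration `a` to `b`. -/
def Steps {m : ℕ} {Λ : Type} (M : Λ → TM2.Stmt (StackSym m) Λ (Option Γ'))
    (a b : TM2.Cfg (StackSym m) Λ (Option Γ')) (t : ℕ) : Prop :=
  (flip bind (TM2.step M))^[t] (some a) = some b

theorem Steps.trans {m : ℕ} {Λ : Type} {M : Λ → TM2.Stmt (StackSym m) Λ (Option Γ')}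
    {a b c : TM2.Cfg (StackSym m) Λ (Option Γ')} {t t' : ℕ} (h : Steps M a b t)
    (h' : Steps M b c t') : Steps M a c (t + t') := by
  unfold Steps at *
  rw [add_comm, Function.iterate_add_apply, h, h']

theorem Steps.one {m : ℕ} {Λ : Type} {M : Λ → TM2.Stmt (StackSym m) Λ (Option Γ')}
    {a b : TM2.Cfg (StackSym m) Λ (Option Γ')} (h : TM2.step M a = some b) : Steps M a b 1 := h

/-- Correctness of the compilation, with `Exec` time equal to the number of machine steps. The label
embedding `f` and the exit `nxt` are arbitrary so that the induction can pass to subprograms, whose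
labels form a summand of the label type. The internal state `v` carries nothing between
instructions, since a pop overwrites it before it is inspected. -/
theorem Exec.steps {m : ℕ} [NeZero m] {Λ : Type} {M : Λ → TM2.Stmt (StackSym m) Λ (Option Γ')}
    (u : List Bool) {c : Prog} {S S' : Store} {t : ℕ} (h : Exec c S S' t) :
    c.Below m → ∀ (f : c.Label → Λ) (nxt : Λ), (∀ l, M (f l) = c.code m f nxt l) → ∀ v,
      ∃ v', Steps M ⟨some (f c.entry), v, machineStk m u S⟩ ⟨some nxt, v', machineStk m u S'⟩ t := by
  induction h with
  | skip S =>
    intro hb f nxt hM v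
    exact ⟨v, Steps.one (by simp [hM, Prog.code])⟩
  | push k a S =>
    intro hb f nxt hM v
    refine ⟨v, Steps.one ?_⟩
    simp only [TM2.step, hM, Prog.code, TM2.stepAux]
    rw [machineStk_ofNat u S hb, update_machineStk u S hb]
  | @seq c d S S' S'' t t' _ _ ih ih' =>
    intro hb f nxt hM v
    obtain ⟨v1, h1⟩ := ih hb.1 (fun l => f (.inl l)) (f (.inr d.entry))
      (fun l => hM (.inl l)) v
    obtain ⟨v2, h2⟩ := ih' hb.2 (fun l => f (.inr l)) nxt (fun l => hM (.inr l)) v1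
    exact ⟨v2, h1.trans h2⟩
  | @popNil k n c S S' t hS _ ih =>
    intro hb f nxt hM v
    obtain ⟨v2, h2⟩ := ih hb.2.1 (fun l => f (.inr (.inl l))) nxt
      (fun l => hM (.inr (.inl l))) none
    refine ⟨v2, add_comm t 1 ▸ Steps.trans (Steps.one ?_) h2⟩
    have h0 := hM (.inl ())
    simp only [TM2.step, Prog.entry]
    rw [h0]
    simp only [Prog.code, Sum.elim_inl, TM2.stepAux]
    rw [machineStk_ofNat u S hb.1, update_machineStk u S hb.1, hS]
    simp only [List.head?_nil, List.tail_nil]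
    rw [show Function.update S k [] = S by rw [← hS, Function.update_eq_self]]
  | @popCons k n c S S' t a l hS _ ih =>
    intro hb f nxt hM v
    obtain ⟨v2, h2⟩ := ih (hb.2.2 a) (fun l => f (.inr (.inr ⟨a, l⟩))) nxt
      (fun l => hM (.inr (.inr ⟨a, l⟩))) (some a)
    refine ⟨v2, add_comm t 1 ▸ Steps.trans (Steps.one ?_) h2⟩
    have h0 := hM (.inl ())
    simp only [TM2.step, Prog.entry]
    rw [h0]
    simp only [Prog.code, Sum.elim_inl, TM2.stepAux]
    rw [machineStk_ofNat u S hb.1, update_machineStk u S hb.1, hS]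
    simp
  | @loopNil k c S hS =>
    intro hb f nxt hM v
    refine ⟨none, Steps.one ?_⟩
    have h0 := hM (.inl ())
    simp only [TM2.step, Prog.entry]
    rw [h0]
    simp only [Prog.code, Sum.elim_inl, TM2.stepAux]
    rw [machineStk_ofNat u S hb.1, update_machineStk u S hb.1, hS]
    simp only [List.head?_nil, List.tail_nil]
    rw [show Function.update S k [] = S by rw [← hS, Function.update_eq_self]]
  | @loopCons k c S S' S'' t t' a l hS _ _ ih ih' =>
    intro hb f nxt hM v
    obtain ⟨v1, h1⟩ := ih (hb.2 a) (fun l => f (.inr ⟨a, l⟩)) (f (.inl ()))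
      (fun l => hM (.inr ⟨a, l⟩)) (some a)
    obtain ⟨v2, h2⟩ := ih' hb f nxt hM v1
    have h0 := hM (.inl ())
    have h3 : Steps M ⟨some (f (Prog.entry (.loop k c))), v, machineStk m u S⟩
        ⟨some (f (.inr ⟨a, (c a).entry⟩)), some a, machineStk m u (Function.update S k l)⟩ 1 := by
      apply Steps.one
      simp only [TM2.step, Prog.entry]
      rw [h0]
      simp only [Prog.code, Sum.elim_inl, TM2.stepAux]
      rw [machineStk_ofNat u S hb.1, update_machineStk u S hb.1, hS]
      simp
    refine ⟨v2, ?_⟩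
    have := (h3.trans h1).trans h2
    rwa [show 1 + t + t' = t + t' + 1 by ring] at this

/-- The labels of the machine of `c`: move the input to register `0`, run `c`, clean up. -/
abbrev MachineLabel (c : Prog) := Bool ⊕ c.Label

/-- The machine which moves its input, reversed, to register `0` and then runs `c`. -/
def machineCode (m : ℕ) [NeZero m] (c : Prog) :
    MachineLabel c → TM2.Stmt (StackSym m) (MachineLabel c) (Option Γ') :=
  Sum.elim
    (fun b => match b with
      | true => .pop none (fun _ (o : Option Bool) => o.map Γ'.bit)
          (.branch (fun v => v.isSome)
            (.push (some (Fin.ofNat m 0)) (fun v => v.getD Γ'.blank)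
              (.goto fun _ => .inl true))
            (.goto fun _ => .inr c.entry))
      -- `haltList` prescribes the initial internal state, so the state is reset before halting.
      | false => .load (fun _ => none) .halt)
    (c.code m .inr (.inl false))

/-- Popping from one stack and pushing on another reverses the input. The extra step is the pop that
finds the input stack empty. -/
theorem machineCode_load (m : ℕ) [NeZero m] (hm : 1 < m) (c : Prog) (u : List Bool) (S : Store)
    (v : Option Γ') :
    Steps (machineCode m c) ⟨some (.inl true), v, machineStk m u S⟩
      ⟨some (.inr c.entry), none,
        machineStk m [] (Function.update S 0 ((u.map Γ'.bit).reverse ++ S 0))⟩ (u.length + 1) := by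
  induction u generalizing S v with
  | nil =>
    apply Steps.one
    simp only [TM2.step, machineCode, Sum.elim_inl, TM2.stepAux]
    simp [machineStk]
  | cons b u ih =>
    have h := ih (Function.update S 0 (Γ'.bit b :: S 0)) (some (Γ'.bit b))
    have h1 : Steps (machineCode m c) ⟨some (.inl true), v, machineStk m (b :: u) S⟩
        ⟨some (.inl true), some (Γ'.bit b),
          machineStk m u (Function.update S 0 (Γ'.bit b :: S 0))⟩ 1 := by
      apply Steps.one
      simp only [TM2.step, machineCode, Sum.elim_inl, TM2.stepAux]
      have : Function.update (machineStk m (b :: u) S) none u = machineStk m u S := by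
        funext k; rcases k with _ | k <;> simp [machineStk]
      simp only [show machineStk m (b :: u) S none = b :: u from rfl, List.head?_cons, Option.map_some,
        Option.isSome_some, cond_true, List.tail_cons, this, Option.getD_some]
      rw [machineStk_ofNat _ _ (by omega), update_machineStk _ _ (by omega)]
    have := h1.trans h
    simp only [Function.update_self, Function.update_idem] at this
    rw [show 1 + (u.length + 1) = (b :: u).length + 1 by simp [add_comm]] at this
    simpa using this

/-- The Turing machine of a program, with register `1` as the output stack. -/
def machine (m : ℕ) [NeZero m] (c : Prog) : FinTM2 where
  K := Option (Fin m)
  k₀ := none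
  k₁ := some (Fin.ofNat m 1)
  Γ := StackSym m
  Λ := MachineLabel c
  main := .inl true
  ΛFin := by
    have := c.finite_label
    exact Fintype.ofFinite _
  σ := Option Γ'
  initialState := none
  Γk₀Fin := inferInstanceAs (Fintype Bool)
  m := machineCode m c

/-- A function computed by a program in polynomial time is computed by a Turing machine in
polynomial time. -/
theorem polyTime_of_exec {β : Type} (e : β → List Γ') (D : ℕ → β) (c : Prog)
    (P : Polynomial ℕ)
    (h : ∀ x, ∃ t ≤ P.eval (Computability.encodeNat x).length,
      Exec c (Function.update (fun _ => []) 0 ((Computability.encodeNat x).map Γ'.bit).reverse)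
        (Function.update (fun _ => []) 1 (e (D x))) t) (m : ℕ) (hc : c.Below m) :
    Nonempty (TM2ComputableInPolyTime Computability.encodeNat e D) := by
  have : NeZero (m + 2) := ⟨by omega⟩
  -- With `m + 2` registers the registers `0` and `1` exist and differ. Beyond `P`, loading an input
  -- of length `ℓ` costs `ℓ + 1` steps and halting costs one.
  refine ⟨⟨⟨machine (m + 2) c, Equiv.refl Bool, Equiv.refl Γ'⟩, P + Polynomial.X + 2, fun x => ?_⟩⟩
  have key : ∃ t ≤ P.eval (Computability.encodeNat x).length +
        (Computability.encodeNat x).length + 2,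
      Steps (machineCode (m + 2) c)
        ⟨some (.inl true), none, machineStk (m + 2) (Computability.encodeNat x) fun _ => []⟩
        ⟨none, none, machineStk (m + 2) [] (Function.update (fun _ => []) 1 (e (D x)))⟩ t := by
    obtain ⟨t, ht, hx⟩ := h x
    obtain ⟨v', h2⟩ := hx.steps (M := machineCode (m + 2) c) [] (hc.mono (by omega)) .inr
      (.inl false) (fun l => rfl) none
    have h1 := machineCode_load (m + 2) (by omega) c (Computability.encodeNat x) (fun _ => []) none
    have h3 : Steps (machineCode (m + 2) c)
        ⟨some (.inl false), v', machineStk (m + 2) [] (Function.update (fun _ => []) 1 (e (D x)))⟩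
        ⟨none, none, machineStk (m + 2) [] (Function.update (fun _ => []) 1 (e (D x)))⟩ 1 :=
      Steps.one rfl
    simp only [List.append_nil] at h1
    exact ⟨_, by omega, (h1.trans h2).trans h3⟩
  have hi : initList (machine (m + 2) c) (List.map (Equiv.refl Bool).invFun (Computability.encodeNat x)) =
      ⟨some (.inl true), none, machineStk (m + 2) (Computability.encodeNat x) fun _ => []⟩ := by
    simp only [initList, machine]
    congr 1
    funext k
    rcases k with _ | k
    · exact List.map_id _
    · simp [machineStk]
  have ho : haltList (machine (m + 2) c) (List.map (Equiv.refl Γ').invFun (e (D x))) =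
      ⟨none, none, machineStk (m + 2) [] (Function.update (fun _ => []) 1 (e (D x)))⟩ := by
    simp only [haltList, machine]
    congr 1
    funext k
    rcases k with _ | k
    · simp [machineStk]
    · by_cases hk : k = Fin.ofNat (m + 2) 1
      · subst hk
        exact (List.map_id _).trans (by simp [machineStk])
      · have : (k : ℕ) ≠ 1 := by
          intro h; apply hk; ext; simp [h]
        exact (dif_neg fun h => hk (Option.some.inj h)).trans (by simp [machineStk, this])
  refine ⟨⟨key.choose, ?_⟩, ?_⟩
  · have h := key.choose_spec.2
    change (flip bind (TM2.step (machineCode (m + 2) c)))^[key.choose]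
      (some (initList (machine (m + 2) c) (List.map (Equiv.refl Bool).invFun (Computability.encodeNat x)))) =
        some (haltList (machine (m + 2) c) (List.map (Equiv.refl Γ').invFun (e (D x))))
    rw [hi, ho]
    exact h
  · have := key.choose_spec.1
    simpa [Polynomial.eval_add] using this

/-! ### Functions computed by stack programs in polynomial time -/

theorem Exec.of_eq {c : Prog} {S S' S'' : Store} {t t' : ℕ} (h : Exec c S S' t) (hS : S' = S'')
    (ht : t = t') : Exec c S S'' t' := hS ▸ ht ▸ h

/-- Move the stack `k`, reversed, onto the stack `k'`. -/
def Prog.move (k k' : ℕ) : Prog := .loop k fun a => .push k' a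

theorem exec_move {k k' : ℕ} (hk : k ≠ k') (S : Store) :
    Exec (.move k k') S
      (Function.update (Function.update S k []) k' ((S k).reverse ++ S k'))
      (2 * (S k).length + 1) := by
  generalize hl : S k = l
  induction l generalizing S with
  | nil =>
    refine (Exec.loopNil hl).of_eq ?_ (by simp)
    funext j
    by_cases h : j = k' <;> by_cases h' : j = k <;> simp_all [Function.update]
  | cons a l ih =>
    have h1 := Exec.push k' a (Function.update S k l)
    have h2 := ih (Function.update (Function.update S k l) k' (a :: (Function.update S k l) k'))
      (by simp [Function.update, hk])
    refine (Exec.loopCons hl h1 h2).of_eq ?_ (by simp; ring)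
    funext j
    by_cases h : j = k' <;> by_cases h' : j = k <;> simp_all [Function.update]

/-- Empty the stack `k`. -/
def Prog.clear (k : ℕ) : Prog := .loop k fun _ => .skip

theorem exec_clear (k : ℕ) (S : Store) :
    Exec (.clear k) S (Function.update S k []) (2 * (S k).length + 1) := by
  generalize hl : S k = l
  induction l generalizing S with
  | nil =>
    refine (Exec.loopNil hl).of_eq ?_ (by simp)
    rw [← hl, Function.update_eq_self]
  | cons a l ih =>
    have h2 := ih (Function.update S k l) (by simp)
    refine (Exec.loopCons hl (.skip _) h2).of_eq (by simp) (by simp; ring)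

/-! ### Polynomial-time computability relative to a list of inputs. -/

/-- A domain with a size function and the functions whose values are available as inputs. -/
structure Ctx (α : Type) where
  D : Set α
  s : α → ℕ
  V : List (α → List Γ')

/-- `g` is bounded by a polynomial in the size. -/
def Ctx.Bdd {α : Type} (C : Ctx α) (g : α → ℕ) : Prop :=
  ∃ P : Polynomial ℕ, ∀ x ∈ C.D, g x ≤ P.eval (C.s x)

/-- The registers `r` hold the inputs. -/
def Ctx.Holds {α : Type} (C : Ctx α) (r : List ℕ) (S : Store) (x : α) : Prop :=
  List.Forall₂ (fun k (v : α → List Γ') => S k = v x) r C.V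

/-- `f` is computed from the inputs by stack programs in polynomial time: for registers `r` with
the inputs, an output register `o`, and scratch registers from `b` on. -/
def PT {α : Type} (C : Ctx α) (f : α → List Γ') : Prop :=
  ∃ P : Polynomial ℕ, ∀ (r : List ℕ) (o b : ℕ), r.length = C.V.length →
    (∀ k ∈ r, k < b ∧ k ≠ o) → o < b → ∃ (c : Prog) (m : ℕ), c.Below m ∧
      ∀ (S : Store) (x : α), x ∈ C.D → S o = [] → (∀ k, b ≤ k → S k = []) → C.Holds r S x →
        ∃ t ≤ P.eval (C.s x), Exec c S (Function.update S o (f x)) t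

variable {α α' : Type} {C : Ctx α}

theorem Ctx.Bdd.mono {g g' : α → ℕ} (h : C.Bdd g) (hg : ∀ x ∈ C.D, g' x ≤ g x) : C.Bdd g' :=
  h.imp fun _ hP x hx => (hg x hx).trans (hP x hx)

theorem Ctx.Bdd.add {g g' : α → ℕ} (h : C.Bdd g) (h' : C.Bdd g') :
    C.Bdd fun x => g x + g' x := by
  obtain ⟨P, hP⟩ := h
  obtain ⟨Q, hQ⟩ := h'
  exact ⟨P + Q, fun x hx => by simpa using add_le_add (hP x hx) (hQ x hx)⟩

theorem Ctx.Bdd.const (n : ℕ) : C.Bdd fun _ => n := ⟨Polynomial.C n, fun x hx => by simp⟩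

theorem Ctx.Holds.congr {r : List ℕ} {S S' : Store} {x : α} (h : C.Holds r S x)
    (hS : ∀ k ∈ r, S' k = S k) : C.Holds r S' x := by
  unfold Ctx.Holds at *
  have h2 := List.forall₂_iff_get.1 h
  refine List.forall₂_iff_get.2 ⟨h2.1, fun i hi hi' => ?_⟩
  rw [hS _ (List.get_mem _ _)]
  exact h2.2 i hi hi'

/-- Run the program on the concrete layout with the inputs in registers `0, 1, …` and the output in
the next one; the output cannot be longer than the running time. -/
theorem PT.bdd {f : α → List Γ'} (h : PT C f) : C.Bdd fun x => (f x).length := by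
  obtain ⟨P, hP⟩ := h
  obtain ⟨c, m, -, hc⟩ := hP (List.range C.V.length) C.V.length (C.V.length + 1) (by simp)
    (fun k hk => by have := List.mem_range.1 hk; omega) (by omega)
  refine ⟨P, fun x hx => ?_⟩
  obtain ⟨t, ht, he⟩ := hc (fun k => (C.V[k]?.map fun v => v x).getD []) x hx (by simp)
    (fun k hk => by
      rw [List.getElem?_eq_none (by omega)]; rfl)
    (by
      refine List.forall₂_iff_get.2 ⟨by simp, fun i hi hi' => ?_⟩
      simp at hi
      simp [hi])
  have := he.length_le C.V.length
  simp at this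
  exact this.trans ht

theorem PT.congr {f f' : α → List Γ'} (h : PT C f) (hf : ∀ x ∈ C.D, f x = f' x) : PT C f' := by
  obtain ⟨P, hP⟩ := h
  refine ⟨P, fun r o b h1 h2 h3 => ?_⟩
  obtain ⟨c, m, hm, hc⟩ := hP r o b h1 h2 h3
  refine ⟨c, m, hm, fun S x hx h4 h5 h6 => ?_⟩
  rw [← hf x hx]
  exact hc S x hx h4 h5 h6

/-- Each old input is, after substitution, one of the new inputs, so the register holding that one
serves for it. Registers may repeat in `r'`, which does no harm because input registers come back
unchanged. -/
theorem Ctx.exists_registers {r : List ℕ} {V : List (α → List Γ')} {V' : List (α' → List Γ')}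
    (φ : α' → α) (hr : r.length = V'.length) (hV : ∀ v ∈ V, v ∘ φ ∈ V') :
    ∃ r' : List ℕ, r'.length = V.length ∧ (∀ k ∈ r', k ∈ r) ∧ ∀ (S : Store) x,
      List.Forall₂ (fun k (v : α' → List Γ') => S k = v x) r V' →
        List.Forall₂ (fun k (v : α → List Γ') => S k = v (φ x)) r' V := by
  induction V with
  | nil => exact ⟨[], rfl, by simp, fun S x _ => .nil⟩
  | cons v V ih =>
    obtain ⟨r', h1, h2, h3⟩ := ih fun v hv => hV v (List.mem_cons_of_mem _ hv)
    obtain ⟨i, hi, hiv⟩ := List.getElem_of_mem (hV v List.mem_cons_self)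
    refine ⟨r[i] :: r', by simp [h1], ?_, fun S x h => ?_⟩
    · intro k hk
      rcases List.mem_cons.1 hk with rfl | hk
      · exact List.getElem_mem _
      · exact h2 k hk
    · refine .cons ?_ (h3 S x h)
      have := (List.forall₂_iff_get.1 h).2 i (hr ▸ hi) hi
      simp only [List.get_eq_getElem] at this
      rw [this, hiv]
      rfl

/-- Substitution, where the inputs of the old context are inputs of the new one. -/
theorem PT.comap {C' : Ctx α'} {f : α → List Γ'} (h : PT C f) (φ : α' → α)
    (hD : ∀ x ∈ C'.D, φ x ∈ C.D) (hs : ∀ x ∈ C'.D, C.s (φ x) = C'.s x)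
    (hV : ∀ v ∈ C.V, v ∘ φ ∈ C'.V) : PT C' fun x => f (φ x) := by
  obtain ⟨P, hP⟩ := h
  refine ⟨P, fun r o b h1 h2 h3 => ?_⟩
  obtain ⟨r', g1, g2, g3⟩ := Ctx.exists_registers φ h1 hV
  obtain ⟨c, m, hm, hc⟩ := hP r' o b g1 (fun k hk => h2 k (g2 k hk)) h3
  refine ⟨c, m, hm, fun S x hx h4 h5 h6 => ?_⟩
  rw [← hs x hx]
  exact hc S (φ x) (hD x hx) h4 h5 (g3 S x h6)

theorem PT.nil : PT C fun _ => [] :=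
  ⟨1, fun r o b _ _ _ => ⟨.skip, 0, trivial, fun S x _ h4 _ _ => ⟨1, by simp, by
    rw [show Function.update S o [] = S by rw [← h4, Function.update_eq_self]]
    exact .skip S⟩⟩⟩

theorem PT.cons {f : α → List Γ'} (a : Γ') (h : PT C f) : PT C fun x => a :: f x := by
  obtain ⟨P, hP⟩ := h
  refine ⟨P + 1, fun r o b h1 h2 h3 => ?_⟩
  obtain ⟨c, m, hm, hc⟩ := hP r o b h1 h2 h3
  refine ⟨.seq c (.push o a), max m b, ⟨hm.mono (le_max_left _ _), h3.trans_le (le_max_right _ _)⟩,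
    fun S x hx h4 h5 h6 => ?_⟩
  obtain ⟨t, ht, he⟩ := hc S x hx h4 h5 h6
  exact ⟨t + 1, by simpa using ht, (he.seq (.push o a _)).of_eq (by simp) rfl⟩

theorem PT.const (l : List Γ') : PT C fun _ => l := by
  induction l with
  | nil => exact .nil
  | cons a l ih => exact ih.cons a

theorem PT.tail {f : α → List Γ'} (h : PT C f) : PT C fun x => (f x).tail := by
  obtain ⟨P, hP⟩ := h
  refine ⟨P + 2, fun r o b h1 h2 h3 => ?_⟩
  obtain ⟨c, m, hm, hc⟩ := hP r o b h1 h2 h3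
  refine ⟨.seq c (.pop o .skip fun _ => .skip), max m b, ⟨hm.mono (le_max_left _ _),
    h3.trans_le (le_max_right _ _), trivial, fun _ => trivial⟩, fun S x hx h4 h5 h6 => ?_⟩
  obtain ⟨t, ht, he⟩ := hc S x hx h4 h5 h6
  refine ⟨t + 2, by simpa using ht, ?_⟩
  rcases hf : f x with _ | ⟨a, l⟩
  · rw [hf] at he
    have e1 : Exec (.pop o .skip fun _ => .skip) (Function.update S o []) (Function.update S o []) 2 :=
      .popNil (by simp) (.skip _)
    simpa [hf] using he.seq e1
  · rw [hf] at he
    exact (he.seq (.popCons (a := a) (l := l) (by simp) (.skip _))).of_eq (by simp [hf]) rfl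

/-- A stack can be read only by destroying it. Moving `k` to the scratch stack `b` reverses it, and
emptying `b` onto both `k` and `o` reverses it back, restoring `k` and copying it. -/
theorem exec_copy {k b o : ℕ} (hkb : k ≠ b) (hko : k ≠ o) (hob : o ≠ b) (S : Store)
    (hb : S b = []) :
    Exec (.seq (.move k b) (.loop b fun a => .seq (.push k a) (.push o a))) S
      (Function.update S o (S k ++ S o)) ((2 * (S k).length + 1) + (3 * (S k).length + 1)) := by
  have key : ∀ (l : List Γ') (T : Store), T b = l →
      Exec (.loop b fun a => .seq (.push k a) (.push o a)) T
        (Function.update (Function.update (Function.update T b []) k (l.reverse ++ T k)) o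
          (l.reverse ++ T o)) (3 * l.length + 1) := by
    intro l
    induction l with
    | nil =>
      intro T hT
      refine (Exec.loopNil hT).of_eq ?_ (by simp)
      funext j
      by_cases h : j = o <;> by_cases h' : j = k <;> by_cases h'' : j = b <;>
        simp_all [Function.update]
    | cons a l ih =>
      intro T hT
      have h1 := (Exec.push k a (Function.update T b l)).seq (.push o a _)
      have h2 := ih _ (by simp [Function.update, hkb.symm, hob.symm] :
        Function.update (Function.update (Function.update T b l) k (a :: (Function.update T b l) k))
          o (a :: (Function.update (Function.update T b l) k
            (a :: (Function.update T b l) k)) o) b = l)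
      refine (Exec.loopCons hT h1 h2).of_eq ?_ (by simp; ring)
      funext j
      by_cases h : j = o <;> by_cases h' : j = k <;> by_cases h'' : j = b <;>
        simp_all [Function.update]
  refine ((exec_move hkb S).seq (key (S k).reverse _ (by simp [hb]))).of_eq ?_ (by simp)
  funext j
  by_cases h : j = o <;> by_cases h' : j = k <;> by_cases h'' : j = b <;>
    simp_all [Function.update]

theorem PT.var {v : α → List Γ'} (hv : v ∈ C.V) (hb : C.Bdd fun x => (v x).length) : PT C v := by
  obtain ⟨P, hP⟩ := hb
  refine ⟨5 * P + 2, fun r o b h1 h2 h3 => ?_⟩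
  obtain ⟨i, hi, hiv⟩ := List.getElem_of_mem hv
  have hk := h2 r[i] (List.getElem_mem _)
  refine ⟨_, b + 1, ?_, fun S x hx h4 h5 h6 => ⟨_, ?_, (exec_copy (o := o) (k := r[i]) (b := b)
    (by omega) hk.2 (by omega) S (h5 b le_rfl)).of_eq ?_ rfl⟩⟩
  · simp only [Prog.Below, Prog.move]
    exact ⟨⟨by omega, fun _ => by omega⟩, by omega, fun _ => ⟨by omega, by omega⟩⟩
  · have : S r[i] = v x := by
      have := (List.forall₂_iff_get.1 h6).2 i (h1 ▸ hi) hi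
      simp only [List.get_eq_getElem] at this
      rw [this, hiv]
    rw [this]
    have : (v x).length ≤ P.eval (C.s x) := hP x hx
    simp
    omega
  · have : S r[i] = v x := by
      have := (List.forall₂_iff_get.1 h6).2 i (h1 ▸ hi) hi
      simp only [List.get_eq_getElem] at this
      rw [this, hiv]
    rw [this, h4, List.append_nil]

/-- Stacks grow at the front, so `g` is written to the output first. Then `f` is computed in the
scratch register `b` and moved twice, two reversals cancelling, on top of `g`. The composition is
sound because `PT` programs restore every register except the output, scratch registers included. -/
theorem PT.append {f g : α → List Γ'} (hf : PT C f) (hg : PT C g) :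
    PT C fun x => f x ++ g x := by
  obtain ⟨B, hB⟩ := hf.bdd
  obtain ⟨P, hP⟩ := hf
  obtain ⟨Q, hQ⟩ := hg
  refine ⟨P + Q + (4 * B + 2), fun r o b h1 h2 h3 => ?_⟩
  obtain ⟨c, m, hm, hc⟩ := hP r b (b + 1) h1 (fun k hk => by have := h2 k hk; omega) (by omega)
  obtain ⟨d, m', hm', hd⟩ := hQ r o b h1 h2 h3
  refine ⟨.seq d (.seq c (.seq (.move b (b + 1)) (.move (b + 1) o))), max (max m m') (b + 2),
    ⟨hm'.mono (by omega), hm.mono (by omega), ?_⟩, fun S x hx h4 h5 h6 => ?_⟩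
  · simp only [Prog.Below, Prog.move]
    exact ⟨⟨by omega, fun _ => by omega⟩, by omega, fun _ => by omega⟩
  obtain ⟨t, ht, he⟩ := hd S x hx h4 h5 h6
  obtain ⟨t', ht', he'⟩ := hc (Function.update S o (g x)) x hx
    (by rw [Function.update_of_ne (by omega)]; exact h5 b le_rfl)
    (fun k hk => by rw [Function.update_of_ne (by omega)]; exact h5 k (by omega))
    (h6.congr fun k hk => by rw [Function.update_of_ne (h2 k hk).2])
  have e1 := exec_move (k := b) (k' := b + 1) (by omega)
    (Function.update (Function.update S o (g x)) b (f x))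
  have e2 := exec_move (k := b + 1) (k' := o) (by omega) (Function.update
    (Function.update (Function.update (Function.update S o (g x)) b (f x)) b []) (b + 1)
      ((Function.update (Function.update S o (g x)) b (f x) b).reverse ++
        Function.update (Function.update S o (g x)) b (f x) (b + 1)))
  refine ⟨_, ?_, (he.seq (he'.seq (e1.seq e2))).of_eq ?_ rfl⟩
  · have : (f x).length ≤ B.eval (C.s x) := hB x hx
    have h7 := h5 (b + 1) (by omega)
    have h8 : b + 1 ≠ o := by omega
    simp [h7, h8]
    omega
  · have h7 := h5 (b + 1) (by omega)
    have h7' := h5 b (by omega)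
    have h8 : b + 1 ≠ o := by omega
    have h8' : o ≠ b := by omega
    funext j
    by_cases h : j = o
    · subst h
      rw [Function.update_self, Function.update_self]
      simp [Function.update_of_ne h8.symm, h7, h8, h8']
    rw [Function.update_of_ne h, Function.update_of_ne h]
    by_cases h'' : j = b + 1
    · subst h''
      rw [Function.update_self, h7]
    rw [Function.update_of_ne h'', Function.update_of_ne h'']
    by_cases h' : j = b
    · subst h'
      rw [Function.update_self, h7']
    rw [Function.update_of_ne h', Function.update_of_ne h', Function.update_of_ne h]

/-- Restriction of the domain. -/
def Ctx.res (C : Ctx α) (E : Set α) : Ctx α := ⟨C.D ∩ E, C.s, C.V⟩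

theorem PT.res {f : α → List Γ'} (h : PT C f) (E : Set α) : PT (C.res E) f :=
  h.comap (C' := C.res E) id (fun _ hx => hx.1) (fun _ _ => rfl) (fun _ hv => hv)

/-- Compute `g` in scratch space, pop its first symbol, discard the rest, and continue with the
program for that symbol. There are finitely many symbols, so the sum of the time bounds bounds every
branch. -/
theorem PT.cases {f g : α → List Γ'} (hg : PT C g)
    (hf : ∀ o : Option Γ', PT (C.res {x | (g x).head? = o}) f) : PT C f := by
  obtain ⟨B, hB⟩ := hg.bdd
  obtain ⟨Q, hQ⟩ := hg
  choose P hP using hf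
  refine ⟨∑ o, P o + (Q + (2 * B + 2)), fun r o b h1 h2 h3 => ?_⟩
  obtain ⟨d, m', hm', hd⟩ := hQ r b (b + 1) h1 (fun k hk => by have := h2 k hk; omega) (by omega)
  have := fun a => hP a r o b h1 h2 h3
  choose c m hm hc using this
  refine ⟨.seq d (.pop b (c none) fun a => .seq (.clear b) (c (some a))),
    max m' (b + 1 + ∑ o, m o), ?_, fun S x hx h4 h5 h6 => ?_⟩
  · have hle : ∀ o, m o ≤ ∑ o, m o := fun o =>
      Finset.single_le_sum (f := m) (fun _ _ => Nat.zero_le _) (Finset.mem_univ o)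
    refine ⟨hm'.mono (by omega), by omega, (hm none).mono ?_, fun a => ⟨⟨by omega, fun _ => trivial⟩,
      (hm (some a)).mono ?_⟩⟩
    · have := hle none; omega
    · have := hle (some a); omega
  have hle : (P (g x).head?).eval (C.s x) ≤ (∑ o, P o).eval (C.s x) := by
    rw [Polynomial.eval_finsetSum]
    exact Finset.single_le_sum (f := fun o => (P o).eval (C.s x)) (fun _ _ => Nat.zero_le _)
      (Finset.mem_univ _)
  obtain ⟨t, ht, he⟩ := hd S x hx (h5 b le_rfl) (fun k hk => h5 k (by omega)) h6
  obtain ⟨t', ht', he'⟩ := hc (g x).head? S x ⟨hx, rfl⟩ h4 h5 h6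
  have hbx : (g x).length ≤ B.eval (C.s x) := hB x hx
  have hback : Function.update S b [] = S := by rw [← h5 b le_rfl, Function.update_eq_self]
  rcases hgx : g x with _ | ⟨a, l⟩
  · rw [hgx] at he he' hle ht'
    rw [hback] at he
    refine ⟨_, ?_, he.seq (.popNil (h5 b le_rfl) he')⟩
    change t' ≤ (P _).eval (C.s x) at ht'
    simp only [Polynomial.eval_add, Polynomial.eval_mul, Polynomial.eval_ofNat]
    omega
  · rw [hgx] at he he' hle ht' hbx
    have e1 := exec_clear b (Function.update S b l)
    rw [Function.update_idem, hback] at e1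
    have e2 : Exec (.pop b (c none) fun a => .seq (.clear b) (c (some a))) _ _ _ :=
      .popCons (Function.update_self b (a :: l) S) (by rw [Function.update_idem]; exact e1.seq he')
    refine ⟨_, ?_, he.seq e2⟩
    change t' ≤ (P _).eval (C.s x) at ht'
    simp only [Polynomial.eval_add, Polynomial.eval_mul, Polynomial.eval_ofNat,
      Function.update_self, List.length_cons] at *
    omega

/-- The unary number `i`. -/
abbrev unary (i : ℕ) : List Γ' := List.replicate i (Γ'.bit true)

/-- The body context of an iteration along `l`: the index is a new input. -/
def Ctx.idx (C : Ctx α) (l : α → List Γ') : Ctx (α × ℕ) :=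
  ⟨{y | y.1 ∈ C.D ∧ y.2 < (l y.1).length}, fun y => C.s y.1,
    (fun y => unary y.2) :: C.V.map fun v y => v y.1⟩

/-- The body context of an iteration along `l` with an accumulator. -/
def Ctx.acc (C : Ctx α) (l : α → List Γ') (acc : α × ℕ → List Γ') : Ctx (α × ℕ) :=
  ⟨(C.idx l).D, (C.idx l).s, acc :: (C.idx l).V⟩

theorem PT.idx {f : α → List Γ'} (h : PT C f) (l : α → List Γ') :
    PT (C.idx l) fun y => f y.1 :=
  h.comap (C' := C.idx l) Prod.fst (fun _ hx => hx.1) (fun _ _ => rfl)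
    (fun v hv => List.mem_cons_of_mem _ (List.mem_map.2 ⟨v, hv, rfl⟩))

theorem PT.acc {l : α → List Γ'} {f : α × ℕ → List Γ'} (h : PT (C.idx l) f)
    (acc : α × ℕ → List Γ') : PT (C.acc l acc) f :=
  h.comap (C' := C.acc l acc) id (fun _ hx => hx) (fun _ _ => rfl)
    (fun _ hv => List.mem_cons_of_mem _ hv)

theorem PT.index {l : α → List Γ'} (hl : PT C l) : PT (C.idx l) fun y => unary y.2 := by
  refine .var List.mem_cons_self ?_
  obtain ⟨P, hP⟩ := hl.bdd
  refine ⟨P, fun y hy => ?_⟩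
  have : y.2 ≤ P.eval (C.s y.1) := hy.2.le.trans (hP y.1 hy.1)
  simpa [Ctx.idx] using this

theorem PT.accum {l : α → List Γ'} {acc : α × ℕ → List Γ'}
    (hb : (C.idx l).Bdd fun y => (acc y).length) : PT (C.acc l acc) acc :=
  .var List.mem_cons_self hb

/-- Bounded iteration: if `acc (x, j)` has polynomial length and `acc (x, j + 1)` is computed from
`acc (x, j)`, `j` and the inputs, then the final value of the accumulator is computed. -/
theorem PT.iterate {l : α → List Γ'} {acc : α × ℕ → List Γ'} (hl : PT C l)
    (h0 : PT C fun x => acc (x, 0)) (hb : (C.idx l).Bdd fun y => (acc y).length)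
    (hs : PT (C.acc l acc) fun y => acc (y.1, y.2 + 1)) :
    PT C fun x => acc (x, (l x).length) := by
  obtain ⟨L, hL⟩ := hl.bdd
  obtain ⟨B, hB⟩ := hb
  obtain ⟨B', hB'⟩ := hs.bdd
  obtain ⟨Pl, hPl⟩ := hl
  obtain ⟨P0, hP0⟩ := h0
  obtain ⟨Ps, hPs⟩ := hs
  -- One round runs the step (`Ps`), clears the old accumulator (`2 * B`) and moves the new one
  -- twice (`4 * B'`); the `10` generously covers the constant overhead. The final `2 * L + 1`
  -- clears the index.
  refine ⟨Pl + (P0 + ((L * (Ps + 2 * B + 4 * B' + 10) + 1) + (2 * L + 1))), fun r o b h1 h2 h3 => ?_⟩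
  obtain ⟨cl, ml, hml, hcl⟩ := hPl r b (b + 1) h1 (fun k hk => by have := h2 k hk; omega)
    (by omega)
  obtain ⟨c0, m0, hm0, hc0⟩ := hP0 r o (b + 1) h1 (fun k hk => by have := h2 k hk; omega)
    (by omega)
  -- The step reads the accumulator from `o` and the index from `b + 1`, and writes to `b + 2`; the
  -- register `b` holds the list that drives the loop.
  obtain ⟨cs, ms, hms, hcs⟩ := hPs (o :: (b + 1) :: r) (b + 2) (b + 3)
    (by simp [Ctx.acc, Ctx.idx, h1])
    (fun k hk => by
      simp only [List.mem_cons] at hk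
      rcases hk with rfl | rfl | hk
      · omega
      · omega
      · have := h2 k hk; omega) (by omega)
  let body : Prog := .seq cs (.seq (.clear o) (.seq (.move (b + 2) (b + 3))
    (.seq (.move (b + 3) o) (.push (b + 1) (Γ'.bit true)))))
  refine ⟨.seq cl (.seq c0 (.seq (.loop b fun _ => body) (.clear (b + 1)))),
    max (max ml m0) (max ms (b + 4)), ⟨hml.mono (by omega), hm0.mono (by omega), ⟨by omega, fun _ =>
      ⟨hms.mono (by omega), ?_⟩⟩, by omega, fun _ => trivial⟩, fun S x hx h4 h5 h6 => ?_⟩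
  · simp only [Prog.Below, Prog.move, Prog.clear]
    exact ⟨⟨by omega, fun _ => trivial⟩, ⟨by omega, fun _ => by omega⟩,
      ⟨by omega, fun _ => by omega⟩, by omega⟩
  -- The loop invariant: before round `j` the output holds the accumulator, `b` the unread part of
  -- `l x`, and `b + 1` the index in unary.
  let T : ℕ → Store := fun j => Function.update (Function.update (Function.update S o (acc (x, j)))
    b ((l x).drop j)) (b + 1) (unary j)
  have hTo : ∀ j, T j o = acc (x, j) := fun j => by
    have h8 : o ≠ b + 1 := by omega
    have h8' : o ≠ b := by omega
    simp [T, Function.update, h8, h8']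
  have hTb : ∀ j, T j b = (l x).drop j := fun j => by simp [T, Function.update]
  have hTb1 : ∀ j, T j (b + 1) = unary j := fun j => by simp [T]
  have hTr : ∀ j k, k ≠ o → k ≠ b → k ≠ b + 1 → T j k = S k := fun j k a1 a2 a3 => by
    simp [T, Function.update, a1, a2, a3]
  set K := (Ps + 2 * B + 4 * B' + 10).eval (C.s x) with hK
  have hbody : ∀ j < (l x).length, ∃ t ≤ K - 1,
      Exec body (Function.update (T j) b ((l x).drop (j + 1))) (T (j + 1)) t := by
    intro j hj
    set U := Function.update (T j) b ((l x).drop (j + 1)) with hU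
    have hUr : ∀ k, k ≠ b → U k = T j k := fun k hk => by rw [hU, Function.update_of_ne hk]
    have hUb : U b = (l x).drop (j + 1) := by simp [hU]
    have hmem : (x, j) ∈ (C.acc l acc).D := ⟨hx, hj⟩
    obtain ⟨t, ht, he⟩ := hcs U (x, j) hmem
      (by rw [hUr _ (by omega), hTr j _ (by omega) (by omega) (by omega)]; exact h5 _ (by omega))
      (fun k hk => by
        rw [hUr _ (by omega), hTr j _ (by omega) (by omega) (by omega)]; exact h5 _ (by omega))
      (by
        refine .cons ?_ (.cons ?_ ?_)
        · rw [hUr _ (by omega), hTo]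
        · rw [hUr _ (by omega), hTb1]
        · refine List.forall₂_map_right_iff.2 ?_
          exact h6.congr fun k hk => by
            have := h2 k hk
            rw [hUr _ (by omega), hTr j _ this.2 (by omega) (by omega)])
    set U1 := Function.update U (b + 2) (acc (x, j + 1)) with hU1
    have e1 := exec_clear o U1
    set U2 := Function.update U1 o [] with hU2
    have e2 := exec_move (k := b + 2) (k' := b + 3) (by omega) U2
    have hU22 : U2 (b + 2) = acc (x, j + 1) := by
      rw [hU2, Function.update_of_ne (by omega), hU1, Function.update_self]
    have hU23 : U2 (b + 3) = [] := by
      rw [hU2, Function.update_of_ne (by omega), hU1, Function.update_of_ne (by omega),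
        hUr _ (by omega), hTr j _ (by omega) (by omega) (by omega)]
      exact h5 _ (by omega)
    rw [hU22, hU23, List.append_nil] at e2
    set U3 := Function.update (Function.update U2 (b + 2) []) (b + 3) (acc (x, j + 1)).reverse
      with hU3
    have e3 := exec_move (k := b + 3) (k' := o) (by omega) U3
    have hU33 : U3 (b + 3) = (acc (x, j + 1)).reverse := by rw [hU3, Function.update_self]
    have hU3o : U3 o = [] := by
      rw [hU3, Function.update_of_ne (by omega), Function.update_of_ne (by omega), hU2,
        Function.update_self]
    rw [hU33, hU3o, List.append_nil, List.reverse_reverse] at e3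
    set U4 := Function.update (Function.update U3 (b + 3) []) o (acc (x, j + 1)) with hU4
    have e4 := Exec.push (b + 1) (Γ'.bit true) U4
    refine ⟨_, ?_, (he.seq (e1.seq (e2.seq (e3.seq e4)))).of_eq ?_ rfl⟩
    · have q1 := hB (x, j) hmem
      have q2 := hB' (x, j) hmem
      have q3 : U1 o = acc (x, j) := by
        rw [hU1, Function.update_of_ne (by omega), hUr _ (by omega), hTo]
      change t ≤ Ps.eval (C.s x) at ht
      change (acc (x, j)).length ≤ B.eval (C.s x) at q1
      change (acc (x, j + 1)).length ≤ B'.eval (C.s x) at q2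
      rw [q3]
      simp only [hK, Polynomial.eval_add, Polynomial.eval_mul, Polynomial.eval_ofNat,
        List.length_reverse]
      omega
    · funext k
      have s2 := h5 (b + 2) (by omega)
      have s3 := h5 (b + 3) (by omega)
      by_cases k0 : k = o
      · subst k0
        rw [Function.update_of_ne (by omega), hU4, Function.update_self, hTo]
      by_cases k1 : k = b + 1
      · subst k1
        rw [Function.update_self, hTb1, hU4, Function.update_of_ne (by omega),
          Function.update_of_ne (by omega), hU3, Function.update_of_ne (by omega),
          Function.update_of_ne (by omega), hU2, Function.update_of_ne (by omega), hU1,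
          Function.update_of_ne (by omega), hUr _ (by omega), hTb1]
        rfl
      rw [Function.update_of_ne k1, hU4, Function.update_of_ne k0]
      by_cases k3 : k = b + 3
      · subst k3
        rw [Function.update_self, hTr _ _ (by omega) (by omega) (by omega), s3]
      rw [Function.update_of_ne k3, hU3, Function.update_of_ne k3]
      by_cases k2 : k = b + 2
      · subst k2
        rw [Function.update_self, hTr _ _ (by omega) (by omega) (by omega), s2]
      rw [Function.update_of_ne k2, hU2, Function.update_of_ne k0, hU1, Function.update_of_ne k2]
      by_cases kb : k = b
      · subst kb
        rw [hUb, hTb]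
      rw [hUr _ kb, hTr _ _ k0 kb k1, hTr _ _ k0 kb k1]
  have hloop : ∀ i j, j + i = (l x).length → ∃ t ≤ i * K + 1,
      Exec (.loop b fun _ => body) (T j) (T (l x).length) t := by
    intro i
    induction i with
    | zero =>
      intro j hj
      rw [add_zero] at hj
      subst hj
      exact ⟨1, by omega, .loopNil (by rw [hTb]; simp)⟩
    | succ i ih =>
      intro j hj
      obtain ⟨t, ht, he⟩ := hbody j (by omega)
      obtain ⟨t', ht', he'⟩ := ih (j + 1) (by omega)
      refine ⟨t + t' + 1, ?_, .loopCons (a := (l x)[j]'(by omega)) (l := (l x).drop (j + 1)) ?_ he he'⟩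
      · have : 1 ≤ K := by simp [hK]
        rw [add_mul, one_mul]
        omega
      · rw [hTb]; exact List.drop_eq_getElem_cons _
  obtain ⟨t1, ht1, e1⟩ := hcl S x hx (h5 b le_rfl) (fun k hk => h5 k (by omega)) h6
  obtain ⟨t2, ht2, e2⟩ := hc0 (Function.update S b (l x)) x hx
    (by rw [Function.update_of_ne (by omega)]; exact h4)
    (fun k hk => by rw [Function.update_of_ne (by omega)]; exact h5 k (by omega))
    (h6.congr fun k hk => by
      have := h2 k hk
      rw [Function.update_of_ne (by omega)])
  obtain ⟨t3, ht3, e3⟩ := hloop (l x).length 0 (by simp)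
  have hT0 : Function.update (Function.update S b (l x)) o (acc (x, 0)) = T 0 := by
    funext k
    have s1 := h5 (b + 1) (by omega)
    have h8 : o ≠ b + 1 := by omega
    have h8' : o ≠ b := by omega
    by_cases k0 : k = o
    · subst k0
      rw [Function.update_self, hTo]
    rw [Function.update_of_ne k0]
    by_cases kb : k = b
    · subst kb
      rw [Function.update_self, hTb]; simp
    rw [Function.update_of_ne kb]
    by_cases k1 : k = b + 1
    · subst k1
      rw [hTb1, s1]; rfl
    rw [hTr _ _ k0 kb k1]
  rw [hT0] at e2
  have e4 := exec_clear (b + 1) (T (l x).length)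
  refine ⟨_, ?_, (e1.seq (e2.seq (e3.seq e4))).of_eq ?_ rfl⟩
  · have hlx := hL x hx
    have : (l x).length * K ≤ L.eval (C.s x) * K := Nat.mul_le_mul_right _ hlx
    rw [hTb1]
    simp only [Polynomial.eval_add, Polynomial.eval_mul, List.length_replicate,
      Polynomial.eval_ofNat, Polynomial.eval_one] at *
    rw [← hK]
    omega
  · funext k
    have s1 := h5 (b + 1) (by omega)
    have s0 := h5 b (by omega)
    by_cases k1 : k = b + 1
    · subst k1
      rw [Function.update_self, Function.update_of_ne (by omega), s1]
    rw [Function.update_of_ne k1]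
    by_cases k0 : k = o
    · subst k0
      rw [Function.update_self, hTo]
    rw [Function.update_of_ne k0]
    by_cases kb : k = b
    · subst kb
      rw [hTb, s0]; simp
    rw [hTr _ _ k0 kb k1]

/-! ### Closure properties: iteration, unary numbers, truth values -/

/-- The accumulator is the concatenation so far; its length is at most the number of rounds times a
bound for one block. -/
theorem PT.flatMap {l : α → List Γ'} {f : α → ℕ → List Γ'} (hl : PT C l)
    (hf : PT (C.idx l) fun y => f y.1 y.2) :
    PT C fun x => (List.range (l x).length).flatMap (f x) := by
  have hb : (C.idx l).Bdd fun y => ((List.range y.2).flatMap (f y.1)).length := by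
    obtain ⟨P, hP⟩ := hf.bdd
    obtain ⟨Q, hQ⟩ := hl.bdd
    refine ⟨Q * P, fun y hy => ?_⟩
    have : ((List.range y.2).flatMap (f y.1)).length ≤ y.2 * P.eval (C.s y.1) := by
      rw [List.length_flatMap]
      refine (List.sum_le_card_nsmul _ (P.eval (C.s y.1)) ?_).trans (by simp)
      intro k hk
      obtain ⟨j, hj, rfl⟩ := List.mem_map.1 hk
      exact hP (y.1, j) ⟨hy.1, (List.mem_range.1 hj).trans hy.2⟩
    simpa [Ctx.idx] using this.trans (Nat.mul_le_mul_right _ (hy.2.le.trans (hQ y.1 hy.1)))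
  refine PT.iterate (acc := fun y => (List.range y.2).flatMap (f y.1)) hl ?_ hb ?_
  · exact PT.nil.congr fun x _ => by simp
  · exact ((PT.accum hb).append (hf.acc _)).congr fun y _ => by simp [List.range_succ]

/-- Prepending each block instead of appending it gives the reverse order, which is what writing
down inverse circuits requires. -/
theorem PT.flatMap_reverse {l : α → List Γ'} {f : α → ℕ → List Γ'} (hl : PT C l)
    (hf : PT (C.idx l) fun y => f y.1 y.2) :
    PT C fun x => (List.range (l x).length).reverse.flatMap (f x) := by
  have hb : (C.idx l).Bdd fun y => ((List.range y.2).reverse.flatMap (f y.1)).length := by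
    obtain ⟨P, hP⟩ := hf.bdd
    obtain ⟨Q, hQ⟩ := hl.bdd
    refine ⟨Q * P, fun y hy => ?_⟩
    have : ((List.range y.2).reverse.flatMap (f y.1)).length ≤ y.2 * P.eval (C.s y.1) := by
      rw [List.length_flatMap]
      refine (List.sum_le_card_nsmul _ (P.eval (C.s y.1)) ?_).trans (by simp)
      intro k hk
      obtain ⟨j, hj, rfl⟩ := List.mem_map.1 hk
      exact hP (y.1, j) ⟨hy.1, (List.mem_range.1 (List.mem_reverse.1 hj)).trans hy.2⟩
    simpa [Ctx.idx] using this.trans (Nat.mul_le_mul_right _ (hy.2.le.trans (hQ y.1 hy.1)))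
  refine PT.iterate (acc := fun y => (List.range y.2).reverse.flatMap (f y.1)) hl ?_ hb ?_
  · exact PT.nil.congr fun x _ => by simp
  · exact ((hf.acc _).append (PT.accum hb)).congr fun y _ => by simp [List.range_succ]

/-! ### Unary numbers and truth values. -/

/-- `f` is computed in unary. -/
def PTU (C : Ctx α) (f : α → ℕ) : Prop := PT C fun x => unary (f x)

/-- `b` is computed. -/
def PTB (C : Ctx α) (b : α → Bool) : Prop := PT C fun x => [Γ'.bit (b x)]

/-- The context of an iteration `j = 0, …, n x - 1`. -/
abbrev Ctx.upto (C : Ctx α) (n : α → ℕ) : Ctx (α × ℕ) := C.idx fun x => unary (n x)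

theorem Ctx.mem_upto {n : α → ℕ} {y : α × ℕ} : y ∈ (C.upto n).D ↔ y.1 ∈ C.D ∧ y.2 < n y.1 := by
  simp [Ctx.idx]

theorem PTU.flatMap {n : α → ℕ} {f : α → ℕ → List Γ'} (hn : PTU C n)
    (hf : PT (C.upto n) fun y => f y.1 y.2) : PT C fun x => (List.range (n x)).flatMap (f x) :=
  (PT.flatMap hn hf).congr fun x _ => by simp

theorem PTU.flatMap_reverse {n : α → ℕ} {f : α → ℕ → List Γ'} (hn : PTU C n)
    (hf : PT (C.upto n) fun y => f y.1 y.2) :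
    PT C fun x => (List.range (n x)).reverse.flatMap (f x) :=
  (PT.flatMap_reverse hn hf).congr fun x _ => by simp

/-- An inner iteration does not depend on the outer index. -/
theorem PT.inner {n m : α → ℕ} {f : α × ℕ → List Γ'} (h : PT (C.upto n) f) :
    PT ((C.upto m).upto fun y => n y.1) fun z => f (z.1.1, z.2) := by
  refine h.comap (C' := (C.upto m).upto fun y => n y.1) (fun z => (z.1.1, z.2))
    (fun z hz => ?_) (fun _ _ => rfl) (fun v hv => ?_)
  · simp only [Ctx.mem_upto] at hz ⊢
    exact ⟨hz.1.1, hz.2⟩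
  · rcases List.mem_cons.1 hv with rfl | hv
    · exact List.mem_cons_self
    · obtain ⟨w, hw, rfl⟩ := List.mem_map.1 hv
      exact List.mem_cons_of_mem _ (List.mem_map.2 ⟨_, List.mem_cons_of_mem _
        (List.mem_map.2 ⟨w, hw, rfl⟩), rfl⟩)

theorem PTU.congr {f f' : α → ℕ} (h : PTU C f) (hf : ∀ x ∈ C.D, f x = f' x) : PTU C f' :=
  PT.congr h fun x hx => by rw [hf x hx]

theorem PTB.congr {f f' : α → Bool} (h : PTB C f) (hf : ∀ x ∈ C.D, f x = f' x) : PTB C f' :=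
  PT.congr h fun x hx => by rw [hf x hx]

theorem PTU.up {f n : α → ℕ} (h : PTU C f) : PTU (C.upto n) fun y => f y.1 := PT.idx h _

theorem PT.up {f : α → List Γ'} {n : α → ℕ} (h : PT C f) : PT (C.upto n) fun y => f y.1 :=
  PT.idx h _

theorem PTU.index {n : α → ℕ} (h : PTU C n) : PTU (C.upto n) fun y => y.2 := PT.index h

theorem PTU.const (n : ℕ) : PTU C fun _ => n := PT.const _

theorem PTU.add {f g : α → ℕ} (hf : PTU C f) (hg : PTU C g) : PTU C fun x => f x + g x :=
  (PT.append hf hg).congr fun x _ => by simp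

theorem PTU.mul {f g : α → ℕ} (hf : PTU C f) (hg : PTU C g) : PTU C fun x => f x * g x :=
  (PTU.flatMap hf (f := fun x _ => unary (g x)) (PTU.up hg)).congr fun x _ => by
    rw [List.flatMap_def, List.map_const', List.length_range]
    simp [unary]

theorem PT.length {l : α → List Γ'} (hl : PT C l) : PTU C fun x => (l x).length :=
  (PT.flatMap hl (f := fun _ _ => [Γ'.bit true]) (PT.const _)).congr fun x _ => by
    rw [List.flatMap_def, List.map_const', List.length_range]
    simp [unary]

/-- Iterate `tail`; on unary numbers this yields truncated subtraction. -/
theorem PT.drop {f : α → List Γ'} {n : α → ℕ} (hf : PT C f) (hn : PTU C n) :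
    PT C fun x => (f x).drop (n x) := by
  have hb : (C.upto n).Bdd fun y => ((f y.1).drop y.2).length :=
    (hf.up (n := n)).bdd.mono fun y _ => by simp
  exact (PT.iterate (acc := fun y => (f y.1).drop y.2) hn (by simpa using hf) hb
    ((PT.accum hb).tail.congr fun y _ => by simp)).congr fun x _ => by simp

theorem PTU.sub {f g : α → ℕ} (hf : PTU C f) (hg : PTU C g) : PTU C fun x => f x - g x :=
  (PT.drop hf hg).congr fun x _ => by simp

/-- The truth value of the first symbol. -/
def headBit : Option Γ' → Bool
  | some (Γ'.bit b) => b
  | _ => false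

theorem PT.headBit {f : α → List Γ'} (h : PT C f) : PTB C fun x => headBit (f x).head? :=
  PT.cases h fun o => (PT.const [Γ'.bit (QNR.headBit o)]).congr fun x hx => by
    simp only [show (f x).head? = o from hx.2]

theorem PTB.getD {l : α → List Bool} {i : α → ℕ} (hl : PT C fun x => (l x).map Γ'.bit)
    (hi : PTU C i) : PTB C fun x => (l x).getD (i x) false :=
  (hl.drop hi).headBit.congr fun x _ => by
    rw [List.head?_drop, List.getElem?_map, List.getD_eq_getElem?_getD]
    cases (l x)[i x]? <;> rfl

/-- A branch needs to be computable only where it is taken. This matters for `PTN.encodeInt_sub`,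
since `PTN.sub` is available only where the subtraction does not truncate. -/
theorem PTB.cond {b : α → Bool} {f g : α → List Γ'} (hb : PTB C b)
    (hf : PT (C.res {x | b x = true}) f) (hg : PT (C.res {x | b x = false}) g) :
    PT C fun x => if b x then f x else g x := by
  refine PT.cases hb fun o => ?_
  by_cases ho : o = some (Γ'.bit true)
  · refine (hf.comap (C' := C.res {x | [Γ'.bit (b x)].head? = o}) id (fun x hx => ⟨hx.1, ?_⟩)
      (fun _ _ => rfl) (fun _ hv => hv)).congr fun x hx => ?_
    all_goals
      have := hx.2
      simp [ho] at this
      simp [this]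
  by_cases ho' : o = some (Γ'.bit false)
  · refine (hg.comap (C' := C.res {x | [Γ'.bit (b x)].head? = o}) id (fun x hx => ⟨hx.1, ?_⟩)
      (fun _ _ => rfl) (fun _ hv => hv)).congr fun x hx => ?_
    all_goals
      have := hx.2
      simp [ho'] at this
      simp [this]
  · refine PT.nil.congr fun x hx => ?_
    have := hx.2
    simp only [List.head?_cons, Set.mem_ofPred_eq] at this
    cases hbx : b x <;> rw [hbx] at this <;> simp_all

theorem PTB.ite {b : α → Bool} {f g : α → List Γ'} (hb : PTB C b) (hf : PT C f) (hg : PT C g) :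
    PT C fun x => if b x then f x else g x := hb.cond (hf.res _) (hg.res _)

theorem PTB.const (b : Bool) : PTB C fun _ => b := PT.const _

theorem PTB.comp {a : α → Bool} (F : Bool → Bool) (ha : PTB C a) : PTB C fun x => F (a x) :=
  (ha.ite (PT.const [Γ'.bit (F true)]) (PT.const [Γ'.bit (F false)])).congr fun x _ => by
    cases h : a x <;> simp [h]

theorem PTB.comp₂ {a b : α → Bool} (F : Bool → Bool → Bool) (ha : PTB C a) (hb : PTB C b) :
    PTB C fun x => F (a x) (b x) :=
  (ha.ite (hb.comp (F true)) (hb.comp (F false))).congr fun x _ => by cases h : a x <;> simp [h]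

theorem PTB.comp₃ {a b c : α → Bool} (F : Bool → Bool → Bool → Bool) (ha : PTB C a) (hb : PTB C b)
    (hc : PTB C c) : PTB C fun x => F (a x) (b x) (c x) :=
  (ha.ite (hb.comp₂ (F true) hc) (hb.comp₂ (F false) hc)).congr fun x _ => by cases h : a x <;> simp [h]

theorem PTU.pos {n : α → ℕ} (hn : PTU C n) : PTB C fun x => decide (0 < n x) :=
  (PT.headBit hn).congr fun x _ => by
    cases n x <;> simp [QNR.headBit, unary, List.replicate_succ]

theorem PTU.lt {m n : α → ℕ} (hm : PTU C m) (hn : PTU C n) : PTB C fun x => decide (m x < n x) :=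
  (hn.sub hm).pos.congr fun x _ => by simp

/-- Boolean recursion. -/
theorem PTB.iterate {n : α → ℕ} {c : α → ℕ → Bool} (hn : PTU C n) (h0 : PTB C fun x => c x 0)
    (hs : PTB (C.acc (fun x => unary (n x)) fun y => [Γ'.bit (c y.1 y.2)])
        (fun y => c y.1 y.2) →
      PTB (C.acc (fun x => unary (n x)) fun y => [Γ'.bit (c y.1 y.2)])
        fun y => c y.1 (y.2 + 1)) :
    PTB C fun x => c x (n x) :=
  (PT.iterate (acc := fun y => [Γ'.bit (c y.1 y.2)]) hn h0 (.const 1)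
    (hs (PT.accum (.const 1)))).congr fun x _ => by simp

theorem PTB.any {n : α → ℕ} {b : α → ℕ → Bool} (hn : PTU C n)
    (hb : PTB (C.upto n) fun y => b y.1 y.2) : PTB C fun x => (List.range (n x)).any (b x) :=
  PTB.iterate (c := fun x j => (List.range j).any (b x)) hn
    ((PTB.const false).congr fun x _ => by simp) fun h =>
      (h.comp₂ or (PT.acc hb _)).congr fun y _ => by simp [List.range_succ, List.any_append]

/-! ### Binary arithmetic -/

/-- Binary numerals are little-endian without leading zeros. The value `0` is excluded because its
code is the empty list. -/
theorem encodeNat_bit (b : Bool) (m : ℕ) (h : Nat.bit b m ≠ 0) :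
    Computability.encodeNat (Nat.bit b m) = b :: Computability.encodeNat m := by
  unfold Computability.encodeNat
  have e : ∀ k : ℕ, (k : Num) = Num.ofNat' k := fun k => by rw [Num.ofNat'_eq]
  rw [e, e, Num.ofNat'_bit]
  cases b
  · cases hm : Num.ofNat' m with
    | zero =>
      exfalso
      apply h
      rw [← e] at hm
      have : m = 0 := by
        have := congrArg (fun z : Num => (z : ℕ)) hm
        simpa using this
      simp [this]
    | pos q => rfl
  · cases hm : Num.ofNat' m with
    | zero => rfl
    | pos q => rfl

theorem encodeNat_eq (m : ℕ) :
    Computability.encodeNat m = (List.range m.size).map m.testBit := by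
  induction m using Nat.binaryRec' with
  | zero => rfl
  | bit b m h ih =>
    have h0 : Nat.bit b m ≠ 0 := by
      intro h1
      rw [Nat.bit_eq_zero_iff] at h1
      have := h h1.1
      simp [this] at h1
    rw [encodeNat_bit b m h0, Nat.size_bit h0, ih, Nat.succ_eq_add_one, List.range_succ_eq_map,
      List.map_cons, Nat.testBit_bit_zero, List.map_map]
    congr 1
    exact List.map_congr_left fun i _ => (Nat.testBit_bit_succ ..).symm

theorem length_encodeNat (m : ℕ) : (Computability.encodeNat m).length = m.size := by
  simp [encodeNat_eq]

theorem getD_encodeNat (m i : ℕ) : (Computability.encodeNat m).getD i false = m.testBit i := by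
  rw [encodeNat_eq]
  by_cases h : i < m.size
  · simp [h]
  · rw [Nat.testBit_lt_two_pow (Nat.size_le.1 (not_lt.1 h))]
    simp [h]

/-- `f` is computed in binary. -/
def PTN (C : Ctx α) (f : α → ℕ) : Prop :=
  PT C fun x => (Computability.encodeNat (f x)).map Γ'.bit

theorem PTN.congr {f f' : α → ℕ} (h : PTN C f) (hf : ∀ x ∈ C.D, f x = f' x) : PTN C f' :=
  PT.congr h fun x hx => by rw [hf x hx]

theorem PTN.size {f : α → ℕ} (h : PTN C f) : PTU C fun x => (f x).size :=
  (PT.length h).congr fun x _ => by rw [List.length_map, length_encodeNat]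

theorem PTN.testBit {f i : α → ℕ} (h : PTN C f) (hi : PTU C i) :
    PTB C fun x => (f x).testBit (i x) :=
  (PTB.getD h hi).congr fun _ _ => getD_encodeNat _ _

theorem PTN.up {f n : α → ℕ} (h : PTN C f) : PTN (C.upto n) fun y => f y.1 := PT.idx h _

theorem PTN.res {f : α → ℕ} (h : PTN C f) (E : Set α) : PTN (C.res E) f := PT.res h E

/-- Position `j` precedes the leading zeros exactly when some digit at or above `j` is set; this
makes the size computable by a bounded search through the digits. -/
theorem lt_size_iff_exists_testBit {m L j : ℕ} (hm : m < 2 ^ L) :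
    j < m.size ↔ ∃ k < L, j ≤ k ∧ m.testBit k = true := by
  rw [Nat.lt_size]
  constructor
  · intro h
    obtain ⟨k, hk, hk'⟩ := Nat.exists_ge_and_testBit_of_ge_two_pow h
    refine ⟨k, ?_, hk, hk'⟩
    by_contra hL
    rw [Nat.testBit_lt_two_pow (hm.trans_le (Nat.pow_le_pow_right (by norm_num) (not_lt.1 hL)))]
      at hk'
    exact absurd hk' (by simp)
  · rintro ⟨k, -, hk, hk'⟩
    exact (Nat.pow_le_pow_right (by norm_num) hk).trans (Nat.ge_two_pow_of_testBit hk')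

/-- A number is computed if its binary digits are. -/
theorem PTN.of_testBit {f L : α → ℕ} (hL : PTU C L) (hf : ∀ x ∈ C.D, f x < 2 ^ L x)
    (hb : PTB (C.upto L) fun y => (f y.1).testBit y.2) : PTN C f := by
  have h1 : PTB (C.upto L) fun y =>
      (List.range (L y.1)).any fun k => !decide (k < y.2) && (f y.1).testBit k := by
    refine PTB.any (n := fun y : α × ℕ => L y.1)
      (b := fun y k => !decide (k < y.2) && (f y.1).testBit k) hL.up ?_
    refine PTB.comp₂ (fun a b => !a && b) (PTU.lt ?_ ?_) ?_
    · exact PTU.index hL.up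
    · exact PTU.up hL.index
    · exact PT.inner hb
  -- Write digit `j` only if a set digit at or above `j` remains, so that leading zeros below the
  -- bound `L x` are suppressed.
  refine (PTU.flatMap (f := fun x j => if (List.range (L x)).any fun k =>
    !decide (k < j) && (f x).testBit k then [Γ'.bit ((f x).testBit j)] else []) hL
    (h1.ite hb PT.nil)).congr fun x hx => ?_
  have hfx := hf x hx
  have h2 : ∀ j, ((List.range (L x)).any fun k => !decide (k < j) && (f x).testBit k) =
      decide (j < (f x).size) := fun j => by
    rw [Bool.eq_iff_iff, decide_eq_true_iff, lt_size_iff_exists_testBit hfx]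
    simp
  simp only [h2]
  rw [encodeNat_eq, List.map_map]
  have h3 : (f x).size ≤ L x := Nat.size_le.2 hfx
  obtain ⟨d, hd⟩ := Nat.exists_eq_add_of_le h3
  rw [hd, List.range_add, List.flatMap_append]
  rw [show (List.map (fun x_1 => (f x).size + x_1) (List.range d)).flatMap (fun j =>
      if decide (j < (f x).size) = true then [Γ'.bit ((f x).testBit j)] else []) = [] by
    rw [List.flatMap_eq_nil_iff]
    intro k hk
    obtain ⟨i, -, rfl⟩ := List.mem_map.1 hk
    simp]
  rw [List.append_nil, List.map_eq_flatMap]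
  refine List.flatMap_congr fun j hj => ?_
  simp [List.mem_range.1 hj]

theorem PTN.of_unary {f : α → ℕ} (hf : PTU C f) : PTN C fun x => 2 ^ f x :=
  PTN.of_testBit (L := fun x => f x + 1) (hf.add (.const 1))
    (fun x _ => Nat.pow_lt_pow_right (by norm_num) (by omega))
    ((PTB.comp₂ (fun a b => !a && !b) (PTU.lt (hf.up) (PTU.index (hf.add (.const 1))))
      (PTU.lt (PTU.index (hf.add (.const 1))) hf.up)).congr fun y _ => by
        rw [Nat.testBit_two_pow]
        by_cases h : f y.1 = y.2
        · simp [h]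
        · have : f y.1 < y.2 ∨ y.2 < f y.1 := by omega
          rcases this with h' | h' <;> simp [h, h'])

/-! ### Addition, subtraction, comparison and multiplication digit by digit. -/

/-- The borrow into digit `j` of `a - b`. -/
def borrow (a b j : ℕ) : Bool := decide (a % 2 ^ j < b % 2 ^ j)

/-- The majority of three truth values. -/
def maj (x y z : Bool) : Bool := (x && y) ^^ (x && z) ^^ (y && z)

@[simp] theorem borrow_zero (a b : ℕ) : borrow a b 0 = false := by
  simp [borrow, Nat.mod_one]

/-- Turns statements about single digits into linear relations between remainders, within reach of
`omega`. -/
theorem testBit_cases (a j : ℕ) :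
    (a.testBit j = true ∧ a % 2 ^ (j + 1) = a % 2 ^ j + 2 ^ j) ∨
      (a.testBit j = false ∧ a % 2 ^ (j + 1) = a % 2 ^ j) := by
  rw [Nat.mod_pow_succ, Nat.testBit_eq_decide_div_mod_eq]
  rcases Nat.mod_two_eq_zero_or_one (a / 2 ^ j) with h | h
  · right; simp [h]
  · left; simp [h]

/-- A borrow leaves position `j` when at least two of the following hold: the digit of `a` is `0`,
the digit of `b` is `1`, a borrow comes in. -/
theorem borrow_succ (a b j : ℕ) :
    borrow a b (j + 1) = maj (!a.testBit j) (b.testBit j) (borrow a b j) := by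
  have ha := Nat.mod_lt a (Nat.two_pow_pos j)
  have hb := Nat.mod_lt b (Nat.two_pow_pos j)
  have h2 : borrow a b j = decide (a % 2 ^ j < b % 2 ^ j) := rfl
  rcases testBit_cases a j with ⟨h, e⟩ | ⟨h, e⟩ <;> rcases testBit_cases b j with ⟨h', e'⟩ | ⟨h', e'⟩ <;>
    by_cases hlt : a % 2 ^ j < b % 2 ^ j <;>
    simp [maj, borrow, h, h', e, e', hlt] <;> omega

/-- The carry into digit `j` of `a + b` equals the borrow into digit `j` of `(a + b) - b`: both say
that the low part of the sum has wrapped around. One notion thus serves addition and subtraction. -/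
theorem testBit_add_eq (a b j : ℕ) :
    (a + b).testBit j = (a.testBit j ^^ b.testBit j ^^ borrow (a + b) b j) := by
  have ha := Nat.mod_lt a (Nat.two_pow_pos j)
  have hb := Nat.mod_lt b (Nat.two_pow_pos j)
  have hc := Nat.mod_lt (a + b) (Nat.two_pow_pos j)
  have e1 := Nat.add_mod a b (2 ^ j)
  have e2 := Nat.add_mod a b (2 ^ (j + 1))
  have hp : 2 ^ (j + 1) = 2 * 2 ^ j := by ring
  have e3 : (a % 2 ^ j + b % 2 ^ j < 2 ^ j ∧ (a + b) % 2 ^ j = a % 2 ^ j + b % 2 ^ j) ∨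
      (2 ^ j ≤ a % 2 ^ j + b % 2 ^ j ∧ (a + b) % 2 ^ j = a % 2 ^ j + b % 2 ^ j - 2 ^ j) := by
    rcases lt_or_ge (a % 2 ^ j + b % 2 ^ j) (2 ^ j) with h | h
    · left; exact ⟨h, by rw [e1, Nat.mod_eq_of_lt h]⟩
    · right; exact ⟨h, by rw [e1, Nat.mod_eq_sub_mod h, Nat.mod_eq_of_lt (by omega)]⟩
  have hc2 := Nat.mod_lt (a + b) (Nat.two_pow_pos (j + 1))
  have ha2 := Nat.mod_lt a (Nat.two_pow_pos (j + 1))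
  have hb2 := Nat.mod_lt b (Nat.two_pow_pos (j + 1))
  have e4 : (a % 2 ^ (j + 1) + b % 2 ^ (j + 1) < 2 ^ (j + 1) ∧
        (a + b) % 2 ^ (j + 1) = a % 2 ^ (j + 1) + b % 2 ^ (j + 1)) ∨
      (2 ^ (j + 1) ≤ a % 2 ^ (j + 1) + b % 2 ^ (j + 1) ∧
        (a + b) % 2 ^ (j + 1) = a % 2 ^ (j + 1) + b % 2 ^ (j + 1) - 2 ^ (j + 1)) := by
    rcases lt_or_ge (a % 2 ^ (j + 1) + b % 2 ^ (j + 1)) (2 ^ (j + 1)) with h | h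
    · left; exact ⟨h, by rw [e2, Nat.mod_eq_of_lt h]⟩
    · right; exact ⟨h, by rw [e2, Nat.mod_eq_sub_mod h, Nat.mod_eq_of_lt (by omega)]⟩
  rcases testBit_cases a j with ⟨h, e⟩ | ⟨h, e⟩ <;>
    rcases testBit_cases b j with ⟨h', e'⟩ | ⟨h', e'⟩ <;>
    rcases testBit_cases (a + b) j with ⟨h'', e''⟩ | ⟨h'', e''⟩ <;>
    simp only [h, h', h'', borrow] <;> simp <;> omega

theorem testBit_sub_eq {a b : ℕ} (h : b ≤ a) (j : ℕ) :
    (a - b).testBit j = (a.testBit j ^^ b.testBit j ^^ borrow a b j) := by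
  have := testBit_add_eq (a - b) b j
  rw [Nat.sub_add_cancel h] at this
  rw [this]
  cases (a - b).testBit j <;> cases b.testBit j <;> cases borrow a b j <;> rfl

theorem borrow_add_succ (a b j : ℕ) : borrow (a + b) b (j + 1) =
    maj (a.testBit j) (b.testBit j) (borrow (a + b) b j) := by
  rw [borrow_succ, testBit_add_eq]
  cases a.testBit j <;> cases b.testBit j <;> cases borrow (a + b) b j <;> rfl

/-- Beyond the top digit the borrow decides the comparison; machines and circuits both compare
numbers this way. -/
theorem borrow_of_lt {a b L : ℕ} (ha : a < 2 ^ L) (hb : b < 2 ^ L) :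
    borrow a b L = decide (a < b) := by
  rw [borrow, Nat.mod_eq_of_lt ha, Nat.mod_eq_of_lt hb]

theorem lt_two_pow_size_add (a b : ℕ) : a + b < 2 ^ (a.size + b.size + 1) := by
  have h1 := Nat.lt_size_self a
  have h2 := Nat.lt_size_self b
  have h3 : 2 ^ a.size ≤ 2 ^ (a.size + b.size) := Nat.pow_le_pow_right (by norm_num) (by omega)
  have h4 : 2 ^ b.size ≤ 2 ^ (a.size + b.size) := Nat.pow_le_pow_right (by norm_num) (by omega)
  rw [pow_succ]
  omega

theorem PTB.borrow_add {f g n : α → ℕ} (hf : PTN C f) (hg : PTN C g) (hn : PTU C n) :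
    PTB C fun x => borrow (f x + g x) (g x) (n x) :=
  PTB.iterate (c := fun x j => borrow (f x + g x) (g x) j) hn
    ((PTB.const false).congr fun x _ => by simp) fun h =>
      (PTB.comp₃ maj (PT.acc (hf.up.testBit hn.index) _) (PT.acc (hg.up.testBit hn.index) _)
        h).congr fun y _ => (borrow_add_succ _ _ _).symm

theorem PTB.borrow {f g n : α → ℕ} (hf : PTN C f) (hg : PTN C g) (hn : PTU C n) :
    PTB C fun x => borrow (f x) (g x) (n x) :=
  PTB.iterate (c := fun x j => QNR.borrow (f x) (g x) j) hn
    ((PTB.const false).congr fun x _ => by simp) fun h =>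
      (PTB.comp₃ (fun a b c => maj (!a) b c) (PT.acc (hf.up.testBit hn.index) _)
        (PT.acc (hg.up.testBit hn.index) _) h).congr fun y _ => (borrow_succ _ _ _).symm

theorem PTN.add {f g : α → ℕ} (hf : PTN C f) (hg : PTN C g) : PTN C fun x => f x + g x := by
  have hL : PTU C fun x => (f x).size + (g x).size + 1 := (hf.size.add hg.size).add (.const 1)
  exact PTN.of_testBit hL (fun x _ => lt_two_pow_size_add _ _)
    ((PTB.comp₃ (fun a b c => a ^^ b ^^ c) (hf.up.testBit hL.index) (hg.up.testBit hL.index)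
      (PTB.borrow_add hf.up hg.up hL.index)).congr fun y _ => (testBit_add_eq _ _ _).symm)

theorem PTN.sub {f g : α → ℕ} (hf : PTN C f) (hg : PTN C g) (h : ∀ x ∈ C.D, g x ≤ f x) :
    PTN C fun x => f x - g x :=
  PTN.of_testBit hf.size (fun _ _ => (Nat.sub_le _ _).trans_lt (Nat.lt_size_self _))
    ((PTB.comp₃ (fun a b c => a ^^ b ^^ c) (hf.up.testBit hf.size.index)
      (hg.up.testBit hf.size.index)
      (PTB.borrow hf.up hg.up hf.size.index)).congr fun _ hy =>
        (testBit_sub_eq (h _ (Ctx.mem_upto.1 hy).1) _).symm)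

theorem PTN.lt {f g : α → ℕ} (hf : PTN C f) (hg : PTN C g) :
    PTB C fun x => decide (f x < g x) :=
  (PTB.borrow hf hg ((hf.size.add hg.size).add (.const 1))).congr fun _ _ =>
    borrow_of_lt ((Nat.le_add_right _ _).trans_lt (lt_two_pow_size_add _ _))
      ((Nat.le_add_left _ _).trans_lt (lt_two_pow_size_add _ _))

theorem PTN.shiftLeft {f i : α → ℕ} (hf : PTN C f) (hi : PTU C i) :
    PTN C fun x => f x * 2 ^ i x := by
  have hL : PTU C fun x => (f x).size + i x := hf.size.add hi
  refine PTN.of_testBit hL (fun x _ => ?_) ((PTB.comp₂ (fun a b => !a && b)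
    (PTU.lt hL.index hi.up) (hf.up.testBit (hL.index.sub hi.up))).congr fun y _ => ?_)
  · rw [pow_add]
    exact Nat.mul_lt_mul_of_pos_right (Nat.lt_size_self _) (Nat.two_pow_pos _)
  · rw [← Nat.shiftLeft_eq, Nat.testBit_shiftLeft]
    by_cases h : y.2 < i y.1
    · simp [h]
    · simp [h, not_lt.1 h]

theorem PTN.zero : PTN C fun _ => 0 := PT.const _

theorem size_mul_le (a b : ℕ) : (a * b).size ≤ a.size + b.size := by
  rw [Nat.size_le, pow_add]
  exact Nat.mul_lt_mul_of_lt_of_lt (Nat.lt_size_self _) (Nat.lt_size_self _)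

/-- Schoolbook multiplication. The accumulator after `j` rounds is the product with the last `j`
digits of `g`, so its size never exceeds the sum of the two sizes. -/
theorem PTN.mul {f g : α → ℕ} (hf : PTN C f) (hg : PTN C g) : PTN C fun x => f x * g x := by
  have hb : (C.upto fun x => (g x).size).Bdd fun y =>
      ((Computability.encodeNat (f y.1 * (g y.1 % 2 ^ y.2))).map Γ'.bit).length := by
    refine (((PT.bdd hf.up).add (PT.bdd hg.up)) : (C.upto fun x => (g x).size).Bdd _).mono
      fun y _ => ?_
    simp only [List.length_map, length_encodeNat]
    exact (size_mul_le _ _).trans (Nat.add_le_add_left (Nat.size_le_size (Nat.mod_le _ _)) _)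
  refine (PT.iterate (acc := fun y => (Computability.encodeNat (f y.1 * (g y.1 % 2 ^ y.2))).map
    Γ'.bit) hg.size ?_ hb ?_).congr fun x _ => ?_
  · exact (PT.nil).congr fun x _ => by simp [Nat.mod_one]; rfl
  · have h1 : PTN (C.acc _ _) (fun y : α × ℕ => f y.1 * (g y.1 % 2 ^ y.2)) := PT.accum hb
    have h2 : PTN (C.acc (fun x => unary (g x).size) (fun y : α × ℕ =>
        (Computability.encodeNat (f y.1 * (g y.1 % 2 ^ y.2))).map Γ'.bit))
        (fun y : α × ℕ => if (g y.1).testBit y.2 then f y.1 * 2 ^ y.2 else 0) :=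
      PT.congr (PTB.ite (PT.acc (hg.up.testBit hg.size.index) _)
        (PT.acc (hf.up.shiftLeft hg.size.index) _) PTN.zero) fun y _ => by cases h : (g y.1).testBit y.2 <;> simp [h]
    refine (h1.add h2).congr fun y _ => ?_
    rcases testBit_cases (g y.1) y.2 with ⟨h, e⟩ | ⟨h, e⟩
    · rw [e, h]; simp [mul_add]
    · rw [e, h]; simp
  · simp only [List.length_replicate]
    rw [Nat.mod_eq_of_lt (Nat.lt_size_self _)]

/-! ### Runs of circuits -/

theorem getBit_of_lt {W : ℕ} (s : Fin W → Bool) {i : ℕ} (h : i < W) : getBit s i = s ⟨i, h⟩ := by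
  simp [getBit, h]

theorem getBit_setBit_of_ne {W : ℕ} (s : Fin W → Bool) {i j : ℕ} (h : j ≠ i) (b : Bool) :
    getBit (setBit s i b) j = getBit s j := by
  unfold getBit setBit
  split_ifs <;> simp_all

theorem getBit_setBit_self {W : ℕ} (s : Fin W → Bool) {i : ℕ} (h : i < W) (b : Bool) :
    getBit (setBit s i b) i = b := by
  simp [getBit, setBit, h]

theorem setBit_setBit {W : ℕ} (s : Fin W → Bool) (i : ℕ) (b b' : Bool) :
    setBit (setBit s i b) i b' = setBit s i b' := by
  funext j; simp only [setBit]; split_ifs <;> rfl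

theorem setBit_getBit {W : ℕ} (s : Fin W → Bool) (i : ℕ) : setBit s i (getBit s i) = s := by
  funext j
  simp only [setBit]
  split_ifs with h
  · subst h; simp [getBit]
  · rfl

theorem setBit_comm {W : ℕ} (s : Fin W → Bool) {i j : ℕ} (h : i ≠ j) (b b' : Bool) :
    setBit (setBit s i b) j b' = setBit (setBit s j b') i b := by
  funext k; simp only [setBit]; split_ifs <;> simp_all

theorem Gate.apply_add {W : ℕ} (g : Gate) (ψ φ : (Fin W → Bool) → ℂ) :
    g.apply W (ψ + φ) = g.apply W ψ + g.apply W φ := by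
  funext s
  simp only [Gate.apply, Pi.add_apply]
  split_ifs
  · simp only [mul_add, Finset.sum_add_distrib]
  · rfl

theorem Gate.apply_smul {W : ℕ} (g : Gate) (c : ℂ) (ψ : (Fin W → Bool) → ℂ) :
    g.apply W (c • ψ) = c • g.apply W ψ := by
  funext s
  simp only [Gate.apply, Pi.smul_apply, smul_eq_mul]
  split_ifs
  · rw [Finset.mul_sum]
    exact Finset.sum_congr rfl fun b _ => by ring
  · rfl

theorem Circuit.run_cons (W : ℕ) (g : Gate) (C : Circuit) (ψ : (Fin W → Bool) → ℂ) :
    Circuit.run W (g :: C) ψ = Circuit.run W C (g.apply W ψ) := rfl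

theorem Circuit.run_append (W : ℕ) (C C' : Circuit) (ψ : (Fin W → Bool) → ℂ) :
    Circuit.run W (C ++ C') ψ = Circuit.run W C' (Circuit.run W C ψ) := by
  simp [Circuit.run, List.foldl_append]

theorem Circuit.run_add (W : ℕ) (C : Circuit) (ψ φ : (Fin W → Bool) → ℂ) :
    C.run W (ψ + φ) = C.run W ψ + C.run W φ := by
  induction C generalizing ψ φ with
  | nil => rfl
  | cons g C ih => rw [Circuit.run_cons, Gate.apply_add, ih]; rfl

theorem Circuit.run_smul (W : ℕ) (C : Circuit) (c : ℂ) (ψ : (Fin W → Bool) → ℂ) :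
    C.run W (c • ψ) = c • C.run W ψ := by
  induction C generalizing ψ with
  | nil => rfl
  | cons g C ih => rw [Circuit.run_cons, Gate.apply_smul, ih]; rfl

/-- The action of a circuit as a linear map. -/
def Circuit.runLinear (W : ℕ) (C : Circuit) :
    ((Fin W → Bool) → ℂ) →ₗ[ℂ] ((Fin W → Bool) → ℂ) where
  toFun := C.run W
  map_add' := C.run_add W
  map_smul' := C.run_smul W

theorem Circuit.run_sum {ι : Type*} (W : ℕ) (C : Circuit) (I : Finset ι) (c : ι → ℂ)
    (ψ : ι → (Fin W → Bool) → ℂ) :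
    C.run W (∑ i ∈ I, c i • ψ i) = ∑ i ∈ I, c i • C.run W (ψ i) := by
  have := map_sum (C.runLinear W) (fun i => c i • ψ i) I
  simp only [map_smul] at this
  exact this

/-- The target is not a control, so changing the target bit does not affect whether the gate fires;
on the configurations where it does, the unitarity relation finishes the computation. -/
theorem Gate.apply_adjoint {W : ℕ} {g : Gate} (hg : g.WellFormed W) (ψ : (Fin W → Bool) → ℂ) :
    Gate.apply W ⟨g.controls, g.target, g.U.conjTranspose⟩ (g.apply W ψ) = ψ := by
  obtain ⟨ht, hc, -, hU⟩ := hg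
  funext s
  simp only [Gate.apply]
  by_cases h : ∀ c ∈ g.controls, getBit s c = true
  · have h' : ∀ b, ∀ c ∈ g.controls, getBit (setBit s g.target b) c = true := fun b c hcc => by
      rw [getBit_setBit_of_ne _ (hc c hcc).2]; exact h c hcc
    rw [if_pos h]
    simp only [if_pos (h' _), getBit_setBit_self s ht, setBit_setBit]
    have hUU : g.U.conjTranspose * g.U = 1 := by
      have := Matrix.mem_unitaryGroup_iff'.1 hU
      simpa [Matrix.star_eq_conjTranspose] using this
    have e : ∀ b', ∑ b, g.U.conjTranspose (getBit s g.target) b * g.U b b' =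
        if getBit s g.target = b' then 1 else 0 := fun b' => by
      have := congrFun (congrFun hUU (getBit s g.target)) b'
      rwa [Matrix.mul_apply, Matrix.one_apply] at this
    calc ∑ b, g.U.conjTranspose (getBit s g.target) b *
          ∑ b', g.U b b' * ψ (setBit s g.target b')
        = ∑ b', (∑ b, g.U.conjTranspose (getBit s g.target) b * g.U b b') *
            ψ (setBit s g.target b') := by
          simp only [Finset.mul_sum, Finset.sum_mul]
          rw [Finset.sum_comm]
          exact Finset.sum_congr rfl fun _ _ => Finset.sum_congr rfl fun _ _ => by ring
      _ = ψ s := by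
          simp only [e, ite_mul, one_mul, zero_mul, Finset.sum_ite_eq, Finset.mem_univ, if_true]
          rw [setBit_getBit]
  · rw [if_neg h, if_neg h]

theorem Circuit.run_inverse {W : ℕ} {C : Circuit} (hC : C.WellFormed W)
    (ψ : (Fin W → Bool) → ℂ) : C.inverse.run W (C.run W ψ) = ψ := by
  induction C generalizing ψ with
  | nil => rfl
  | cons g C ih =>
    have h1 : Circuit.inverse (g :: C) = Circuit.inverse C ++
        [⟨g.controls, g.target, g.U.conjTranspose⟩] := by
      simp [Circuit.inverse]
    rw [h1, Circuit.run_append, Circuit.run_cons W g C ψ, ih fun g' hg' => hC g' (List.mem_cons_of_mem _ hg')]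
    exact Gate.apply_adjoint (hC g List.mem_cons_self) ψ

theorem Gate.WellFormed.adjoint {W : ℕ} {g : Gate} (hg : g.WellFormed W) :
    Gate.WellFormed W ⟨g.controls, g.target, g.U.conjTranspose⟩ := by
  refine ⟨hg.1, hg.2.1, hg.2.2.1, ?_⟩
  rw [Matrix.mem_unitaryGroup_iff]
  have := Matrix.mem_unitaryGroup_iff'.1 hg.2.2.2
  simpa [Matrix.star_eq_conjTranspose] using this

theorem Circuit.WellFormed.inverse {W : ℕ} {C : Circuit} (hC : C.WellFormed W) :
    C.inverse.WellFormed W := by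
  intro g hg
  simp only [Circuit.inverse, List.mem_map, List.mem_reverse] at hg
  obtain ⟨g', hg', rfl⟩ := hg
  exact (hC g' hg').adjoint

theorem Circuit.WellFormed.append {W : ℕ} {C C' : Circuit} (hC : C.WellFormed W)
    (hC' : C'.WellFormed W) : Circuit.WellFormed W (C ++ C') := fun g hg =>
  (List.mem_append.1 hg).elim (hC g) (hC' g)

/-! ### Basis states and elementary unitary matrices. -/

/-- The basis state of `W` qubits given by a sequence of bits. -/
def basis (W : ℕ) (s : ℕ → Bool) : (Fin W → Bool) → ℂ := Pi.single (fun j : Fin W => s j) 1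

theorem ket_eq_basis (W x : ℕ) : ket W x = basis W x.testBit := rfl

theorem basis_apply {W : ℕ} (s : ℕ → Bool) (u : Fin W → Bool) :
    basis W s u = if u = (fun j : Fin W => s j) then 1 else 0 := by
  simp [basis, Pi.single_apply]

theorem basis_injective {W : ℕ} {s s' : ℕ → Bool} (h : basis W s = basis W s') :
    ∀ j < W, s j = s' j := by
  have := congrFun h fun j : Fin W => s j
  rw [basis_apply, basis_apply, if_pos rfl] at this
  intro j hj
  by_contra hne
  rw [if_neg] at this
  · exact one_ne_zero this
  · intro h'; exact hne (congrFun h' ⟨j, hj⟩)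

theorem unitary_notMatrix : notMatrix ∈ Matrix.unitaryGroup Bool ℂ := by
  rw [Matrix.mem_unitaryGroup_iff]
  ext a b
  cases a <;> cases b <;> simp [Matrix.mul_apply, notMatrix, Matrix.star_apply]

theorem unitary_phaseMatrix (φ : ℝ) : phaseMatrix φ ∈ Matrix.unitaryGroup Bool ℂ := by
  rw [Matrix.mem_unitaryGroup_iff]
  have h : Complex.exp (Complex.I * φ) * (starRingEnd ℂ) (Complex.exp (Complex.I * φ)) = 1 := by
    rw [Complex.mul_conj, Complex.normSq_eq_norm_sq, mul_comm, Complex.norm_exp_ofReal_mul_I]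
    simp
  ext a b
  cases a <;> cases b <;> simp [Matrix.mul_apply, phaseMatrix, Matrix.star_apply, h]

theorem unitary_hadamardMatrix : hadamardMatrix ∈ Matrix.unitaryGroup Bool ℂ := by
  rw [Matrix.mem_unitaryGroup_iff]
  have h : ((Real.sqrt 2 : ℂ))⁻¹ * ((Real.sqrt 2 : ℂ))⁻¹ = 1 / 2 := by
    rw [← mul_inv, ← Complex.ofReal_mul, Real.mul_self_sqrt (by norm_num)]; norm_num
  ext a b
  cases a <;> cases b <;>
    simp [Matrix.mul_apply, hadamardMatrix, Matrix.star_apply, h, Complex.conj_ofReal] <;> norm_num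

/-- A controlled phase is diagonal, and its condition treats target and controls alike. Hence the
rotations of the algorithm may use qubits that hold data as their targets. -/
theorem Gate.apply_phase {W : ℕ} (cs : List ℕ) {t : ℕ} (φ : ℝ) (ht : t < W)
    (hcs : ∀ c ∈ cs, c < W) (s : ℕ → Bool) :
    Gate.apply W ⟨cs, t, phaseMatrix φ⟩ (basis W s) =
      (if (cs.all s && s t) = true then Complex.exp (Complex.I * φ) else 1) • basis W s := by
  funext u
  simp only [Gate.apply, Pi.smul_apply, smul_eq_mul]
  have e1 : ∑ b, phaseMatrix φ (getBit u t) b * basis W s (setBit u t b) =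
      (if getBit u t = true then Complex.exp (Complex.I * φ) else 1) * basis W s u := by
    conv_rhs => rw [← setBit_getBit u t]
    rw [getBit_setBit_self u ht]
    cases getBit u t <;> simp [phaseMatrix]
  rw [e1]
  by_cases hu : u = fun j : Fin W => s j
  · subst hu
    have h1 : (∀ c ∈ cs, getBit (fun j : Fin W => s j) c = true) ↔ cs.all s = true := by
      rw [List.all_eq_true]
      exact forall₂_congr fun c hc => by rw [getBit_of_lt _ (hcs c hc)]
    rw [getBit_of_lt _ ht]
    by_cases h2 : cs.all s = true
    · rw [if_pos (h1.2 h2), h2]; simp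
    · rw [if_neg (fun h => h2 (h1.1 h))]
      simp [h2]
  · rw [basis_apply, if_neg hu]; simp

/-! ### Classical reversible operations -/

/-- Flip the target bit if all control bits are set. -/
abbrev Op := List ℕ × ℕ

def Op.toGate (o : Op) : Gate := ⟨o.1, o.2, notMatrix⟩

def Op.act (o : Op) (s : ℕ → Bool) : ℕ → Bool :=
  if o.1.all s then Function.update s o.2 (!s o.2) else s

/-- The operations are legitimate on `W` bits. -/
def Op.Ok (W : ℕ) (o : Op) : Prop := o.2 < W ∧ (∀ c ∈ o.1, c < W ∧ c ≠ o.2) ∧ o.1.length ≤ 2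

def actAll (l : List Op) (s : ℕ → Bool) : ℕ → Bool := l.foldl (fun s o => o.act s) s

theorem actAll_append (l l' : List Op) (s : ℕ → Bool) :
    actAll (l ++ l') s = actAll l' (actAll l s) := by
  simp [actAll, List.foldl_append]

/-- A controlled NOT permutes the basis states. From here on reversible circuits are handled as
classical maps on bit sequences. -/
theorem Op.apply_toGate {W : ℕ} {o : Op} (ho : o.Ok W) (s : ℕ → Bool) :
    o.toGate.apply W (basis W s) = basis W (o.act s) := by
  obtain ⟨ht, hc, -⟩ := ho
  funext u
  change Gate.apply W ⟨o.1, o.2, notMatrix⟩ _ u = _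
  simp only [Gate.apply]
  have e1 : ∑ b, notMatrix (getBit u o.2) b * basis W s (setBit u o.2 b) =
      basis W s (setBit u o.2 (!getBit u o.2)) := by
    cases getBit u o.2 <;> simp [notMatrix]
  rw [e1]
  by_cases hs : o.1.all s = true
  · have hs' := List.all_eq_true.1 hs
    have e2 : o.act s = Function.update s o.2 (!s o.2) := by rw [Op.act, if_pos hs]
    rw [e2]
    by_cases hu : u = fun j : Fin W => Function.update s o.2 (!s o.2) j
    · have h1 : ∀ c ∈ o.1, getBit u c = true := fun c hcc => by
        rw [hu, getBit_of_lt _ (hc c hcc).1]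
        simp only
        rw [Function.update_of_ne (hc c hcc).2]
        exact hs' c hcc
      rw [if_pos h1, basis_apply, basis_apply, if_pos hu, if_pos]
      funext j
      rw [hu, getBit_of_lt _ ht]
      by_cases hj : (j : ℕ) = o.2 <;> simp [setBit, hj]
    · rw [basis_apply (Function.update _ _ _), if_neg hu]
      split_ifs with h1
      · rw [basis_apply, if_neg]
        intro h2
        apply hu
        funext j
        have h3 := congrFun h2 j
        have h4 := congrFun h2 ⟨o.2, ht⟩
        simp only [setBit] at h3 h4
        by_cases hj : (j : ℕ) = o.2
        · have : j = ⟨o.2, ht⟩ := Fin.ext hj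
          subst this
          simp only [if_true] at h4
          rw [getBit_of_lt _ ht] at h4
          simp only [Function.update_self]
          rw [← h4, Bool.not_not]
        · rw [if_neg hj] at h3
          simpa [Function.update_of_ne hj] using h3
      · rw [basis_apply, if_neg]
        intro h2
        apply h1
        intro c hcc
        rw [h2, getBit_of_lt _ (hc c hcc).1]
        exact hs' c hcc
  · rw [Op.act, if_neg hs]
    split_ifs with h1
    · have hne : ∀ v : Fin W → Bool, (∀ c ∈ o.1, getBit v c = true) → basis W s v = 0 := by
        intro v hv
        rw [basis_apply, if_neg]
        intro h2
        apply hs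
        rw [List.all_eq_true]
        intro c hcc
        have := hv c hcc
        rwa [h2, getBit_of_lt _ (hc c hcc).1] at this
      rw [hne u h1, hne]
      intro c hcc
      rw [getBit_setBit_of_ne _ (hc c hcc).2]
      exact h1 c hcc
    · rfl

theorem run_ops {W : ℕ} {l : List Op} (hl : ∀ o ∈ l, o.Ok W) (s : ℕ → Bool) :
    Circuit.run W (l.map Op.toGate) (basis W s) = basis W (actAll l s) := by
  induction l generalizing s with
  | nil => rfl
  | cons o l ih =>
    rw [List.map_cons, Circuit.run_cons, Op.apply_toGate (hl o List.mem_cons_self),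
      ih fun o' ho' => hl o' (List.mem_cons_of_mem _ ho')]
    rfl

theorem Op.Ok.wellFormed {W : ℕ} {o : Op} (h : o.Ok W) : o.toGate.WellFormed W :=
  ⟨h.1, h.2.1, h.2.2, unitary_notMatrix⟩

theorem reversible_ops {W : ℕ} {l : List Op} (hl : ∀ o ∈ l, o.Ok W) :
    Circuit.Reversible W (l.map Op.toGate) := by
  constructor
  · intro g hg
    obtain ⟨o, ho, rfl⟩ := List.mem_map.1 hg
    exact (hl o ho).wellFormed
  · intro g hg
    obtain ⟨o, ho, rfl⟩ := List.mem_map.1 hg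
    rfl

theorem Circuit.Reversible.exists_ops {W : ℕ} {J : Circuit} (h : J.Reversible W) :
    ∃ l : List Op, J = l.map Op.toGate ∧ ∀ o ∈ l, o.Ok W := by
  refine ⟨J.map fun g => (g.controls, g.target), ?_, ?_⟩
  · rw [List.map_map]
    conv_lhs => rw [← List.map_id J]
    refine List.map_congr_left fun g hg => ?_
    have := h.2 g hg
    rcases g with ⟨c, t, U⟩
    simp only at this
    subst this
    rfl
  · intro o ho
    obtain ⟨g, hg, rfl⟩ := List.mem_map.1 ho
    have := h.1 g hg
    exact ⟨this.1, this.2.1, this.2.2.1⟩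

theorem inverse_ops (l : List Op) :
    Circuit.inverse (l.map Op.toGate) = l.reverse.map Op.toGate := by
  have h : notMatrix.conjTranspose = notMatrix := by
    ext a b
    cases a <;> cases b <;> simp [notMatrix, Matrix.conjTranspose_apply]
  simp only [Circuit.inverse, ← List.map_reverse, List.map_map]
  refine List.map_congr_left fun o _ => ?_
  simp [Op.toGate, h]

theorem Op.act_of_ne {o : Op} {j : ℕ} (h : j ≠ o.2) (s : ℕ → Bool) : o.act s j = s j := by
  unfold Op.act
  split_ifs
  · rw [Function.update_of_ne h]
  · rfl

theorem actAll_of_not_mem {l : List Op} {j : ℕ} (h : ∀ o ∈ l, j ≠ o.2) (s : ℕ → Bool) :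
    actAll l s j = s j := by
  induction l generalizing s with
  | nil => rfl
  | cons o l ih =>
    change actAll l (o.act s) j = s j
    rw [ih (fun o' ho' => h o' (List.mem_cons_of_mem _ ho')),
      Op.act_of_ne (h o List.mem_cons_self)]

theorem Op.act_act {o : Op} (h : ∀ c ∈ o.1, c ≠ o.2) (s : ℕ → Bool) : o.act (o.act s) = s := by
  unfold Op.act
  by_cases hs : o.1.all s = true
  · have h2 : o.1.all (Function.update s o.2 (!s o.2)) = true := by
      rw [List.all_eq_true] at hs ⊢
      intro c hc
      rw [Function.update_of_ne (h c hc)]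
      exact hs c hc
    simp [hs, h2]
  · simp [hs]

theorem actAll_reverse {l : List Op} (h : ∀ o ∈ l, ∀ c ∈ o.1, c ≠ o.2) (s : ℕ → Bool) :
    actAll l.reverse (actAll l s) = s := by
  induction l generalizing s with
  | nil => rfl
  | cons o l ih =>
    rw [List.reverse_cons, actAll_append]
    change o.act (actAll l.reverse (actAll l (o.act s))) = s
    rw [ih (fun o' ho' => h o' (List.mem_cons_of_mem _ ho')), Op.act_act (h o List.mem_cons_self)]

/-- A bit that is neither a control nor a target is inert, so setting it commutes with the whole
list of operations. -/
theorem actAll_update {l : List Op} {k : ℕ} (h : ∀ o ∈ l, k ≠ o.2 ∧ k ∉ o.1) (s : ℕ → Bool)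
    (b : Bool) : actAll l (Function.update s k b) = Function.update (actAll l s) k b := by
  induction l generalizing s with
  | nil => rfl
  | cons o l ih =>
    change actAll l (o.act (Function.update s k b)) = Function.update (actAll l (o.act s)) k b
    have ho := h o List.mem_cons_self
    have e : o.act (Function.update s k b) = Function.update (o.act s) k b := by
      have e1 : o.1.all (Function.update s k b) = o.1.all s := by
        rw [Bool.eq_iff_iff, List.all_eq_true, List.all_eq_true]
        refine forall₂_congr fun c hc => ?_
        rw [Function.update_of_ne]
        rintro rfl
        exact ho.2 hc
      unfold Op.act
      rw [e1]
      split_ifs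
      · rw [Function.update_of_ne ho.1.symm, Function.update_comm ho.1.symm]
      · rfl
    rw [e, ih fun o' ho' => h o' (List.mem_cons_of_mem _ ho')]

/-- Compute, copy the bit `r` to the output `k`, and uncompute. -/
def computeCopy (l : List Op) (r k : ℕ) : List Op := l ++ ([([r], k)] ++ l.reverse)

/-- The output bit `k` is inert for `l`, so the copied value survives the uncomputation, which
returns all other bits to their initial state. -/
theorem actAll_computeCopy {l : List Op} {r k : ℕ} (h : ∀ o ∈ l, ∀ c ∈ o.1, c ≠ o.2)
    (hk : ∀ o ∈ l, k ≠ o.2 ∧ k ∉ o.1) (s : ℕ → Bool) :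
    actAll (computeCopy l r k) s = Function.update s k (s k ^^ actAll l s r) := by
  rw [computeCopy, actAll_append, actAll_append]
  have e : actAll [([r], k)] (actAll l s) =
      Function.update (actAll l s) k (s k ^^ actAll l s r) := by
    change Op.act ([r], k) (actAll l s) = _
    have := actAll_of_not_mem (fun o ho => (hk o ho).1) s
    cases h : actAll l s r
    · simp [Op.act, h, ← this]
    · simp [Op.act, h, this]
  rw [e, actAll_update (fun o ho => hk o (List.mem_reverse.1 ho)), actAll_reverse h]

/-! ### Straight-line programs -/

/-- Assign to a fresh bit the sum modulo 2 of the given products of bits. -/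
abbrev Instr := ℕ × List (List ℕ)

def Instr.ops (i : Instr) : List Op := i.2.map fun m => (m, i.1)

/-- The sum modulo 2 of products of bits. -/
def xorSum (s : ℕ → Bool) (ms : List (List ℕ)) : Bool := ms.foldr (fun m b => m.all s ^^ b) false

theorem xorSum_congr {s s' : ℕ → Bool} {ms : List (List ℕ)} (h : ∀ m ∈ ms, ∀ c ∈ m, s c = s' c) :
    xorSum s ms = xorSum s' ms := by
  induction ms with
  | nil => rfl
  | cons m ms ih =>
    have e1 : m.all s = m.all s' := by
      rw [Bool.eq_iff_iff, List.all_eq_true, List.all_eq_true]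
      exact forall₂_congr fun c hc => by rw [h m List.mem_cons_self c hc]
    have := ih fun m' hm' => h m' (List.mem_cons_of_mem _ hm')
    simp only [xorSum, List.foldr_cons] at this ⊢
    rw [e1, this]

/-- The target does not occur in the products, so each product sees the original bits even though
the target changes between the gates. -/
theorem Instr.actAll_ops {i : Instr} (h : ∀ m ∈ i.2, i.1 ∉ m) (s : ℕ → Bool) :
    actAll i.ops s = Function.update s i.1 (s i.1 ^^ xorSum s i.2) := by
  obtain ⟨t, ms⟩ := i
  simp only at h ⊢
  induction ms generalizing s with
  | nil => simp [Instr.ops, actAll, xorSum]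
  | cons m ms ih =>
    change actAll (Instr.ops (t, ms)) (Op.act (m, t) s) = _
    rw [ih (h := fun m' hm' => h m' (List.mem_cons_of_mem _ hm'))]
    have hm := h m List.mem_cons_self
    have e : Op.act (m, t) s = Function.update s t (s t ^^ m.all s) := by
      unfold Op.act
      cases hms : m.all s <;> simp
    rw [e, Function.update_idem, Function.update_self]
    have e2 : xorSum (Function.update s t (s t ^^ m.all s)) ms = xorSum s ms := by
      refine xorSum_congr fun m' hm' c hc => ?_
      rw [Function.update_of_ne]
      exact fun hct => h m' (List.mem_cons_of_mem _ hm') (hct ▸ hc)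
    rw [e2]
    simp [xorSum]

/-- The operations of a straight-line program. -/
def slpOps (L : List Instr) : List Op := L.flatMap Instr.ops

/-- A straight-line program with increasing targets computes values that satisfy all its
assignments. -/
theorem actAll_slpOps {L : List Instr} (hL : L.Pairwise fun i j => i.1 < j.1)
    (hc : ∀ i ∈ L, ∀ m ∈ i.2, ∀ c ∈ m, c < i.1) {s : ℕ → Bool} (hs : ∀ i ∈ L, s i.1 = false) :
    (∀ j, (∀ i ∈ L, j ≠ i.1) → actAll (slpOps L) s j = s j) ∧
      ∀ i ∈ L, actAll (slpOps L) s i.1 = xorSum (actAll (slpOps L) s) i.2 := by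
  induction L generalizing s with
  | nil => exact ⟨fun _ _ => rfl, by simp⟩
  | cons i L ih =>
    rw [List.pairwise_cons] at hL
    have hci := hc i List.mem_cons_self
    have e1 : actAll (slpOps (i :: L)) s =
        actAll (slpOps L) (Function.update s i.1 (xorSum s i.2)) := by
      rw [slpOps, List.flatMap_cons, actAll_append, Instr.actAll_ops
        (fun m hm h => lt_irrefl _ (hci m hm _ h)), hs i List.mem_cons_self]
      simp [slpOps]
    obtain ⟨h1, h2⟩ := ih hL.2 (fun i' hi' => hc i' (List.mem_cons_of_mem _ hi'))
      (s := Function.update s i.1 (xorSum s i.2)) (fun i' hi' => by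
        rw [Function.update_of_ne (hL.1 i' hi').ne']
        exact hs i' (List.mem_cons_of_mem _ hi'))
    rw [e1]
    refine ⟨fun j hj => ?_, fun i' hi' => ?_⟩
    · rw [h1 j fun i' hi' => hj i' (List.mem_cons_of_mem _ hi'),
        Function.update_of_ne (hj i List.mem_cons_self)]
    · rcases List.mem_cons.1 hi' with rfl | hi'
      -- Later instructions write only to larger positions, so neither the assigned bit nor the bits
      -- in its products change afterwards, and the assignment stays true as an equation.
      · rw [h1 _ fun i'' hi'' => (hL.1 i'' hi'').ne, Function.update_self]
        refine xorSum_congr fun m hm c hcm => ?_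
        have := hci m hm c hcm
        rw [h1 c fun i'' hi'' => (this.trans (hL.1 i'' hi'')).ne,
          Function.update_of_ne this.ne]
      · exact h2 i' hi'

theorem slpOps_controls_ne {L : List Instr} (hc : ∀ i ∈ L, ∀ m ∈ i.2, ∀ c ∈ m, c < i.1) :
    ∀ o ∈ slpOps L, ∀ c ∈ o.1, c ≠ o.2 := by
  intro o ho c hco
  obtain ⟨i, hi, ho⟩ := List.mem_flatMap.1 ho
  obtain ⟨m, hm, rfl⟩ := List.mem_map.1 ho
  exact (hc i hi m hm c hco).ne

/-- Legitimacy of the operations of a straight-line program that avoids the bit `k`. -/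
theorem slpOps_ok {L : List Instr} {W : ℕ} (hc : ∀ i ∈ L, ∀ m ∈ i.2, ∀ c ∈ m, c < i.1)
    (hW : ∀ i ∈ L, i.1 < W) (hm : ∀ i ∈ L, ∀ m ∈ i.2, m.length ≤ 2) :
    ∀ o ∈ slpOps L, o.Ok W := by
  intro o ho
  obtain ⟨i, hi, ho⟩ := List.mem_flatMap.1 ho
  obtain ⟨m, hmi, rfl⟩ := List.mem_map.1 ho
  exact ⟨hW i hi, fun c hcm => ⟨(hc i hi m hmi c hcm).trans (hW i hi), (hc i hi m hmi c hcm).ne⟩,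
    hm i hi m hmi⟩

theorem slpOps_avoid {L : List Instr} {k : ℕ} (h : ∀ i ∈ L, k ≠ i.1 ∧ ∀ m ∈ i.2, k ∉ m) :
    ∀ o ∈ slpOps L, k ≠ o.2 ∧ k ∉ o.1 := by
  intro o ho
  obtain ⟨i, hi, ho⟩ := List.mem_flatMap.1 ho
  obtain ⟨m, hmi, rfl⟩ := List.mem_map.1 ho
  exact ⟨(h i hi).1, (h i hi).2 m hmi⟩

theorem computeCopy_ok {l : List Op} {r k W : ℕ} (hl : ∀ o ∈ l, o.Ok W) (hr : r < W) (hk : k < W)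
    (hrk : r ≠ k) : ∀ o ∈ computeCopy l r k, o.Ok W := by
  intro o ho
  simp only [computeCopy, List.mem_append, List.mem_singleton, List.mem_reverse] at ho
  rcases ho with ho | rfl | ho
  · exact hl o ho
  · exact ⟨hk, by simpa using ⟨hr, hrk⟩, by simp⟩
  · exact hl o ho

theorem testBit_add_two_pow {y k b : ℕ} (hy : y < 2 ^ k) (hb : b < 2) :
    (y + b * 2 ^ k).testBit = Function.update y.testBit k (decide (b = 1)) := by
  funext j
  rw [add_comm, mul_comm, Nat.testBit_two_pow_mul_add b hy]
  rcases lt_trichotomy j k with h | rfl | h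
  · rw [if_pos h, Function.update_of_ne h.ne]
  · rw [if_neg (lt_irrefl _), Function.update_self]
    have : b = 0 ∨ b = 1 := by omega
    rcases this with rfl | rfl <;> simp
  · rw [if_neg (by omega), Function.update_of_ne h.ne',
      Nat.testBit_lt_two_pow (hy.trans (Nat.pow_lt_pow_right (by norm_num) h))]
    refine Nat.testBit_lt_two_pow (hb.trans_le ?_)
    calc 2 = 2 ^ 1 := rfl
      _ ≤ 2 ^ (j - k) := Nat.pow_le_pow_right (by norm_num) (by omega)

/-- A reversible circuit can be run on more qubits. -/
theorem Circuit.Reversible.run_mono {W W' x y : ℕ} (hW : W ≤ W') {J : Circuit}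
    (h : J.Reversible W) (hx : x < 2 ^ W) (hy : y < 2 ^ W) (hJ : J.run W (ket W x) = ket W y) :
    J.Reversible W' ∧ J.run W' (ket W' x) = ket W' y := by
  obtain ⟨l, rfl, hl⟩ := h.exists_ops
  have hl' : ∀ o ∈ l, o.Ok W' := fun o ho =>
    ⟨(hl o ho).1.trans_le hW, fun c hc => ⟨((hl o ho).2.1 c hc).1.trans_le hW,
      ((hl o ho).2.1 c hc).2⟩, (hl o ho).2.2⟩
  refine ⟨reversible_ops hl', ?_⟩
  rw [ket_eq_basis, run_ops hl] at hJ
  rw [ket_eq_basis, run_ops hl', ket_eq_basis]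
  congr 1
  funext j
  by_cases hj : j < W
  · exact basis_injective hJ j hj
  · have h2 : 2 ^ W ≤ 2 ^ j := Nat.pow_le_pow_right (by norm_num) (not_lt.1 hj)
    rw [actAll_of_not_mem (fun o ho => by have := (hl o ho).1; omega),
      Nat.testBit_lt_two_pow (hx.trans_le h2), Nat.testBit_lt_two_pow (hy.trans_le h2)]

/-! ### Nonresidues and the amplitudes -/

/-- Below 17 only 1 and 9 are congruent to 1 modulo 8, and neither is prime. -/
theorem Admissible.two_le {p n : ℕ} (h : Admissible p n) : 17 ≤ p := by
  obtain ⟨hp, h8, -, -⟩ := h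
  have h9 : p ≠ 9 := by rintro rfl; revert hp; decide
  have := hp.two_le
  omega

theorem Admissible.pos {p n : ℕ} (h : Admissible p n) : 5 ≤ n := by
  by_contra hn
  have h1 := h.two_le
  have h2 : 2 ^ n ≤ 2 ^ 4 := Nat.pow_le_pow_right (by norm_num) (by omega)
  have := h.2.2.2
  omega

/-- Both sides of `2 ^ n < 2 * p` are even, which gains the `2`. This is exactly what makes the
argument of `arccos` at least `-1`. -/
theorem Admissible.two_pow_le {p n : ℕ} (h : Admissible p n) : 2 ^ n ≤ 2 * (p - 1) := by
  obtain ⟨k, rfl⟩ := Nat.exists_eq_add_of_le' h.pos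
  have := h.2.2.1
  rw [pow_succ] at this ⊢
  omega

theorem Admissible.cos_angle {p n : ℕ} (h : Admissible p n) :
    Real.cos (angle p n) = 1 - 2 ^ n / ((p : ℝ) - 1) := by
  have h1 := h.two_le
  have hp : (0 : ℝ) < (p : ℝ) - 1 := by
    have : (17 : ℝ) ≤ p := by exact_mod_cast h1
    linarith
  have h2 : (2 : ℝ) ^ n ≤ 2 * ((p : ℝ) - 1) := by
    have := h.two_pow_le
    have h3 : ((2 ^ n : ℕ) : ℝ) ≤ ((2 * (p - 1) : ℕ) : ℝ) := by exact_mod_cast this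
    push_cast [Nat.cast_sub (show 1 ≤ p by omega)] at h3
    exact h3
  refine Real.cos_arccos ?_ ?_
  · have : 2 ^ n / ((p : ℝ) - 1) ≤ 2 := by rw [div_le_iff₀ hp]; exact h2
    linarith
  · have : 0 ≤ 2 ^ n / ((p : ℝ) - 1) := by positivity
    linarith

theorem isNonresidue_iff {p : ℕ} (hp : p.Prime) (x : ℕ) :
    IsNonresidue p x ↔ x < p ∧ jacobiSym (x : ℤ) p = -1 := by
  have := Fact.mk hp
  rw [IsNonresidue, ← jacobiSym.legendreSym.to_jacobiSym, legendreSym.eq_neg_one_iff]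
  simp

open Classical in
theorem indicator_eq {p : ℕ} (hp : p.Prime) (x : ℕ) :
    indicator p x = if IsNonresidue p x then 1 else 0 := by
  rw [indicator, jacobiIndicator, ltIndicator]
  simp only [isNonresidue_iff hp]
  split_ifs <;> simp_all

open Classical in
-- Sum the identity χ(a) = 1 - [a = 0] - 2·[a is not a square] over the field and use that the
-- quadratic character has sum zero.
theorem two_mul_card_not_isSquare (p : ℕ) [Fact p.Prime] (h2 : p ≠ 2) :
    2 * (Finset.univ.filter fun a : ZMod p => ¬ IsSquare a).card + 1 = p := by
  have hF : ringChar (ZMod p) ≠ 2 := by rwa [ZMod.ringChar_zmod_n]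
  have h := quadraticChar_sum_zero hF
  have e : ∀ a : ZMod p, quadraticChar (ZMod p) a =
      1 - (if a = 0 then 1 else 0) - 2 * (if ¬ IsSquare a then 1 else 0) := by
    intro a
    by_cases h0 : a = 0
    · subst h0; simp
    · by_cases hs : IsSquare a
      · simp [h0, hs, (quadraticChar_one_iff_isSquare h0).2 hs]
      · simp [h0, hs, quadraticChar_neg_one_iff_not_isSquare.2 hs]
  simp only [e, Finset.sum_sub_distrib, ← Finset.mul_sum, Finset.sum_boole, Finset.sum_const,
    Finset.card_univ, ZMod.card, Finset.filter_eq', Finset.mem_univ, if_true,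
    Finset.card_singleton] at h
  simp only [nsmul_eq_mul, mul_one, Nat.cast_one] at h
  omega

open Classical in
/-- The nonresidues. -/
def nonresidues (p : ℕ) : Finset ℕ := (Finset.range p).filter (IsNonresidue p)

theorem mem_nonresidues {p x : ℕ} : x ∈ nonresidues p ↔ IsNonresidue p x := by
  simp only [nonresidues, Finset.mem_filter, Finset.mem_range, and_iff_right_iff_imp]
  exact fun h => h.1

open Classical in
theorem two_mul_card_nonresidues {p : ℕ} (hp : p.Prime) (h2 : p ≠ 2) :
    2 * (nonresidues p).card + 1 = p := by
  have := Fact.mk hp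
  have e := two_mul_card_not_isSquare p h2
  suffices hs : (nonresidues p).card = (Finset.univ.filter fun a : ZMod p => ¬ IsSquare a).card by
    rw [hs, e]
  refine Finset.card_nbij' (fun x => (x : ZMod p)) (fun a => a.val) ?_ ?_ ?_ ?_
  · intro x hx
    simpa using (mem_nonresidues.1 hx).2
  · intro a ha
    refine mem_nonresidues.2 ⟨ZMod.val_lt a, ?_⟩
    simpa using ha
  · intro x hx
    exact ZMod.val_cast_of_lt (mem_nonresidues.1 hx).1
  · intro a _
    simp

/-- Modulo `p` the number `p - x` is `-x`, and `-1` is a square. -/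
theorem IsNonresidue.sub {p x : ℕ} (hp : p.Prime) (h8 : p % 8 = 1) (h : IsNonresidue p x) :
    IsNonresidue p (p - x) := by
  have := Fact.mk hp
  have hx0 : x ≠ 0 := by
    rintro rfl
    exact h.2 (by simp)
  refine ⟨by have := hp.pos; omega, ?_⟩
  rw [Nat.cast_sub h.1.le, ZMod.natCast_self, zero_sub]
  have h1 : IsSquare (-1 : ZMod p) := ZMod.exists_sq_eq_neg_one_iff.2 (by omega)
  intro hs
  apply h.2
  have := h1.mul hs
  simpa using this

/-- The involution x ↦ p - x preserves the nonresidues and, `p` being odd, switches parity, so the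
two classes have equal size. -/
theorem card_even_nonresidues {p : ℕ} (hp : p.Prime) (h8 : p % 8 = 1) :
    4 * ((nonresidues p).filter Even).card + 1 = p ∧
      4 * ((nonresidues p).filter fun x => ¬ Even x).card + 1 = p := by
  have h1 := two_mul_card_nonresidues hp (by rintro rfl; omega)
  have h2 : ((nonresidues p).filter Even).card + ((nonresidues p).filter fun x => ¬ Even x).card =
      (nonresidues p).card := by
    rw [← Finset.card_filter_add_card_filter_not (s := nonresidues p) Even]
  have h3 : ((nonresidues p).filter Even).card =
      ((nonresidues p).filter fun x => ¬ Even x).card := by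
    refine Finset.card_nbij' (fun x => p - x) (fun x => p - x) ?_ ?_ ?_ ?_
    · intro x hx
      simp only [Finset.coe_filter, Set.mem_ofPred_eq, mem_nonresidues] at hx ⊢
      have := hx.1.1
      refine ⟨hx.1.sub hp h8, ?_⟩
      rw [Nat.even_iff] at hx ⊢
      omega
    · intro x hx
      simp only [Finset.coe_filter, Set.mem_ofPred_eq, mem_nonresidues] at hx ⊢
      have := hx.1.1
      refine ⟨hx.1.sub hp h8, ?_⟩
      rw [Nat.even_iff] at hx ⊢
      omega
    · intro x hx
      simp only [Finset.coe_filter, Set.mem_ofPred_eq, mem_nonresidues] at hx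
      exact Nat.sub_sub_self hx.1.1.le
    · intro x hx
      simp only [Finset.coe_filter, Set.mem_ofPred_eq, mem_nonresidues] at hx
      exact Nat.sub_sub_self hx.1.1.le
  omega

/-! ### The amplitudes before and after the inversion about the mean. -/

open Classical in
theorem finalAmplitude_eq {p : ℕ} (hp : p.Prime) (n x : ℕ) :
    finalAmplitude p n x = if IsNonresidue p x then
      (1 / (Real.sqrt (2 ^ n) : ℂ)) * (1 - if Even x then Complex.exp (Complex.I * angle p n)
        else Complex.exp (-(Complex.I * angle p n))) else 0 := by
  rw [finalAmplitude, indicator_eq hp]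
  by_cases h : IsNonresidue p x
  · rw [if_pos h, if_pos h]
    by_cases hx : Even x
    · rw [if_pos hx, Nat.even_iff.1 hx]; simp
    · rw [if_neg hx, Nat.odd_iff.1 (Nat.not_even_iff_odd.1 hx)]
      congr 3; push_cast; ring
  · rw [if_neg h, if_neg h]; simp

open Classical in
-- With equally many rotations by `θ` and by `-θ`, only `2 * cos θ` enters the sum, and the angle
-- was chosen to make the sum half of its original value.
theorem mean_rotateNonresidues {p n : ℕ} (h : Admissible p n) :
    mean n (rotateNonresidues p n (angle p n) (uniformState n)) =
      1 / (2 * (Real.sqrt (2 ^ n) : ℂ)) := by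
  obtain ⟨hp, h8, h2, hN⟩ := h
  obtain ⟨hE, hO⟩ := card_even_nonresidues hp h8
  set E := (nonresidues p).filter Even with hEdef
  set O := (nonresidues p).filter (fun x => ¬ Even x) with hOdef
  set z := Complex.exp (Complex.I * angle p n) with hz
  set z' := Complex.exp (-(Complex.I * angle p n)) with hz'
  set u : ℂ := 1 / (Real.sqrt (2 ^ n) : ℂ) with hu
  have hsub : nonresidues p ⊆ Finset.range (2 ^ n) := fun x hx => by
    have := (mem_nonresidues.1 hx).1
    simp only [Finset.mem_range]; omega
  have e1 : ∑ x, rotateNonresidues p n (angle p n) (uniformState n) x =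
      u * (2 ^ n + E.card * (z - 1) + O.card * (z' - 1)) := by
    have e2 : ∀ x : Fin (2 ^ n), rotateNonresidues p n (angle p n) (uniformState n) x =
        (fun x : ℕ => u * (1 + (if x ∈ E then z - 1 else 0) + if x ∈ O then z' - 1 else 0)) x := by
      intro x
      simp only [rotateNonresidues, uniformState, hEdef, hOdef, Finset.mem_filter,
        mem_nonresidues, ← hu]
      by_cases h1 : IsNonresidue p x <;> by_cases h3 : Even (x : ℕ) <;> simp [h1, h3] <;>
        first | done | (rw [mul_comm])
    rw [Finset.sum_congr rfl fun x _ => e2 x, Fin.sum_univ_eq_sum_range (fun x : ℕ =>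
      u * (1 + (if x ∈ E then z - 1 else 0) + if x ∈ O then z' - 1 else 0)) (2 ^ n),
      ← Finset.mul_sum, Finset.sum_add_distrib, Finset.sum_add_distrib, Finset.sum_ite_mem,
      Finset.sum_ite_mem, Finset.inter_eq_right.2 ((Finset.filter_subset _ _).trans hsub),
      Finset.inter_eq_right.2 ((Finset.filter_subset _ _).trans hsub)]
    simp only [Finset.sum_const, Finset.card_range, nsmul_eq_mul, mul_one]
    push_cast
    ring
  have hcos : z + z' = 2 * (1 - 2 ^ n / ((p : ℂ) - 1)) := by
    have h3 := Admissible.cos_angle ⟨hp, h8, h2, hN⟩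
    have h4 : (Real.cos (angle p n) : ℂ) = 1 - 2 ^ n / ((p : ℂ) - 1) := by
      rw [h3]; push_cast; ring
    rw [← h4, Complex.ofReal_cos, Complex.two_cos, hz, hz']
    congr 2 <;> ring
  have hE' : (E.card : ℂ) = ((p : ℂ) - 1) / 4 := by
    have : (4 * (E.card : ℂ) + 1) = p := by exact_mod_cast hE
    rw [← this]; ring
  have hO' : (O.card : ℂ) = ((p : ℂ) - 1) / 4 := by
    have : (4 * (O.card : ℂ) + 1) = p := by exact_mod_cast hO
    rw [← this]; ring
  have hp1 : (p : ℂ) - 1 ≠ 0 := by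
    have : (p : ℂ) ≠ 1 := by exact_mod_cast hp.one_lt.ne'
    exact sub_ne_zero.2 this
  -- Each class contributes (p - 1)/4 terms, together (p - 1)/2 · (cos θ - 1) = -N/2.
  have e3 : (2 : ℂ) ^ n + E.card * (z - 1) + O.card * (z' - 1) = 2 ^ n / 2 := by
    rw [hE', hO']
    have : (2 : ℂ) ^ n + ((p : ℂ) - 1) / 4 * (z - 1) + ((p : ℂ) - 1) / 4 * (z' - 1) =
      2 ^ n + ((p : ℂ) - 1) / 4 * ((z + z') - 2) := by ring
    rw [this, hcos]
    field_simp
    ring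
  rw [mean, e1, e3, hu]
  have h9 : (2 : ℂ) ^ n ≠ 0 := pow_ne_zero _ two_ne_zero
  rw [one_div_mul_eq_div, ← mul_div_assoc]
  rw [div_eq_div_iff h9 (by simp)]
  have h10 : (Real.sqrt (2 ^ n) : ℂ) ≠ 0 := by
    rw [Complex.ofReal_ne_zero]; positivity
  field_simp

open Classical in
theorem invertAboutMean_rotateNonresidues {p n : ℕ} (h : Admissible p n) (x : Fin (2 ^ n)) :
    invertAboutMean n (rotateNonresidues p n (angle p n) (uniformState n)) x =
      finalAmplitude p n x := by
  rw [invertAboutMean, mean_rotateNonresidues h, finalAmplitude_eq h.1, rotateNonresidues]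
  simp only [uniformState]
  have : 2 * (1 / (2 * (Real.sqrt (2 ^ n) : ℂ))) = 1 / (Real.sqrt (2 ^ n) : ℂ) := by
    rw [one_div, one_div, mul_inv, ← mul_assoc, mul_inv_cancel₀ two_ne_zero, one_mul]
  rw [this]
  split_ifs <;> ring

theorem norm_one_sub_exp_sq (θ : ℝ) :
    ‖1 - Complex.exp (Complex.I * θ)‖ ^ 2 = 2 - 2 * Real.cos θ := by
  rw [mul_comm, Complex.exp_mul_I, ← Complex.normSq_eq_norm_sq, Complex.normSq_apply]
  simp only [Complex.sub_re, Complex.add_re, Complex.one_re, Complex.sub_im, Complex.add_im,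
    Complex.one_im, Complex.mul_re, Complex.mul_im, Complex.I_re, Complex.I_im,
    Complex.cos_ofReal_re, Complex.sin_ofReal_re, Complex.cos_ofReal_im, Complex.sin_ofReal_im]
  have := Real.sin_sq_add_cos_sq θ
  nlinarith

theorem norm_finalAmplitude_sq {p n : ℕ} (h : Admissible p n) {x : ℕ} (hx : IsNonresidue p x) :
    ‖finalAmplitude p n x‖ ^ 2 = 2 / ((p : ℝ) - 1) := by
  classical
  rw [finalAmplitude_eq h.1, if_pos hx]
  have h17 : (17 : ℝ) ≤ p := by exact_mod_cast h.two_le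
  have hcos := h.cos_angle
  have e : ‖(1 : ℂ) - if Even x then Complex.exp (Complex.I * angle p n)
      else Complex.exp (-(Complex.I * angle p n))‖ ^ 2 = 2 * (2 ^ n / ((p : ℝ) - 1)) := by
    split_ifs
    · rw [norm_one_sub_exp_sq, hcos]; ring
    · have := norm_one_sub_exp_sq (-angle p n)
      rw [Real.cos_neg, hcos] at this
      rw [show -(Complex.I * (angle p n : ℂ)) = Complex.I * ((-angle p n : ℝ) : ℂ) by push_cast; ring,
        this]
      ring
  rw [norm_mul, mul_pow, e, norm_div, norm_one, Complex.norm_real, Real.norm_of_nonneg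
    (Real.sqrt_nonneg _), div_pow, one_pow, Real.sq_sqrt (by positivity)]
  have : (2 : ℝ) ^ n ≠ 0 := by positivity
  field_simp

theorem finalAmplitude_eq_zero {p n : ℕ} (hp : p.Prime) {x : ℕ} (hx : ¬ IsNonresidue p x) :
    finalAmplitude p n x = 0 := by
  rw [finalAmplitude_eq hp, if_neg hx]

theorem ncard_nonresidues {p : ℕ} (hp : p.Prime) (h2 : p ≠ 2) :
    2 * Set.ncard {x : ℕ | IsNonresidue p x} = p - 1 := by
  have : {x : ℕ | IsNonresidue p x} = (nonresidues p : Set ℕ) := by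
    ext x; simp [mem_nonresidues]
  rw [this, Set.ncard_coe_finset]
  have := two_mul_card_nonresidues hp h2
  omega

/-! ### Hadamard transforms and inversion about the mean -/

theorem Gate.apply_basis {W : ℕ} {i : ℕ} (hi : i < W) (U : Matrix Bool Bool ℂ) (s : ℕ → Bool) :
    Gate.apply W ⟨[], i, U⟩ (basis W s) =
      U false (s i) • basis W (Function.update s i false) +
        U true (s i) • basis W (Function.update s i true) := by
  funext u
  have hU : Gate.apply W ⟨[], i, U⟩ (basis W s) u =
      ∑ b, U (getBit u i) b * basis W s (setBit u i b) := by
    simp [Gate.apply]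
  rw [hU]
  by_cases hu : ∀ j : Fin W, (j : ℕ) ≠ i → u j = s j
  · have h1 : ∀ b, basis W s (setBit u i b) = if b = s i then 1 else 0 := by
      intro b
      rw [basis_apply]
      congr 1
      rw [eq_iff_iff]
      constructor
      · intro h
        have := congrFun h ⟨i, hi⟩
        simpa [setBit] using this
      · rintro rfl
        funext j
        by_cases hj : (j : ℕ) = i
        · simp [setBit, hj]
        · simp [setBit, hj, hu j hj]
    have h2 : ∀ b, basis W (Function.update s i b) u = if getBit u i = b then 1 else 0 := by
      intro b
      rw [basis_apply]
      congr 1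
      rw [eq_iff_iff]
      constructor
      · intro h
        have := congrFun h ⟨i, hi⟩
        rw [getBit_of_lt _ hi, this]
        simp
      · rintro rfl
        funext j
        by_cases hj : (j : ℕ) = i
        · have : j = ⟨i, hi⟩ := Fin.ext hj
          subst this
          simp [getBit_of_lt _ hi]
        · simp [hj, hu j hj]
    simp only [h1, h2, Pi.add_apply, Pi.smul_apply, smul_eq_mul]
    cases getBit u i <;> simp
  · push Not at hu
    obtain ⟨j, hj, hne⟩ := hu
    have h1 : ∀ b, basis W s (setBit u i b) = 0 := fun b => by
      rw [basis_apply, if_neg]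
      intro h
      have := congrFun h j
      simp only [setBit, if_neg hj] at this
      exact hne this
    have h2 : ∀ b, basis W (Function.update s i b) u = 0 := fun b => by
      rw [basis_apply, if_neg]
      intro h
      have := congrFun h j
      simp only [Function.update_of_ne hj] at this
      exact hne this
    simp [h1, h2]

/-- The sign of the coefficient of `y` in the Hadamard transform of `x`. -/
def character (m x y : ℕ) : ℂ :=
  ∏ i ∈ Finset.range m, if x.testBit i = true ∧ y.testBit i = true then -1 else 1

theorem hadamards_succ (m : ℕ) : hadamards (m + 1) = hadamards m ++ [⟨[], m, hadamardMatrix⟩] := by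
  simp [hadamards, List.range_succ]

theorem hadamards_wellFormed {n W : ℕ} (h : n ≤ W) : Circuit.WellFormed W (hadamards n) := by
  intro g hg
  simp only [hadamards, List.mem_map, List.mem_range] at hg
  obtain ⟨i, hi, rfl⟩ := hg
  exact ⟨by simp; omega, by simp, by simp, unitary_hadamardMatrix⟩

/-- After `m` gates the low `m` bits range over all values while the others still hold the digits of
`x`; this intermediate form is what the induction needs. -/
theorem run_hadamards_aux {W : ℕ} (m : ℕ) (hm : m ≤ W) (x : ℕ) :
    (hadamards m).run W (ket W x) = ((1 / (Real.sqrt 2 : ℂ)) ^ m) •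
      ∑ y ∈ Finset.range (2 ^ m), character m x y •
        basis W (fun j => if j < m then y.testBit j else x.testBit j) := by
  induction m with
  | zero => simp [hadamards, Circuit.run, character, ket_eq_basis]
  | succ m ih =>
    rw [hadamards_succ, Circuit.run_append, ih (by omega), Circuit.run_smul, Circuit.run_sum,
      pow_succ, mul_smul]
    congr 1
    have e : ∀ y ∈ Finset.range (2 ^ m), character m x y • Circuit.run W
        [⟨[], m, hadamardMatrix⟩] (basis W fun j => if j < m then y.testBit j else x.testBit j) =
        (1 / (Real.sqrt 2 : ℂ)) • (character (m + 1) x y •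
            basis W (fun j => if j < m + 1 then y.testBit j else x.testBit j) +
          character (m + 1) x (2 ^ m + y) •
            basis W (fun j => if j < m + 1 then (2 ^ m + y).testBit j else x.testBit j)) := by
      intro y hy
      have hy := Finset.mem_range.1 hy
      have hbit : (2 ^ m + y).testBit = Function.update y.testBit m true := by
        have := testBit_add_two_pow hy (b := 1) (by norm_num)
        rwa [one_mul, add_comm, decide_eq_true rfl] at this
      have hym : y.testBit m = false := Nat.testBit_lt_two_pow hy
      have e0 : (fun j => if j < m + 1 then y.testBit j else x.testBit j) =
          Function.update (fun j => if j < m then y.testBit j else x.testBit j) m false := by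
        funext j
        rcases lt_trichotomy j m with h | rfl | h
        · rw [Function.update_of_ne h.ne, if_pos h, if_pos (by omega)]
        · simp [hym]
        · rw [Function.update_of_ne h.ne', if_neg (by omega), if_neg (by omega)]
      have e1 : (fun j => if j < m + 1 then (2 ^ m + y).testBit j else x.testBit j) =
          Function.update (fun j => if j < m then y.testBit j else x.testBit j) m true := by
        rw [hbit]
        funext j
        rcases lt_trichotomy j m with h | rfl | h
        · simp only [Function.update_of_ne h.ne, if_pos h, if_pos (show j < m + 1 by omega)]
        · simp
        · simp only [Function.update_of_ne h.ne', if_neg (show ¬ j < m by omega),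
            if_neg (show ¬ j < m + 1 by omega)]
      have c0 : character (m + 1) x y = character m x y := by
        rw [character, Finset.prod_range_succ, hym]
        simp [character]
      have c1 : character (m + 1) x (2 ^ m + y) =
          character m x y * if x.testBit m = true then -1 else 1 := by
        rw [character, Finset.prod_range_succ, hbit, character]
        congr 1
        · refine Finset.prod_congr rfl fun i hi => ?_
          rw [Function.update_of_ne (Finset.mem_range.1 hi).ne]
        · simp
      rw [Circuit.run_cons, Gate.apply_basis (by omega), e0, e1, c0, c1]
      simp only [Circuit.run, List.foldl_nil, lt_irrefl, if_false, hadamardMatrix]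
      cases x.testBit m
      · simp only [and_false, if_false, mul_one, Bool.false_eq_true]
        module
      · simp only [and_true, if_false, if_true, mul_one, Bool.false_eq_true]
        module
    rw [Finset.sum_congr rfl e, ← Finset.smul_sum, Finset.sum_add_distrib]
    congr 1
    rw [show 2 ^ (m + 1) = 2 ^ m + 2 ^ m by ring, Finset.sum_range_add]

theorem run_hadamards {W n : ℕ} (hn : n ≤ W) {x : ℕ} (hx : x < 2 ^ n) :
    (hadamards n).run W (ket W x) = ∑ y ∈ Finset.range (2 ^ n),
      (1 / (Real.sqrt (2 ^ n) : ℂ) * character n x y) • ket W y := by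
  rw [run_hadamards_aux n hn, Finset.smul_sum]
  refine Finset.sum_congr rfl fun y hy => ?_
  have hy := Finset.mem_range.1 hy
  rw [smul_smul, ket_eq_basis]
  congr 2
  · rw [one_div_pow, ← Complex.ofReal_pow, Real.sqrt_eq_rpow, Real.sqrt_eq_rpow,
      ← Real.rpow_mul_natCast (by norm_num), ← Real.rpow_natCast, ← Real.rpow_mul (by norm_num),
      mul_comm]
  · funext j
    split_ifs with h
    · rfl
    · have := Nat.pow_le_pow_right (n := 2) (by norm_num) (not_lt.1 h)
      rw [Nat.testBit_lt_two_pow (hx.trans_le this), Nat.testBit_lt_two_pow (hy.trans_le this)]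

theorem Gate.apply_comm {W i j : ℕ} (hij : i ≠ j)
    (U V : Matrix Bool Bool ℂ) (ψ : (Fin W → Bool) → ℂ) :
    Gate.apply W ⟨[], i, U⟩ (Gate.apply W ⟨[], j, V⟩ ψ) =
      Gate.apply W ⟨[], j, V⟩ (Gate.apply W ⟨[], i, U⟩ ψ) := by
  funext s
  simp only [Gate.apply, List.not_mem_nil, false_imp_iff, implies_true, if_true, Fintype.sum_bool]
  simp only [getBit_setBit_of_ne _ hij, getBit_setBit_of_ne _ hij.symm, setBit_comm s hij]
  ring

theorem run_hadamards_comm {W m i : ℕ} (hm : m ≤ i) (hi : i < W) (U : Matrix Bool Bool ℂ)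
    (ψ : (Fin W → Bool) → ℂ) : (hadamards m).run W (Gate.apply W ⟨[], i, U⟩ ψ) =
      Gate.apply W ⟨[], i, U⟩ ((hadamards m).run W ψ) := by
  induction m with
  | zero => rfl
  | succ m ih =>
    rw [hadamards_succ, Circuit.run_append, Circuit.run_append, ih (by omega)]
    exact Gate.apply_comm (by omega) _ _ _

/-- The last gate commutes with the Hadamard gates on lower qubits and so meets its own copy, with
which it cancels. Orthogonality of characters is not needed. -/
theorem run_hadamards_run_hadamards {W n : ℕ} (hn : n ≤ W) (ψ : (Fin W → Bool) → ℂ) :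
    (hadamards n).run W ((hadamards n).run W ψ) = ψ := by
  induction n with
  | zero => rfl
  | succ n ih =>
    rw [hadamards_succ, Circuit.run_append, Circuit.run_append]
    change Gate.apply W ⟨[], n, hadamardMatrix⟩ ((hadamards n).run W
      (Gate.apply W ⟨[], n, hadamardMatrix⟩ ((hadamards n).run W ψ))) = ψ
    rw [run_hadamards_comm le_rfl (by omega), ih (by omega)]
    have := Gate.apply_adjoint (g := ⟨[], n, hadamardMatrix⟩)
      (hadamards_wellFormed (n := n + 1) hn _ (by simp [hadamards_succ])) ψ
    have hH : hadamardMatrix.conjTranspose = hadamardMatrix := by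
      ext a b
      cases a <;> cases b <;> simp [hadamardMatrix, Matrix.conjTranspose_apply, Complex.conj_ofReal]
    simpa [hH] using this

theorem sqrt_two_pow_inv_mul_self (n : ℕ) :
    (1 / (Real.sqrt (2 ^ n) : ℂ)) * (1 / (Real.sqrt (2 ^ n) : ℂ)) = 1 / 2 ^ n := by
  rw [div_mul_div_comm, one_mul, ← Complex.ofReal_mul, Real.mul_self_sqrt (by positivity)]
  push_cast
  rfl

/-- The inversion about the mean by Hadamard transforms and a phase flip, with sign `-1`. -/
theorem run_diffusion {n W : ℕ} (hn : n ≤ W) {Z : Circuit} (hZ : IsZeroFlipCircuit n W Z)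
    (a : ℕ → ℂ) :
    (hadamards n).run W (Z.run W ((hadamards n).run W
      (∑ x ∈ Finset.range (2 ^ n), a x • ket W x))) =
      ∑ x ∈ Finset.range (2 ^ n),
        (a x - 2 * (1 / 2 ^ n * ∑ y ∈ Finset.range (2 ^ n), a y)) • ket W x := by
  set u : ℂ := 1 / (Real.sqrt (2 ^ n) : ℂ) with hu
  set ψ := ∑ x ∈ Finset.range (2 ^ n), a x • ket W x with hψ
  set c : ℕ → ℂ := fun y => ∑ x ∈ Finset.range (2 ^ n), a x * (u * character n x y) with hc
  have h1 : (hadamards n).run W ψ = ∑ y ∈ Finset.range (2 ^ n), c y • ket W y := by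
    rw [hψ, Circuit.run_sum]
    rw [Finset.sum_congr rfl fun x hx => by rw [run_hadamards hn (Finset.mem_range.1 hx)]]
    simp only [Finset.smul_sum, smul_smul, hc, Finset.sum_smul]
    exact Finset.sum_comm
  -- On these states `Z` subtracts twice the `|0⟩` component. The second Hadamard transform then
  -- returns the first term to `ψ` and spreads the correction uniformly, giving `a x` minus twice
  -- the mean.
  have h2 : Z.run W ((hadamards n).run W ψ) = (hadamards n).run W ψ + (-2 * c 0) • ket W 0 := by
    rw [h1, Circuit.run_sum]
    rw [Finset.sum_congr rfl fun y hy => by rw [hZ.2 y (Finset.mem_range.1 hy)]]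
    have e : ∀ y, c y • ((if y = 0 then (-1 : ℂ) else 1) • ket W y) =
        c y • ket W y + if y = 0 then (-2 * c 0) • ket W 0 else 0 := by
      intro y
      by_cases hy : y = 0
      · subst hy; simp only [if_true]; module
      · simp [hy]
    simp only [e]
    rw [Finset.sum_add_distrib, Finset.sum_ite_eq' ]
    simp
  have hch : ∀ y, character n 0 y = 1 := fun y => by simp [character]
  have hch' : ∀ x, character n x 0 = 1 := fun y => by simp [character]
  rw [h2, Circuit.run_add, run_hadamards_run_hadamards hn, Circuit.run_smul,
    run_hadamards hn (Nat.two_pow_pos n), hψ, Finset.smul_sum, ← Finset.sum_add_distrib]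
  refine Finset.sum_congr rfl fun x _ => ?_
  rw [smul_smul, ← add_smul, hch]
  congr 1
  have : c 0 = u * ∑ y ∈ Finset.range (2 ^ n), a y := by
    simp only [hc, hch', mul_one]
    rw [← Finset.sum_mul, mul_comm]
  rw [this, ← sqrt_two_pow_inv_mul_self, ← hu]
  ring

/-! ### Measurements -/

theorem sum_testBit (x m : ℕ) :
    (∑ j ∈ Finset.range m, if x.testBit j = true then 2 ^ j else 0) = x % 2 ^ m := by
  induction m with
  | zero => simp [Nat.mod_one]
  | succ m ih =>
    rw [Finset.sum_range_succ, ih]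
    rcases testBit_cases x m with ⟨h, e⟩ | ⟨h, e⟩ <;> rw [e, h] <;> simp

theorem outputValue_testBit {W n x : ℕ} (hn : n ≤ W) (hx : x < 2 ^ n) :
    outputValue n (fun j : Fin W => x.testBit j) = x := by
  rw [outputValue, Fin.sum_univ_eq_sum_range
    (fun j => if j < n ∧ x.testBit j = true then 2 ^ j else 0) W]
  obtain ⟨d, rfl⟩ := Nat.exists_eq_add_of_le hn
  rw [Finset.sum_range_add, Finset.sum_congr rfl (g := fun j => if x.testBit j = true then 2 ^ j
    else 0) fun j hj => by simp [Finset.mem_range.1 hj], sum_testBit, Nat.mod_eq_of_lt hx]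
  simp

open Classical in
-- The scratch qubits are `0`, so different `x` give different configurations, each with measured
-- value `x`; all remaining configurations have amplitude zero.
theorem outputProb_sum {W n : ℕ} (hn : n ≤ W) (c : ℕ → ℂ) (S : Set ℕ) :
    outputProb W n (∑ x ∈ Finset.range (2 ^ n), c x • ket W x) S =
      ∑ x ∈ Finset.range (2 ^ n), if x ∈ S then ‖c x‖ ^ 2 else 0 := by
  set bits : ℕ → Fin W → Bool := fun x j => x.testBit j with hbits
  have hinj : Set.InjOn bits (Finset.range (2 ^ n)) := by
    intro x hx y hy hxy
    have h1 := outputValue_testBit hn (Finset.mem_range.1 (Finset.mem_coe.1 hx))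
    have h2 := outputValue_testBit hn (Finset.mem_range.1 (Finset.mem_coe.1 hy))
    rw [← h1, ← h2]
    exact congrArg _ hxy
  have hket : ∀ x s, ket W x s = if s = bits x then 1 else 0 := fun x s => basis_apply _ _
  have hψ : ∀ s, (∑ x ∈ Finset.range (2 ^ n), c x • ket W x) s =
      ∑ x ∈ Finset.range (2 ^ n), if s = bits x then c x else 0 := fun s => by
    rw [Finset.sum_apply]
    refine Finset.sum_congr rfl fun x _ => ?_
    rw [Pi.smul_apply, hket]
    simp
  have hψ1 : ∀ x ∈ Finset.range (2 ^ n),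
      (∑ x ∈ Finset.range (2 ^ n), c x • ket W x) (bits x) = c x := by
    intro x hx
    rw [hψ, Finset.sum_eq_single x]
    · simp
    · intro y hy hne
      rw [if_neg]
      intro h
      exact hne (hinj hy hx h.symm)
    · exact fun h => absurd hx h
  rw [outputProb, ← Finset.sum_subset (Finset.subset_univ ((Finset.range (2 ^ n)).image bits)),
    Finset.sum_image hinj]
  · refine Finset.sum_congr rfl fun x hx => ?_
    rw [hψ1 x hx, outputValue_testBit hn (Finset.mem_range.1 hx)]
  · intro s _ hs
    rw [hψ, Finset.sum_eq_zero]
    · simp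
    · intro x hx
      rw [if_neg]
      rintro rfl
      exact hs (Finset.mem_image_of_mem _ hx)

/-! ### The algorithm -/

theorem jacobiIndicator_lt (p x : ℕ) : jacobiIndicator p x < 2 := by
  unfold jacobiIndicator; split_ifs <;> norm_num

theorem ltIndicator_lt (p x : ℕ) : ltIndicator p x < 2 := by
  unfold ltIndicator; split_ifs <;> norm_num

theorem algorithm_wellFormed {p n W : ℕ} {J K Z : Circuit} (hn : 0 < n) (h : IsInstance p n W J K Z) :
    (algorithm p n J K Z).WellFormed W := by
  obtain ⟨hW, hJ, hK, hZ⟩ := h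
  have hH := hadamards_wellFormed (n := n) (W := W) (by omega)
  refine (((((((hH.append hJ.1.1).append hK.1.1).append ?_).append hK.1.1.inverse).append
    hJ.1.1.inverse).append hH).append hZ.1).append hH
  intro g hg
  simp only [List.mem_cons, List.not_mem_nil, or_false] at hg
  rcases hg with rfl | rfl
  · exact ⟨by simp; omega, by simp; omega, by simp, unitary_phaseMatrix _⟩
  · exact ⟨by simp; omega, by simp; omega, by simp, unitary_phaseMatrix _⟩

/-- The final state of the algorithm. -/
theorem run_algorithm {p n W : ℕ} {J K Z : Circuit} (hp : Admissible p n)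
    (h : IsInstance p n W J K Z) :
    (algorithm p n J K Z).run W (ket W 0) =
      (-1 : ℂ) • ∑ x ∈ Finset.range (2 ^ n), finalAmplitude p n x • ket W x := by
  obtain ⟨hW, hJ, hK, hZ⟩ := h
  set u : ℂ := 1 / (Real.sqrt (2 ^ n) : ℂ) with hu
  have hn := hp.pos
  set θ := angle p n with hθ
  set E : ℕ → ℂ := fun x => Complex.exp (Complex.I * (θ : ℂ) * (indicator p x : ℂ) *
      (1 - 2 * ((x % 2 : ℕ) : ℂ))) with hE
  have hβ : ∀ x, finalAmplitude p n x = u * (1 - E x) := fun x => rfl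
  set v : ℕ → (Fin W → Bool) → ℂ := fun x =>
    ket W (x + jacobiIndicator p x * 2 ^ n + ltIndicator p x * 2 ^ (n + 1)) with hv
  have hJK : ∀ x < 2 ^ n, K.run W (J.run W (ket W x)) = v x := fun x hx => by
    rw [hJ.2 x hx, hK.2 x hx _ (jacobiIndicator_lt p x)]
  -- When both indicators are `1`, the rotation by `θ` together with the one by `-2θ` for odd `x`
  -- gives the phase `θ (1 - 2 x₀)`.
  have hph : ∀ x < 2 ^ n, Circuit.run W
      [⟨[n, n + 1], 0, phaseMatrix (-2 * θ)⟩, ⟨[n + 1], n, phaseMatrix θ⟩] (v x) = E x • v x := by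
    intro x hx
    have hbits : (x + jacobiIndicator p x * 2 ^ n + ltIndicator p x * 2 ^ (n + 1)).testBit =
        Function.update (Function.update x.testBit n (decide (jacobiIndicator p x = 1))) (n + 1)
          (decide (ltIndicator p x = 1)) := by
      rw [testBit_add_two_pow ?_ (ltIndicator_lt p x), testBit_add_two_pow hx (jacobiIndicator_lt p x)]
      have := jacobiIndicator_lt p x
      have : jacobiIndicator p x = 0 ∨ jacobiIndicator p x = 1 := by omega
      rw [pow_succ]
      rcases this with h | h <;> rw [h] <;> omega
    simp only [hv, ket_eq_basis, hbits]
    rw [Circuit.run_cons, Gate.apply_phase _ _ (by omega) (by simp; omega), Circuit.run_smul,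
      Circuit.run_cons, Gate.apply_phase _ _ (by omega) (by simp; omega)]
    simp only [Circuit.run, List.foldl_nil, smul_smul]
    congr 1
    have h0 : x.testBit 0 = decide (x % 2 = 1) := Nat.testBit_zero x
    have hj := jacobiIndicator_lt p x
    have hl := ltIndicator_lt p x
    have n1 : n ≠ n + 1 := by omega
    have n0 : (0 : ℕ) ≠ n := by omega
    simp only [List.all_cons, List.all_nil, Bool.and_true, Function.update_self,
      Function.update_of_ne n1, Function.update_of_ne n0,
      Function.update_of_ne (show (0 : ℕ) ≠ n + 1 by omega), h0, hE, indicator]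
    have hj : jacobiIndicator p x = 0 ∨ jacobiIndicator p x = 1 := by omega
    have hl : ltIndicator p x = 0 ∨ ltIndicator p x = 1 := by omega
    have hx2 : x % 2 = 0 ∨ x % 2 = 1 := by omega
    rcases hj with hj | hj <;> rcases hl with hl | hl <;> rcases hx2 with hx2 | hx2 <;>
      simp [hj, hl, hx2]
    -- What remains is the case of odd `x` with both indicators equal to `1`, where both rotations
    -- act.
    rw [← Complex.exp_add]
    congr 1
    ring
  have hback : ∀ x < 2 ^ n, (Circuit.inverse J).run W ((Circuit.inverse K).run W (v x)) =
      ket W x := fun x hx => by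
    rw [← hJK x hx, Circuit.run_inverse hK.1.1, Circuit.run_inverse hJ.1.1]
  have hch : ∀ y, character n 0 y = 1 := fun y => by simp [character]
  have h1 : Circuit.run W (Circuit.inverse J) (Circuit.run W (Circuit.inverse K) (Circuit.run W
      [⟨[n, n + 1], 0, phaseMatrix (-2 * θ)⟩, ⟨[n + 1], n, phaseMatrix θ⟩]
      (K.run W (J.run W ((hadamards n).run W (ket W 0)))))) =
      ∑ x ∈ Finset.range (2 ^ n), (u - finalAmplitude p n x) • ket W x := by
    rw [run_hadamards (by omega) (Nat.two_pow_pos n)]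
    simp only [Circuit.run_sum, hch, mul_one, ← hu]
    refine Finset.sum_congr rfl fun x hx => ?_
    have hx := Finset.mem_range.1 hx
    rw [hJK x hx, hph x hx, Circuit.run_smul, Circuit.run_smul, hback x hx, smul_smul, hβ]
    congr 1
    ring
  rw [algorithm]
  simp only [Circuit.run_append]
  rw [h1, run_diffusion (by omega) hZ, Finset.smul_sum]
  -- Before the diffusion the amplitude is `u - β x` with mean `u / 2`, so subtracting twice the
  -- mean leaves `-β x`.
  have hmean : (1 / 2 ^ n : ℂ) * ∑ y ∈ Finset.range (2 ^ n), (u - finalAmplitude p n y) = u / 2 := by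
    have h2 := mean_rotateNonresidues hp
    have h3 : ∀ x : Fin (2 ^ n), rotateNonresidues p n (angle p n) (uniformState n) x =
        u - finalAmplitude p n x := fun x => by
      have := invertAboutMean_rotateNonresidues hp x
      rw [invertAboutMean, h2] at this
      rw [← this, hu]
      have : 2 * (1 / (2 * (Real.sqrt (2 ^ n) : ℂ))) = 1 / (Real.sqrt (2 ^ n) : ℂ) := by
        rw [one_div, one_div, mul_inv, ← mul_assoc, mul_inv_cancel₀ two_ne_zero, one_mul]
      rw [this]; ring
    rw [mean, Finset.sum_congr rfl fun x _ => h3 x, Fin.sum_univ_eq_sum_range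
      (fun x => u - finalAmplitude p n x)] at h2
    rw [h2, hu, div_div, mul_comm]
  refine Finset.sum_congr rfl fun x _ => ?_
  rw [hmean, smul_smul]
  congr 1
  ring

theorem outputProb_algorithm {p n W : ℕ} {J K Z : Circuit} (hp : Admissible p n)
    (h : IsInstance p n W J K Z) :
    outputProb W n ((algorithm p n J K Z).run W (ket W 0)) {y | IsNonresidue p y} = 1 ∧
      ∀ y : ℕ, IsNonresidue p y →
        outputProb W n ((algorithm p n J K Z).run W (ket W 0)) {y} = 2 / ((p : ℝ) - 1) := by
  classical
  have hW : n ≤ W := by have := h.1; omega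
  have h17 : (17 : ℝ) ≤ p := by exact_mod_cast hp.two_le
  have hN := hp.2.2.2
  rw [run_algorithm hp h, Finset.smul_sum]
  simp only [smul_smul, outputProb_sum hW, neg_one_mul, norm_neg]
  constructor
  · have e : ∀ x ∈ Finset.range (2 ^ n), (if x ∈ {y | IsNonresidue p y} then
        ‖finalAmplitude p n x‖ ^ 2 else 0) = if x ∈ nonresidues p then 2 / ((p : ℝ) - 1) else 0 := by
      intro x _
      simp only [Set.mem_ofPred_eq, mem_nonresidues]
      by_cases hx : IsNonresidue p x
      · rw [if_pos hx, if_pos hx, norm_finalAmplitude_sq hp hx]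
      · rw [if_neg hx, if_neg hx]
    rw [Finset.sum_congr rfl e, Finset.sum_ite_mem, Finset.inter_eq_right.2, Finset.sum_const,
      nsmul_eq_mul]
    · have h2 := two_mul_card_nonresidues hp.1 (by have := hp.two_le; omega)
      have h3 : 2 * ((nonresidues p).card : ℝ) + 1 = p := by exact_mod_cast h2
      rw [← h3, mul_div_assoc', div_eq_one_iff_eq]
      · ring
      · rw [← h3] at h17; linarith
    · intro x hx
      have := (mem_nonresidues.1 hx).1
      simp only [Finset.mem_range]; omega
  · intro y hy
    simp only [Set.mem_singleton_iff]
    rw [Finset.sum_ite_eq', if_pos, norm_finalAmplitude_sq hp hy]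
    have := hy.1
    simp only [Finset.mem_range]; omega

/-! ### Circuits from straight-line programs -/

/-- Run a straight-line program, copy the bit `r` to the bit `k`, and run it backwards. -/
def slpCircuit (L : List Instr) (r k : ℕ) : Circuit :=
  (computeCopy (slpOps L) r k).map Op.toGate

/-- A straight-line program whose scratch bits start at `m`, and which avoids the output `k`. -/
structure Slp (m W k : ℕ) (L : List Instr) : Prop where
  sorted : L.Pairwise fun i j => i.1 < j.1
  bounds : ∀ i ∈ L, m ≤ i.1 ∧ i.1 < W
  lt : ∀ i ∈ L, ∀ t ∈ i.2, ∀ c ∈ t, c < i.1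
  length_le : ∀ i ∈ L, ∀ t ∈ i.2, t.length ≤ 2
  avoid : ∀ i ∈ L, ∀ t ∈ i.2, k ∉ t

/-- The values computed by a straight-line program from the bits `s`. -/
structure Slp.Values (m : ℕ) (L : List Instr) (s v : ℕ → Bool) : Prop where
  input : ∀ j < m, v j = s j
  zero : ∀ j, m ≤ j → (∀ i ∈ L, j ≠ i.1) → v j = false
  eq : ∀ i ∈ L, v i.1 = xorSum v i.2

theorem Slp.exists_values {m W k : ℕ} {L : List Instr} (h : Slp m W k L) {s : ℕ → Bool}
    (hs : ∀ j, m ≤ j → s j = false) : Slp.Values m L s (actAll (slpOps L) s) := by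
  obtain ⟨h1, h2⟩ := actAll_slpOps h.sorted h.lt (s := s) fun i hi => hs _ (h.bounds i hi).1
  refine ⟨fun j hj => h1 j fun i hi => ?_, fun j hj hne => by rw [h1 j hne, hs j hj], h2⟩
  have := (h.bounds i hi).1
  omega

theorem Slp.reversible {m W k : ℕ} {L : List Instr} (h : Slp m W k L) {r : ℕ} (hr : r < W)
    (hk : k < W) (hrk : r ≠ k) : Circuit.Reversible W (slpCircuit L r k) :=
  reversible_ops (computeCopy_ok (slpOps_ok h.lt (fun i hi => (h.bounds i hi).2) h.length_le)
    hr hk hrk)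

/-- The output `k` lies below all targets and occurs in no product, so `actAll_computeCopy` applies
and all scratch bits are restored. -/
theorem Slp.run {m W k : ℕ} {L : List Instr} (h : Slp m W k L) {r : ℕ} (hr : r < W)
    (hk : k < W) (hkm : k < m) (hrk : r ≠ k) (s : ℕ → Bool) :
    (slpCircuit L r k).run W (basis W s) =
      basis W (Function.update s k (s k ^^ actAll (slpOps L) s r)) := by
  rw [slpCircuit, run_ops (computeCopy_ok (slpOps_ok h.lt (fun i hi => (h.bounds i hi).2)
    h.length_le) hr hk hrk), actAll_computeCopy (slpOps_controls_ne h.lt)]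
  refine slpOps_avoid fun i hi => ⟨?_, h.avoid i hi⟩
  have := (h.bounds i hi).1
  omega

/-! ### The comparison with a constant -/

/-- The borrows of the subtraction of the constant `p`, with scratch bits from `n + 2`. -/
def comparatorSlp (p n : ℕ) : List Instr := (List.range n).map fun i =>
  (n + 3 + i, (if p.testBit i = true then [[], [i]] else [[n + 2 + i]]) ++ [[i, n + 2 + i]])

def comparator (p n : ℕ) : Circuit := slpCircuit (comparatorSlp p n) (n + 2 + n) (n + 1)

theorem pairwise_map_range {f : ℕ → Instr} (h : ∀ i j, i < j → (f i).1 < (f j).1) (n : ℕ) :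
    ((List.range n).map f).Pairwise fun i j => i.1 < j.1 := by
  rw [List.pairwise_map]
  exact List.pairwise_lt_range.imp fun hij => h _ _ hij

theorem comparatorSlp_slp (p n : ℕ) : Slp (n + 2) (2 * n + 3) (n + 1) (comparatorSlp p n) := by
  refine ⟨pairwise_map_range (fun i j hij => by simp only; omega) n, ?_, ?_, ?_, ?_⟩
  all_goals
    intro i hi
    obtain ⟨i, hi', rfl⟩ := List.mem_map.1 hi
    have hi' := List.mem_range.1 hi'
  · exact ⟨by simp only; omega, by simp only; omega⟩
  · intro t ht c hc
    split_ifs at ht <;> simp at ht <;>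
      rcases ht with rfl | rfl | rfl
    all_goals (simp at hc; try (simp only; omega))
  · intro t ht
    split_ifs at ht <;> simp at ht <;>
      rcases ht with rfl | rfl | rfl
    all_goals simp
  · intro t ht hc
    split_ifs at ht <;> simp at ht <;>
      rcases ht with rfl | rfl | rfl
    all_goals (simp at hc; try omega)

/-- The last borrow of `x - p` is the truth value of `x < p`. As the digit of `p` is a constant, the
majority with input digit `x` and borrow `c` becomes `1 + x + xc` for digit `1` and `c + xc` for
digit `0`. The initial borrow is the bit `n + 2`, which no instruction writes. -/
theorem comparator_isComparatorCircuit {p n W : ℕ} (hp : p < 2 ^ n) (hW : 2 * n + 3 ≤ W) :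
    IsComparatorCircuit p n W (comparator p n) := by
  have hS := comparatorSlp_slp p n
  have hS : Slp (n + 2) W (n + 1) (comparatorSlp p n) :=
    ⟨hS.1, fun i hi => ⟨(hS.2 i hi).1, (hS.2 i hi).2.trans_le hW⟩, hS.3, hS.4, hS.5⟩
  refine ⟨hS.reversible (by omega) (by omega) (by omega), fun x hx b hb => ?_⟩
  have hlt : x + b * 2 ^ n < 2 ^ (n + 1) := by
    have : b * 2 ^ n ≤ 1 * 2 ^ n := Nat.mul_le_mul_right _ (by omega)
    rw [pow_succ]; omega
  rw [ket_eq_basis, comparator, hS.run (by omega) (by omega) (by omega) (by omega), ket_eq_basis,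
    testBit_add_two_pow hlt (ltIndicator_lt p x), Nat.testBit_lt_two_pow hlt, Bool.false_xor]
  congr 2
  set s := (x + b * 2 ^ n).testBit with hs
  have hv := hS.exists_values (s := s) fun j hj => Nat.testBit_lt_two_pow
    (hlt.trans_le (Nat.pow_le_pow_right (by norm_num) (by omega)))
  set v := actAll (slpOps (comparatorSlp p n)) s
  have hx' : ∀ i < n, v i = x.testBit i := fun i hi => by
    rw [hv.input i (by omega), hs, testBit_add_two_pow hx hb, Function.update_of_ne hi.ne]
  have key : ∀ i ≤ n, v (n + 2 + i) = borrow x p i := by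
    intro i
    induction i with
    | zero =>
      intro _
      rw [borrow_zero]
      refine hv.zero _ (by omega) fun i hi => ?_
      obtain ⟨i, -, rfl⟩ := List.mem_map.1 hi
      simp only; omega
    | succ i ih =>
      intro hi
      have h := hv.eq _ (List.mem_map.2 ⟨i, List.mem_range.2 (by omega), rfl⟩)
      simp only at h
      rw [show n + 2 + (i + 1) = n + 3 + i by omega, h, borrow_succ, ← ih (by omega),
        ← hx' i (by omega)]
      cases hpi : p.testBit i <;> cases hxi : v i <;> cases hci : v (n + 2 + i) <;>
        simp [xorSum, hxi, hci, maj]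
  rw [key n le_rfl, borrow_of_lt hx hp, ltIndicator]
  split_ifs with h <;> simp [h]

/-! ### The phase flip of zero -/

/-- The conjunctions of the negated bits, with scratch bits from `n + 2`. -/
def zeroTestSlp (n : ℕ) : List Instr :=
  (n + 2, [[]]) :: (List.range n).map fun i => (n + 3 + i, [[n + 2 + i], [i, n + 2 + i]])

/-- Compute whether all bits vanish, change the sign if so, and uncompute. -/
def zeroFlip (n : ℕ) : Circuit :=
  (slpOps (zeroTestSlp n)).map Op.toGate ++ ([⟨[], n + 2 + n, phaseMatrix Real.pi⟩] ++
    (slpOps (zeroTestSlp n)).reverse.map Op.toGate)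

theorem zeroTestSlp_slp (n : ℕ) : Slp (n + 2) (2 * n + 3) n (zeroTestSlp n) := by
  refine ⟨List.pairwise_cons.2 ⟨?_, pairwise_map_range (fun i j hij => by simp only; omega) n⟩,
    ?_, ?_, ?_, ?_⟩
  · intro i hi
    obtain ⟨i, hi, rfl⟩ := List.mem_map.1 hi
    simp only; omega
  all_goals
    intro i hi
    rcases List.mem_cons.1 hi with rfl | hi
    on_goal 2 =>
      obtain ⟨i, hi', rfl⟩ := List.mem_map.1 hi
      have hi' := List.mem_range.1 hi'
  · simp; omega
  · exact ⟨by simp only; omega, by simp only; omega⟩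
  · simp
  · simp
  · simp
  · simp
  · simp
  · simp; omega

/-- The bit `n + 2 + i` records that the first `i` digits vanish: it starts at `1` and is updated by
`t + xt = t(1 + x)`. A phase `π` on the last such bit gives the sign, and running the test backwards
clears the scratch bits. -/
theorem zeroFlip_isZeroFlipCircuit {n W : ℕ} (hW : 2 * n + 3 ≤ W) :
    IsZeroFlipCircuit n W (zeroFlip n) := by
  have hS := zeroTestSlp_slp n
  have hok := slpOps_ok hS.lt (fun i hi => (hS.bounds i hi).2.trans_le hW) hS.length_le
  have hok' : ∀ o ∈ (slpOps (zeroTestSlp n)).reverse, o.Ok W := fun o ho =>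
    hok o (List.mem_reverse.1 ho)
  refine ⟨(reversible_ops hok).1.append (Circuit.WellFormed.append ?_ (reversible_ops hok').1),
    fun x hx => ?_⟩
  · intro g hg
    rw [List.mem_singleton] at hg
    subst hg
    exact ⟨by simp only; omega, by simp, by simp, unitary_phaseMatrix _⟩
  rw [zeroFlip, Circuit.run_append, Circuit.run_append, ket_eq_basis, run_ops hok, Circuit.run_cons,
    Gate.apply_phase _ _ (by omega) (by simp), Circuit.run_smul, Circuit.run_smul]
  change _ • Circuit.run W _ (basis W _) = _
  rw [run_ops hok', actAll_reverse (slpOps_controls_ne hS.lt)]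
  congr 1
  have hv := hS.exists_values (s := x.testBit) fun j hj => Nat.testBit_lt_two_pow
    (hx.trans_le (Nat.pow_le_pow_right (by norm_num) (by omega)))
  set v := actAll (slpOps (zeroTestSlp n)) x.testBit
  have key : ∀ i ≤ n, v (n + 2 + i) = decide (x % 2 ^ i = 0) := by
    intro i
    induction i with
    | zero =>
      intro _
      have := hv.eq _ List.mem_cons_self
      simpa [xorSum, Nat.mod_one] using this
    | succ i ih =>
      intro hi
      have h := hv.eq _ (List.mem_cons_of_mem _ (List.mem_map.2 ⟨i, List.mem_range.2 (by omega), rfl⟩))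
      simp only at h
      have hxi := hv.input i (by omega)
      have ih := ih (by omega)
      have h2 := Nat.two_pow_pos i
      rw [show n + 2 + (i + 1) = n + 3 + i by omega, h]
      rcases testBit_cases x i with ⟨hb, e⟩ | ⟨hb, e⟩
      · rw [hb] at hxi
        have : x % 2 ^ (i + 1) ≠ 0 := by omega
        simp [xorSum, hxi, this]
      · rw [hb] at hxi
        simp [xorSum, hxi, ih, e]
  rw [key n le_rfl, Nat.mod_eq_of_lt hx]
  have : Complex.exp (Complex.I * Real.pi) = -1 := by rw [mul_comm, Complex.exp_pi_mul_I]
  by_cases h : x = 0 <;> simp [h, this]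

/-! ### The number of gates -/

theorem length_inverse (C : Circuit) : (Circuit.inverse C).length = C.length := by
  simp [Circuit.inverse]

theorem length_slpOps {L : List Instr} {c : ℕ} (h : ∀ i ∈ L, i.2.length ≤ c) :
    (slpOps L).length ≤ c * L.length := by
  induction L with
  | nil => simp [slpOps]
  | cons i L ih =>
    have h1 := ih fun i' hi' => h i' (List.mem_cons_of_mem _ hi')
    have h2 := h i List.mem_cons_self
    simp only [slpOps, List.flatMap_cons, List.length_append, List.length_cons, Instr.ops,
      List.length_map] at h1 ⊢
    rw [Nat.mul_succ]
    omega

theorem length_comparator (p n : ℕ) : (comparator p n).length ≤ 6 * n + 1 := by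
  have := length_slpOps (L := comparatorSlp p n) (c := 3) fun i hi => by
    obtain ⟨i, -, rfl⟩ := List.mem_map.1 hi
    split_ifs <;> simp
  simp only [comparatorSlp, List.length_map, List.length_range] at this
  simp only [comparator, slpCircuit, computeCopy, List.length_map, List.length_append,
    List.length_reverse, List.length_singleton, comparatorSlp]
  omega

theorem length_zeroFlip (n : ℕ) : (zeroFlip n).length ≤ 4 * n + 5 := by
  have := length_slpOps (L := zeroTestSlp n) (c := 2) fun i hi => by
    rcases List.mem_cons.1 hi with rfl | hi
    · simp
    · obtain ⟨i, -, rfl⟩ := List.mem_map.1 hi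
      simp
  simp only [zeroTestSlp, List.length_map, List.length_range, List.length_cons] at this
  simp only [zeroFlip, List.length_map, List.length_append, zeroTestSlp,
    List.length_reverse, List.length_singleton]
  omega

theorem IsJacobiCircuit.mono {p n W W' : ℕ} {J : Circuit} (hn : n + 2 ≤ W) (hW : W ≤ W')
    (h : IsJacobiCircuit p n W J) : IsJacobiCircuit p n W' J := by
  have hlt : ∀ x < 2 ^ n, ∀ b < 2, x + b * 2 ^ n < 2 ^ W := fun x hx b hb => by
    have h1 : b * 2 ^ n ≤ 1 * 2 ^ n := Nat.mul_le_mul_right _ (by omega)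
    have h2 : 2 ^ (n + 1) ≤ 2 ^ W := Nat.pow_le_pow_right (by norm_num) (by omega)
    rw [pow_succ] at h2
    omega
  have key := fun x hx => h.1.run_mono hW (by simpa using hlt x hx 0 (by norm_num))
    (hlt x hx _ (jacobiIndicator_lt p x)) (h.2 x hx)
  exact ⟨(key 0 (Nat.two_pow_pos n)).1, fun x hx => (key x hx).2⟩

/-- The cost of the algorithm relative to the circuit for the Jacobi symbol. -/
theorem exists_instance_length_le {p n W : ℕ} {J : Circuit} (hp : Admissible p n)
    (hW : n + 2 ≤ W) (hJ : IsJacobiCircuit p n W J) :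
    ∃ (W' : ℕ) (K Z : Circuit), IsInstance p n W' J K Z ∧
      (algorithm p n J K Z).length ≤ 2 * J.length + 28 * n := by
  refine ⟨max W (2 * n + 3), comparator p n, zeroFlip n,
    ⟨by omega, hJ.mono hW (le_max_left _ _),
      comparator_isComparatorCircuit hp.2.2.2 (le_max_right _ _),
      zeroFlip_isZeroFlipCircuit (le_max_right _ _)⟩, ?_⟩
  have h1 := length_comparator p n
  have h2 := length_zeroFlip n
  have h3 := hp.pos
  -- Three Hadamard layers, two rotations, two comparators and one zero flip make at most `3n + 2 +
  -- 2(6n + 1) + 4n + 5 = 19n + 9` gates, hence `28n`.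
  simp only [algorithm, List.length_append, length_inverse, hadamards, List.length_map,
    List.length_range, List.length_cons, List.length_nil]
  omega

/-- Since `5 ≤ n`, the logarithm is at least `1`, so the linear overhead is absorbed by `M n * log
n`. -/
theorem exists_instance_length_le_mul_log (M : ℕ → ℝ) (hM : ∀ n : ℕ, (n : ℝ) ≤ M n)
    (h : ∃ c : ℝ, ∀ p n : ℕ, Admissible p n → ∃ (W : ℕ) (J : Circuit), n + 2 ≤ W ∧
      IsJacobiCircuit p n W J ∧ (J.length : ℝ) ≤ c * (M n * Real.log n)) :
    ∃ c : ℝ, ∀ p n : ℕ, Admissible p n → ∃ (W : ℕ) (J K Z : Circuit),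
      IsInstance p n W J K Z ∧
        ((algorithm p n J K Z).length : ℝ) ≤ c * (M n * Real.log n) := by
  obtain ⟨c, hc⟩ := h
  refine ⟨2 * c + 28, fun p n hp => ?_⟩
  obtain ⟨W, J, hW, hJ, hlen⟩ := hc p n hp
  obtain ⟨W', K, Z, hI, hlen'⟩ := exists_instance_length_le hp hW hJ
  refine ⟨W', J, K, Z, hI, ?_⟩
  have h5 : (5 : ℝ) ≤ n := by exact_mod_cast hp.pos
  have hlog : 1 ≤ Real.log n := by
    rw [Real.le_log_iff_exp_le (by linarith)]
    have := Real.exp_one_lt_d9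
    linarith
  have h1 : (n : ℝ) ≤ M n * Real.log n := by
    have h0 := hM n
    nlinarith
  have h2 : ((algorithm p n J K Z).length : ℝ) ≤ 2 * J.length + 28 * n := by exact_mod_cast hlen'
  linarith

/-! ### The binary algorithm for the Jacobi symbol -/

/-- One step of the binary algorithm on `(a, b, s)`, which stands for `(-1) ^ s (a / b)`. -/
def jacobiStep (q : ℕ × ℕ × Bool) : ℕ × ℕ × Bool :=
  let swap := q.1.testBit 0 && decide (q.1 < q.2.1)
  let u := if swap then q.2.1 else q.1
  let v := if swap then q.1 else q.2.1
  ((u - if q.1.testBit 0 then v else 0) / 2, v,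
    q.2.2 ^^ (swap && (q.1.testBit 1 && q.2.1.testBit 1)) ^^ v.testBit 1 ^^ v.testBit 2)

def jacobiValue (q : ℕ × ℕ × Bool) : ℤ := (if q.2.2 then -1 else 1) * jacobiSym q.1 q.2.1

theorem testBit_one_eq (a : ℕ) : a.testBit 1 = decide (a / 2 % 2 = 1) := by
  rw [Nat.testBit_eq_decide_div_mod_eq, pow_one]

theorem testBit_two_eq (a : ℕ) : a.testBit 2 = decide (a / 4 % 2 = 1) := by
  rw [Nat.testBit_eq_decide_div_mod_eq]

theorem sign_xor (x y : Bool) :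
    (if (x ^^ y) then -1 else 1 : ℤ) = (if x then -1 else 1) * if y then -1 else 1 := by
  cases x <;> cases y <;> rfl

/-- The symbol (2/v) is -1 exactly for v ≡ 3, 5 mod 8, that is, when the bits 1 and 2 of the odd
number `v` differ. -/
theorem jacobiSym_half {w v : ℕ} (hw : w % 2 = 0) (hv : v % 2 = 1) :
    (if (v.testBit 1 ^^ v.testBit 2) then -1 else 1 : ℤ) * jacobiSym (w / 2 : ℕ) v =
      jacobiSym w v := by
  rw [← jacobiSym.even_odd (a := (w : ℤ)) (by exact_mod_cast hw) hv, testBit_one_eq,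
    testBit_two_eq]
  push_cast
  have h : v % 8 = 1 ∨ v % 8 = 3 ∨ v % 8 = 5 ∨ v % 8 = 7 := by omega
  rcases h with h | h | h | h
  · have h2 : v / 2 % 2 = 0 := by omega
    have h4 : v / 4 % 2 = 0 := by omega
    simp [h, h2, h4]
  · have h2 : v / 2 % 2 = 1 := by omega
    have h4 : v / 4 % 2 = 0 := by omega
    simp [h, h2, h4]
  · have h2 : v / 2 % 2 = 0 := by omega
    have h4 : v / 4 % 2 = 1 := by omega
    simp [h, h2, h4]
  · have h2 : v / 2 % 2 = 1 := by omega
    have h4 : v / 4 % 2 = 1 := by omega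
    simp [h, h2, h4]

/-- Reciprocity costs a sign exactly when both numbers are 3 modulo 4, that is, when both have bit 1
set. -/
theorem jacobiSym_swap {a b : ℕ} (ha : a % 2 = 1) (hb : b % 2 = 1) :
    (if (a.testBit 1 && b.testBit 1) then -1 else 1 : ℤ) * jacobiSym b a = jacobiSym a b := by
  rw [← jacobiSym.quadratic_reciprocity_if ha hb, testBit_one_eq, testBit_one_eq]
  have ha' : a % 4 = 1 ∧ a / 2 % 2 = 0 ∨ a % 4 = 3 ∧ a / 2 % 2 = 1 := by omega
  have hb' : b % 4 = 1 ∧ b / 2 % 2 = 0 ∨ b % 4 = 3 ∧ b / 2 % 2 = 1 := by omega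
  rcases ha' with ⟨h, h2⟩ | ⟨h, h2⟩ <;> rcases hb' with ⟨h', h2'⟩ | ⟨h', h2'⟩ <;>
    simp [h, h2, h', h2']

theorem jacobiSym_sub_self {u v : ℕ} (h : v ≤ u) : jacobiSym (u - v : ℕ) v = jacobiSym u v :=
  jacobiSym.mod_left' (by push_cast [h]; simp)

/-- The value, a bound for the size, the common divisors and oddness along the algorithm. -/
theorem jacobiStep_spec {a b : ℕ} {s : Bool} (hb : b % 2 = 1) :
    jacobiValue (jacobiStep (a, b, s)) = jacobiValue (a, b, s) ∧
      (jacobiStep (a, b, s)).2.1 % 2 = 1 ∧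
      2 * ((jacobiStep (a, b, s)).1 * (jacobiStep (a, b, s)).2.1) ≤ a * b ∧
      (∀ d, d ∣ (jacobiStep (a, b, s)).1 → d ∣ (jacobiStep (a, b, s)).2.1 → d ∣ a ∧ d ∣ b) ∧
      ∀ N, a < N → b < N → (jacobiStep (a, b, s)).1 < N ∧ (jacobiStep (a, b, s)).2.1 < N := by
  have h0 : a.testBit 0 = decide (a % 2 = 1) := Nat.testBit_zero a
  have hdvd : ∀ w d : ℕ, w % 2 = 0 → d ∣ w / 2 → d ∣ w := fun w d hw hd => by
    have : w = 2 * (w / 2) := by omega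
    rw [this]; exact hd.mul_left 2
  -- An even `a` is just halved. For odd `a` the smaller number is subtracted from the larger, after
  -- a swap if `a < b`, and the even difference is halved.
  rcases Nat.mod_two_eq_zero_or_one a with ha | ha
  · have e : jacobiStep (a, b, s) = (a / 2, b, s ^^ b.testBit 1 ^^ b.testBit 2) := by
      simp [jacobiStep, h0, ha]
    rw [e]
    refine ⟨?_, hb, ?_, fun d h1 h2 => ⟨hdvd _ _ ha h1, h2⟩, fun N h1 h2 => ⟨by simp only; omega, h2⟩⟩
    · simp only [jacobiValue, Bool.xor_assoc]
      rw [sign_xor, mul_assoc, jacobiSym_half ha hb]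
    · simp only
      rw [← mul_assoc]
      exact Nat.mul_le_mul_right _ (by omega)
  · rcases lt_or_ge a b with hab | hab
    · have e : jacobiStep (a, b, s) = ((b - a) / 2, a,
          s ^^ (a.testBit 1 && b.testBit 1) ^^ a.testBit 1 ^^ a.testBit 2) := by
        simp [jacobiStep, h0, ha, hab]
      rw [e]
      refine ⟨?_, ha, ?_, fun d h1 h2 => ⟨h2, ?_⟩, fun N h1 h2 => ⟨by simp only; omega, h1⟩⟩
      · simp only [jacobiValue]
        rw [Bool.xor_assoc, sign_xor, mul_assoc, jacobiSym_half (by omega) ha,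
          jacobiSym_sub_self hab.le, sign_xor, mul_assoc, jacobiSym_swap ha hb]
      · simp only
        rw [← mul_assoc, mul_comm a b]
        exact Nat.mul_le_mul_right _ (by omega)
      · have := (hdvd _ _ (by omega) h1).add h2
        rwa [Nat.sub_add_cancel hab.le] at this
    · have e : jacobiStep (a, b, s) = ((a - b) / 2, b, s ^^ b.testBit 1 ^^ b.testBit 2) := by
        simp [jacobiStep, h0, ha, not_lt.2 hab]
      rw [e]
      refine ⟨?_, hb, ?_, fun d h1 h2 => ⟨?_, h2⟩, fun N h1 h2 => ⟨by simp only; omega, h2⟩⟩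
      · simp only [jacobiValue]
        rw [Bool.xor_assoc, sign_xor, mul_assoc, jacobiSym_half (by omega) hb,
          jacobiSym_sub_self hab]
      · simp only
        rw [← mul_assoc]
        exact Nat.mul_le_mul_right _ (by omega)
      · have := (hdvd _ _ (by omega) h1).add h2
        rwa [Nat.sub_add_cancel hab] at this

/-- The state after `k` steps. -/
def jacobiState (p x k : ℕ) : ℕ × ℕ × Bool := jacobiStep^[k] (x, p, false)

theorem jacobiState_succ (p x k : ℕ) :
    jacobiState p x (k + 1) = jacobiStep (jacobiState p x k) :=
  Function.iterate_succ_apply' _ _ _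

theorem jacobiState_spec {p : ℕ} (hp : p % 2 = 1) (x k : ℕ) :
    jacobiValue (jacobiState p x k) = jacobiSym x p ∧ (jacobiState p x k).2.1 % 2 = 1 ∧
      2 ^ k * ((jacobiState p x k).1 * (jacobiState p x k).2.1) ≤ x * p ∧
      (∀ d, d ∣ (jacobiState p x k).1 → d ∣ (jacobiState p x k).2.1 → d ∣ x ∧ d ∣ p) ∧
      ∀ N, x < N → p < N → (jacobiState p x k).1 < N ∧ (jacobiState p x k).2.1 < N := by
  induction k with
  | zero => exact ⟨by simp [jacobiState, jacobiValue], hp, by simp [jacobiState],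
      fun d h1 h2 => ⟨h1, h2⟩, fun N h1 h2 => ⟨h1, h2⟩⟩
  | succ k ih =>
    obtain ⟨i1, i2, i3, i4, i5⟩ := ih
    rw [jacobiState_succ]
    generalize jacobiState p x k = q at *
    obtain ⟨a, b, s⟩ := q
    obtain ⟨h1, h2, h3, h4, h5⟩ := jacobiStep_spec (a := a) (s := s) i2
    refine ⟨h1.trans i1, h2, ?_, fun d hd hd' => ?_, fun N hx hp => ?_⟩
    · rw [pow_succ, mul_assoc]
      exact (Nat.mul_le_mul_left _ h3).trans i3
    · obtain ⟨g1, g2⟩ := h4 d hd hd'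
      exact i4 d g1 g2
    · obtain ⟨g1, g2⟩ := i5 N hx hp
      exact h5 N g1 g2

/-- The result of the algorithm for a prime modulus. -/
theorem jacobiIndicator_eq {p n x : ℕ} (hp : p.Prime) (hp2 : p % 2 = 1) (hn : 2 ≤ n)
    (h1 : 2 ^ (n - 1) ≤ p) (h2 : p < 2 ^ n) (hx : x < 2 ^ n) :
    decide (jacobiIndicator p x = 1) = ((jacobiState p x (2 * n)).2.2 ^^
      ((jacobiState p x (2 * n)).2.2 && (jacobiState p x (2 * n)).2.1.testBit (n - 1))) := by
  obtain ⟨i1, i2, i3, i4, -⟩ := jacobiState_spec hp2 x (2 * n)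
  generalize jacobiState p x (2 * n) = q at *
  obtain ⟨a, b, s⟩ := q
  simp only at i1 i2 i3 i4 ⊢
  -- After `2n` steps `2 ^ (2n) * (a * b) ≤ x * p < 2 ^ (2n)`, so `a * b = 0`, while `b` is odd.
  have ha : a = 0 := by
    by_contra ha
    have hab : 1 ≤ a * b := Nat.mul_pos (Nat.pos_of_ne_zero ha) (by omega)
    have := Nat.mul_lt_mul'' hx h2
    rw [← pow_add, ← two_mul] at this
    have := Nat.mul_le_mul_left (2 ^ (2 * n)) hab
    omega
  subst ha
  obtain ⟨-, hbp⟩ := i4 b (dvd_zero _) dvd_rfl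
  rw [jacobiIndicator, ← i1, jacobiValue]
  -- Now `b` divides `p`. If `b = 1` the sign is the answer. If `b = p` the symbol is `0`, whatever
  -- the sign bit says; bit `n - 1`, set in `p` but not in `1`, tells the cases apart.
  rcases (Nat.dvd_prime hp).1 hbp with rfl | rfl
  · rw [Nat.testBit_lt_two_pow (Nat.one_lt_two_pow (by omega))]
    cases s <;> simp
  · have hb : b.testBit (n - 1) = true := by
      have e : b = 2 ^ (n - 1) + (b - 2 ^ (n - 1)) := by omega
      rw [e, Nat.testBit_two_pow_add_eq, Nat.testBit_lt_two_pow]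
      · rfl
      · have : 2 ^ n = 2 ^ (n - 1) * 2 := by rw [← pow_succ]; congr 1; omega
        omega
    have hz : jacobiSym 0 b = 0 := jacobiSym.zero_left hp.one_lt
    rw [hb]
    simp [hz]

/-! ### The circuit for the Jacobi symbol -/

/-- The bit `i` of the register `r` of the stage `k`. -/
def wire (n k r i : ℕ) : ℕ := n + 2 + (k * 12 + r) * (n + 1) + i

/-- The next borrow of a subtraction with the bits `a`, `b` and the borrow `c`. -/
def borrowTerms (a b c : ℕ) : List (List ℕ) := [[b], [a, b], [c], [a, c], [b, c]]

/-- The registers of the first stage: the input in `0` and the modulus in `1`. -/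
def initTerms (p n i : ℕ) : ℕ → List (List ℕ)
  | 0 => if i < n then [[i]] else []
  | 1 => if p.testBit i = true then [[]] else []
  | _ => []

/-- The registers `0`, `1` and `10` for the numbers and the sign, from the stage before. -/
def nextTerms (n k i : ℕ) : ℕ → List (List ℕ)
  | 0 => if i < n then [[wire n k 8 (i + 1)]] else []
  | 1 => [[wire n k 5 i]]
  | 10 => [[wire n k 10 i], [wire n k 3 0, wire n k 9 0], [wire n k 5 1], [wire n k 5 2]]
  | _ => []

/-- The registers within a stage: `2` the borrows of the comparison, `3` whether to swap, `4` and
`5` the numbers after swapping, `6` the subtrahend, `7` and `8` the borrows and the bits of the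
difference, `9` the sign of the swap, `11` the result if this is the last stage. -/
def stageTerms (n k i : ℕ) : ℕ → List (List ℕ)
  | 2 => if 0 < i then borrowTerms (wire n k 0 (i - 1)) (wire n k 1 (i - 1)) (wire n k 2 (i - 1))
    else []
  | 3 => [[wire n k 0 0, wire n k 2 n]]
  | 4 => [[wire n k 0 i], [wire n k 3 i, wire n k 0 i], [wire n k 3 i, wire n k 1 i]]
  | 5 => [[wire n k 1 i], [wire n k 3 i, wire n k 0 i], [wire n k 3 i, wire n k 1 i]]
  | 6 => [[wire n k 0 0, wire n k 5 i]]
  | 7 => if 0 < i then borrowTerms (wire n k 4 (i - 1)) (wire n k 6 (i - 1)) (wire n k 7 (i - 1))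
    else []
  | 8 => [[wire n k 4 i], [wire n k 6 i], [wire n k 7 i]]
  | 9 => [[wire n k 0 1, wire n k 1 1]]
  | 11 => [[wire n k 10 i], [wire n k 10 i, wire n k 1 (n - 1)]]
  | _ => []

def jacobiTerms (p n k r i : ℕ) : List (List ℕ) :=
  (if 0 < k then nextTerms n (k - 1) i r else initTerms p n i r) ++ stageTerms n k i r

def jacobiSlp (p n : ℕ) : List Instr := (List.range (2 * n + 1)).flatMap fun k =>
  (List.range 12).flatMap fun r => (List.range (n + 1)).map fun i =>
    (wire n k r i, jacobiTerms p n k r i)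

/-- Wires are numbered by stage, then register, then bit, so that every product refers to smaller
wires only. -/
theorem wire_lt {n k r r' i i' : ℕ} (h : r < r') (hi : i ≤ n) : wire n k r i < wire n k r' i' := by
  have : (k * 12 + r + 1) * (n + 1) ≤ (k * 12 + r') * (n + 1) :=
    Nat.mul_le_mul_right _ (by omega)
  rw [Nat.succ_mul] at this
  unfold wire; omega

theorem wire_lt_of_stage_lt {n k k' r r' i i' : ℕ} (h : k < k') (hr : r < 12) (hi : i ≤ n) :
    wire n k r i < wire n k' r' i' := by
  have : (k * 12 + r + 1) * (n + 1) ≤ (k' * 12 + r') * (n + 1) :=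
    Nat.mul_le_mul_right _ (by omega)
  rw [Nat.succ_mul] at this
  unfold wire; omega

theorem le_wire (n k r i : ℕ) : n + 2 ≤ wire n k r i := by unfold wire; omega

theorem mem_jacobiSlp {p n : ℕ} {i : Instr} : i ∈ jacobiSlp p n ↔
    ∃ k < 2 * n + 1, ∃ r < 12, ∃ j ≤ n, i = (wire n k r j, jacobiTerms p n k r j) := by
  simp only [jacobiSlp, List.mem_flatMap, List.mem_range, List.mem_map, eq_comm (a := i),
    Nat.lt_succ_iff]

theorem jacobiSlp_sorted (p n : ℕ) : (jacobiSlp p n).Pairwise fun i j => i.1 < j.1 := by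
  rw [jacobiSlp, List.pairwise_flatMap]
  refine ⟨fun k _ => ?_, List.pairwise_lt_range.imp fun hk => ?_⟩
  · rw [List.pairwise_flatMap]
    refine ⟨fun r _ => pairwise_map_range (fun i j hij => ?_) _,
      List.pairwise_lt_range.imp fun hr => ?_⟩
    · simp only [wire]; omega
    · intro x hx y hy
      simp only [List.mem_map, List.mem_range] at hx hy
      obtain ⟨i, hi, rfl⟩ := hx
      obtain ⟨j, hj, rfl⟩ := hy
      exact wire_lt hr (by omega)
  · intro x hx y hy
    simp only [List.mem_flatMap, List.mem_map, List.mem_range] at hx hy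
    obtain ⟨r, hr, i, hi, rfl⟩ := hx
    obtain ⟨r', hr', j, hj, rfl⟩ := hy
    exact wire_lt_of_stage_lt hk hr (by omega)

/-- The bits that may be used to compute the bit `i` of the register `r` of the stage `k`. -/
def Usable (n k r i c : ℕ) : Prop := c < wire n k r i ∧ c ≠ n

theorem usable_wire {n k r r' i i' : ℕ} (h : r < r') (hi : i ≤ n) :
    Usable n k r' i' (wire n k r i) := by
  refine ⟨wire_lt h hi, ?_⟩
  have := le_wire n k r i
  omega

theorem usable_self {n k r i : ℕ} (h : 0 < i) : Usable n k r i (wire n k r (i - 1)) := by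
  refine ⟨?_, ?_⟩
  · unfold wire; omega
  · have := le_wire n k r (i - 1)
    omega

theorem usable_stage {n k r r' i i' : ℕ} (h : 0 < k) (hr : r < 12) (hi : i ≤ n) :
    Usable n k r' i' (wire n (k - 1) r i) := by
  refine ⟨wire_lt_of_stage_lt (by omega) hr hi, ?_⟩
  have := le_wire n (k - 1) r i
  omega

theorem stageTerms_usable {n k r i : ℕ} (hr : r < 12) (hi : i ≤ n) (hn : 2 ≤ n) :
    ∀ t ∈ stageTerms n k i r, t.length ≤ 2 ∧ ∀ c ∈ t, Usable n k r i c := by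
  rcases Nat.eq_zero_or_pos i with h0 | h0
  all_goals
    interval_cases r <;>
      simp only [stageTerms, borrowTerms, h0, lt_irrefl, if_true, if_false, List.mem_cons,
        List.not_mem_nil, or_false, forall_eq_or_imp, forall_eq, false_imp_iff, implies_true,
        List.length_cons, List.length_nil, Nat.reduceAdd, le_refl, Nat.reduceLeDiff, true_and] <;>
      repeat' first
        | exact usable_self h0
        | exact usable_wire (by norm_num) (by omega)
        | apply And.intro

theorem nextTerms_usable {n k r i : ℕ} (hi : i ≤ n) (hn : 2 ≤ n) (hk : 0 < k) :
    ∀ t ∈ nextTerms n (k - 1) i r, t.length ≤ 2 ∧ ∀ c ∈ t, Usable n k r i c := by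
  unfold nextTerms
  split
  case h_1 =>
    split_ifs with h
    · simp only [List.mem_singleton, forall_eq]
      exact ⟨by simp, usable_stage hk (by norm_num) (by omega)⟩
    · simp
  all_goals
    simp only [List.mem_cons,
        List.not_mem_nil, or_false, forall_eq_or_imp, forall_eq, false_imp_iff, implies_true,
        List.length_cons, List.length_nil, Nat.reduceAdd, le_refl, Nat.reduceLeDiff, true_and]
  all_goals
    repeat' first | exact usable_stage hk (by norm_num) (by omega) | apply And.intro

theorem initTerms_usable {p n k r i : ℕ} :
    ∀ t ∈ initTerms p n i r, t.length ≤ 2 ∧ ∀ c ∈ t, Usable n k r i c := by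
  have := le_wire n k r i
  unfold initTerms Usable
  split
  · split_ifs with h
    · simp; omega
    · simp
  · split_ifs <;> simp
  · simp

theorem jacobiSlp_slp {p n : ℕ} (hn : 2 ≤ n) :
    Slp (n + 2) (wire n (2 * n + 1) 0 0) n (jacobiSlp p n) := by
  have key : ∀ k r i, r < 12 → i ≤ n → ∀ t ∈ jacobiTerms p n k r i,
      t.length ≤ 2 ∧ ∀ c ∈ t, Usable n k r i c := by
    intro k r i hr hi t ht
    rcases List.mem_append.1 ht with ht | ht
    · split_ifs at ht with hk
      · exact nextTerms_usable hi hn hk t ht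
      · exact initTerms_usable t ht
    · exact stageTerms_usable hr hi hn t ht
  refine ⟨jacobiSlp_sorted p n, ?_, ?_, ?_, ?_⟩
  all_goals
    intro i hi
    obtain ⟨k, hk, r, hr, j, hj, rfl⟩ := mem_jacobiSlp.1 hi
  · exact ⟨le_wire _ _ _ _, wire_lt_of_stage_lt hk hr hj⟩
  · exact fun t ht c hc => ((key k r j hr hj t ht).2 c hc).1
  · exact fun t ht => (key k r j hr hj t ht).1
  · exact fun t ht hc => ((key k r j hr hj t ht).2 n hc).2 rfl

/-- The registers `0`, `1`, `10` of the stage `k` hold a state of the algorithm. -/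
def Holds (n : ℕ) (v : ℕ → Bool) (k : ℕ) (q : ℕ × ℕ × Bool) : Prop :=
  ∀ i ≤ n, v (wire n k 0 i) = q.1.testBit i ∧ v (wire n k 1 i) = q.2.1.testBit i ∧
    v (wire n k 10 i) = q.2.2

theorem xorSum_borrowTerms (v : ℕ → Bool) (a b c : ℕ) :
    xorSum v (borrowTerms a b c) = maj (!v a) (v b) (v c) := by
  cases ha : v a <;> cases hb : v b <;> cases hc : v c <;>
    simp [xorSum, borrowTerms, maj, ha, hb, hc]

/-- The equations of the straight-line program are read off register by register, in the order of
their dependence; only the two borrow registers need an induction along the bits. -/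
theorem holds_succ {p n : ℕ} {s v : ℕ → Bool} (hv : Slp.Values (n + 2) (jacobiSlp p n) s v)
    (hn : 2 ≤ n) {k : ℕ} (hk : k < 2 * n) {q : ℕ × ℕ × Bool} (ha : q.1 < 2 ^ n)
    (hb : q.2.1 < 2 ^ n) (h : Holds n v k q) : Holds n v (k + 1) (jacobiStep q) := by
  obtain ⟨a, b, s⟩ := q
  simp only at ha hb
  have hval : ∀ k < 2 * n + 1, ∀ r < 12, ∀ i ≤ n,
      v (wire n k r i) = xorSum v (jacobiTerms p n k r i) := fun k hk r hr i hi =>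
    hv.eq _ (mem_jacobiSlp.2 ⟨k, hk, r, hr, i, hi, rfl⟩)
  have hst : ∀ r < 12, r ≠ 0 → r ≠ 1 → r ≠ 10 → ∀ i ≤ n,
      v (wire n k r i) = xorSum v (stageTerms n k i r) := by
    intro r hr h0 h1 h10 i hi
    rw [hval k (by omega) r hr i hi]
    have e1 : nextTerms n (k - 1) i r = [] := by unfold nextTerms; split <;> simp_all
    have e2 : initTerms p n i r = [] := by unfold initTerms; split <;> simp_all
    simp [jacobiTerms, e1, e2]
  have h0 : ∀ i ≤ n, v (wire n k 0 i) = a.testBit i := fun i hi => (h i hi).1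
  have h1 : ∀ i ≤ n, v (wire n k 1 i) = b.testBit i := fun i hi => (h i hi).2.1
  have h10 : ∀ i ≤ n, v (wire n k 10 i) = s := fun i hi => (h i hi).2.2
  have h2 : ∀ i ≤ n, v (wire n k 2 i) = borrow a b i := by
    intro i
    induction i with
    | zero =>
      intro hi
      rw [hst 2 (by norm_num) (by norm_num) (by norm_num) (by norm_num) 0 hi]
      simp [stageTerms, xorSum]
    | succ i ih =>
      intro hi
      rw [hst 2 (by norm_num) (by norm_num) (by norm_num) (by norm_num) _ hi, stageTerms,
        if_pos (Nat.succ_pos i), xorSum_borrowTerms, borrow_succ, Nat.add_sub_cancel,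
        h0 i (by omega), h1 i (by omega), ih (by omega)]
  set swap : Bool := a.testBit 0 && decide (a < b) with hswap
  have h3 : ∀ i ≤ n, v (wire n k 3 i) = swap := by
    intro i hi
    rw [hst 3 (by norm_num) (by norm_num) (by norm_num) (by norm_num) i hi]
    -- Borrow number `n` decides `a < b`, both numbers having at most `n` bits. To hold it,
    -- registers have `n + 1` bits.
    simp [stageTerms, xorSum, h0 0 (by omega), h2 n le_rfl, borrow_of_lt ha hb, hswap]
  set u := if swap then b else a with hu
  set w := if swap then a else b with hw
  have h4 : ∀ i ≤ n, v (wire n k 4 i) = u.testBit i := by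
    intro i hi
    rw [hst 4 (by norm_num) (by norm_num) (by norm_num) (by norm_num) i hi]
    simp only [stageTerms, xorSum, List.foldr_cons, List.foldr_nil, List.all_cons, List.all_nil,
      Bool.and_true, h0 i hi, h1 i hi, h3 i hi, hu]
    cases swap <;> cases ha : a.testBit i <;> cases hb : b.testBit i <;> simp [ha, hb]
  have h5 : ∀ i ≤ n, v (wire n k 5 i) = w.testBit i := by
    intro i hi
    rw [hst 5 (by norm_num) (by norm_num) (by norm_num) (by norm_num) i hi]
    simp only [stageTerms, xorSum, List.foldr_cons, List.foldr_nil, List.all_cons, List.all_nil,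
      Bool.and_true, h0 i hi, h1 i hi, h3 i hi, hw]
    cases swap <;> cases ha : a.testBit i <;> cases hb : b.testBit i <;> simp [ha, hb]
  set w' := if a.testBit 0 then w else 0 with hw'
  have h6 : ∀ i ≤ n, v (wire n k 6 i) = w'.testBit i := by
    intro i hi
    rw [hst 6 (by norm_num) (by norm_num) (by norm_num) (by norm_num) i hi]
    simp only [stageTerms, xorSum, List.foldr_cons, List.foldr_nil, List.all_cons, List.all_nil,
      Bool.and_true, h0 0 (by omega), h5 i hi, hw']
    cases a.testBit 0 <;> simp
  -- After the swap the subtrahend does not exceed the minuend, so register `8` holds the true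
  -- difference and not a residue modulo a power of 2.
  have hle : w' ≤ u := by
    rw [hw', hu, hw, hswap]
    cases a.testBit 0
    · simp
    · by_cases hab : a < b
      · simp [hab, hab.le]
      · simpa [hab] using not_lt.1 hab
  have h7 : ∀ i ≤ n, v (wire n k 7 i) = borrow u w' i := by
    intro i
    induction i with
    | zero =>
      intro hi
      rw [hst 7 (by norm_num) (by norm_num) (by norm_num) (by norm_num) 0 hi]
      simp [stageTerms, xorSum]
    | succ i ih =>
      intro hi
      rw [hst 7 (by norm_num) (by norm_num) (by norm_num) (by norm_num) _ hi, stageTerms,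
        if_pos (Nat.succ_pos i), xorSum_borrowTerms, borrow_succ, Nat.add_sub_cancel,
        h4 i (by omega), h6 i (by omega), ih (by omega)]
  have h8 : ∀ i ≤ n, v (wire n k 8 i) = (u - w').testBit i := by
    intro i hi
    rw [hst 8 (by norm_num) (by norm_num) (by norm_num) (by norm_num) i hi, testBit_sub_eq hle]
    simp [stageTerms, xorSum, h4 i hi, h6 i hi, h7 i hi]
  have h9 : v (wire n k 9 0) = (a.testBit 1 && b.testBit 1) := by
    rw [hst 9 (by norm_num) (by norm_num) (by norm_num) (by norm_num) 0 (by omega)]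
    simp [stageTerms, xorSum, h0 1 (by omega), h1 1 (by omega)]
  have hstep : jacobiStep (a, b, s) = ((u - w') / 2, w,
      s ^^ (swap && (a.testBit 1 && b.testBit 1)) ^^ w.testBit 1 ^^ w.testBit 2) := rfl
  have hnx : ∀ r < 12, ∀ i ≤ n, stageTerms n (k + 1) i r = [] →
      v (wire n (k + 1) r i) = xorSum v (nextTerms n k i r) := by
    intro r hr i hi he
    rw [hval (k + 1) (by omega) r hr i hi]
    simp [jacobiTerms, he]
  have hub : u - w' < 2 ^ n := by
    have : u < 2 ^ n := by rw [hu]; split_ifs <;> assumption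
    omega
  rw [hstep]
  intro i hi
  refine ⟨?_, ?_, ?_⟩
  · rw [hnx 0 (by norm_num) i hi rfl, Nat.testBit_div_two]
    -- Halving is a shift of the wiring: bit `i` of the new number is bit `i + 1` of register `8`,
    -- and the top bit is zero.
    rcases hi.lt_or_eq with hi | rfl
    · simp [nextTerms, hi, xorSum, h8 (i + 1) hi]
    · rw [Nat.testBit_lt_two_pow (hub.trans (Nat.pow_lt_pow_right (by norm_num) (by omega)))]
      simp [nextTerms, xorSum]
  · rw [hnx 1 (by norm_num) i hi rfl]
    simp [nextTerms, xorSum, h5 i hi]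
  · rw [hnx 10 (by norm_num) i hi rfl]
    simp [nextTerms, xorSum, h10 i hi, h3 0 (by omega), h9, h5 1 (by omega), h5 2 hn]

/-- The circuit computing the indicator of the nonresidues. -/
def jacobiCircuit (p n : ℕ) : Circuit := slpCircuit (jacobiSlp p n) (wire n (2 * n) 11 0) n

/-- Stage `k` holds the state after `k` steps of the binary algorithm, by induction with
`holds_succ`; register `11` of stage `2n` then evaluates the formula of `jacobiIndicator_eq`. -/
theorem jacobiCircuit_isJacobiCircuit {p n W : ℕ} (hp : Admissible p n)
    (hW : wire n (2 * n + 1) 0 0 ≤ W) : IsJacobiCircuit p n W (jacobiCircuit p n) := by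
  have hn := hp.pos
  have hS := jacobiSlp_slp (p := p) (n := n) (by omega)
  have hS : Slp (n + 2) W n (jacobiSlp p n) :=
    ⟨hS.1, fun i hi => ⟨(hS.2 i hi).1, (hS.2 i hi).2.trans_le hW⟩, hS.3, hS.4, hS.5⟩
  have hr : wire n (2 * n) 11 0 < W :=
    (wire_lt_of_stage_lt (by omega) (by norm_num) (by omega)).trans_le hW
  have hr' := le_wire n (2 * n) 11 0
  have h2 : p % 2 = 1 := by have := hp.2.1; omega
  refine ⟨hS.reversible hr (by omega) (by omega), fun x hx => ?_⟩
  rw [ket_eq_basis, jacobiCircuit, hS.run hr (by omega) (by omega) (by omega), ket_eq_basis,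
    testBit_add_two_pow hx (jacobiIndicator_lt p x), Nat.testBit_lt_two_pow hx, Bool.false_xor]
  congr 2
  have hv := hS.exists_values (s := x.testBit) fun j hj => Nat.testBit_lt_two_pow
    (hx.trans_le (Nat.pow_le_pow_right (by norm_num) (by omega)))
  set v := actAll (slpOps (jacobiSlp p n)) x.testBit
  have hval : ∀ k < 2 * n + 1, ∀ r < 12, ∀ i ≤ n,
      v (wire n k r i) = xorSum v (jacobiTerms p n k r i) := fun k hk r hr i hi =>
    hv.eq _ (mem_jacobiSlp.2 ⟨k, hk, r, hr, i, hi, rfl⟩)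
  have hlt : ∀ k, (jacobiState p x k).1 < 2 ^ n ∧ (jacobiState p x k).2.1 < 2 ^ n := fun k =>
    (jacobiState_spec h2 x k).2.2.2.2 _ hx hp.2.2.2
  have key : ∀ k ≤ 2 * n, Holds n v k (jacobiState p x k) := by
    intro k
    induction k with
    | zero =>
      intro _ i hi
      refine ⟨?_, ?_, ?_⟩
      · rw [hval 0 (by omega) 0 (by norm_num) i hi]
        rcases hi.lt_or_eq with hi' | rfl
        · simp [jacobiTerms, initTerms, stageTerms, hi', xorSum, jacobiState, hv.input i (by omega)]
        · simp [jacobiTerms, initTerms, stageTerms, xorSum, jacobiState,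
            Nat.testBit_lt_two_pow hx]
      · rw [hval 0 (by omega) 1 (by norm_num) i hi]
        cases hb : p.testBit i <;>
          simp [jacobiTerms, initTerms, stageTerms, xorSum, jacobiState, hb]
      · rw [hval 0 (by omega) 10 (by norm_num) i hi]
        simp [jacobiTerms, initTerms, stageTerms, xorSum, jacobiState]
    | succ k ih =>
      intro hk
      rw [jacobiState_succ]
      exact holds_succ hv (by omega) hk (hlt k).1 (hlt k).2 (ih (by omega))
  have h := key (2 * n) le_rfl
  rw [hval (2 * n) (by omega) 11 (by norm_num) 0 (by omega)]
  rw [jacobiIndicator_eq hp.1 h2 (by omega) ?_ hp.2.2.2 hx]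
  · simp [jacobiTerms, nextTerms, stageTerms, initTerms, xorSum, (h 0 (by omega)).2.2,
      (h (n - 1) (by omega)).2.1]
  · have h3 := hp.2.2.1
    have : 2 ^ n = 2 ^ (n - 1) * 2 := by rw [← pow_succ]; congr 1; omega
    omega

/-! ### Descriptions of the gates -/

def zeroDesc : EntryDesc := ⟨[0, 1], -1, 1, 0, 1⟩

/-- A number on the upper half of the unit circle. -/
def unitDesc (a b : ℤ) : EntryDesc := ⟨[a, b, a], -1, 1, 0, 1⟩

def invSqrtTwoDesc : EntryDesc := ⟨[-1, 0, 2], 0, 1, 0, 1⟩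

def negInvSqrtTwoDesc : EntryDesc := ⟨[-1, 0, 2], -1, 0, 0, 1⟩

theorem zeroDesc_denotes : zeroDesc.Denotes 0 := by
  refine ⟨⟨1, by simp [zeroDesc], one_ne_zero⟩, ?_⟩
  ext w
  simp only [EntryDesc.eval, zeroDesc, List.foldr_cons, List.foldr_nil, Set.mem_ofPred_eq,
    Set.mem_singleton_iff]
  constructor
  · rintro ⟨h, -⟩
    simpa using h
  · rintro rfl
    norm_num

/-- For `z` on the unit circle, `z` and its conjugate are the roots of `a w² + b w + a` with `b = -2
a Re z`. The rectangle covers the closed upper half disc, so it contains the conjugate only if `z`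
is real, when the two roots coincide. -/
theorem unitDesc_denotes {a b : ℤ} {z : ℂ} (hz : ‖z‖ = 1) (him : 0 ≤ z.im) (ha : a ≠ 0)
    (hb : (b : ℝ) = -2 * a * z.re) : (unitDesc a b).Denotes z := by
  refine ⟨⟨a, by simp [unitDesc], ha⟩, ?_⟩
  have h1 : z * (starRingEnd ℂ) z = 1 := by
    rw [Complex.mul_conj, Complex.normSq_eq_norm_sq, hz]; simp
  have h2 : (b : ℂ) = -a * (z + (starRingEnd ℂ) z) := by
    rw [Complex.add_conj]
    have : (b : ℂ) = ((b : ℝ) : ℂ) := by push_cast; rfl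
    rw [this, hb]
    push_cast
    ring
  have heval : ∀ w, (unitDesc a b).eval w = a * ((w - z) * (w - (starRingEnd ℂ) z)) := by
    intro w
    simp only [EntryDesc.eval, unitDesc, List.foldr_cons, List.foldr_nil]
    rw [h2]
    linear_combination -(a : ℂ) * h1
  have hre := abs_le.1 ((Complex.abs_re_le_norm z).trans hz.le)
  have him' := abs_le.1 ((Complex.abs_im_le_norm z).trans hz.le)
  have ha' : (a : ℂ) ≠ 0 := by exact_mod_cast ha
  ext w
  simp only [Set.mem_ofPred_eq, Set.mem_singleton_iff, heval]
  constructor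
  · rintro ⟨h, -, -, hw, -⟩
    rcases mul_eq_zero.1 ((mul_eq_zero.1 h).resolve_left ha') with h | h
    · exact sub_eq_zero.1 h
    · have h := sub_eq_zero.1 h
      have hzi : z.im = 0 := by
        rw [h, Complex.conj_im] at hw
        simp only [unitDesc] at hw
        norm_num at hw
        linarith
      rw [h]
      exact Complex.conj_eq_iff_im.2 hzi
  · rintro rfl
    refine ⟨by simp, ?_⟩
    simp only [unitDesc]
    norm_num
    exact ⟨hre.1, hre.2, him, him'.2⟩

theorem oneDesc_denotes : (unitDesc 1 (-2)).Denotes 1 :=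
  unitDesc_denotes (by simp) (by simp) one_ne_zero (by simp)

theorem sqrtDesc_eval {d : EntryDesc} (hd : d.coeffs = [-1, 0, 2]) {w : ℂ} (h : d.eval w = 0) :
    w = 1 / (Real.sqrt 2 : ℂ) ∨ w = -(1 / (Real.sqrt 2 : ℂ)) := by
  have h2 : (1 / (Real.sqrt 2 : ℂ)) ^ 2 = 1 / 2 := by
    rw [div_pow, ← Complex.ofReal_pow, Real.sq_sqrt (by norm_num)]; norm_num
  rw [← sq_eq_sq_iff_eq_or_eq_neg, h2]
  simp only [EntryDesc.eval, hd, List.foldr_cons, List.foldr_nil] at h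
  push_cast at h
  linear_combination h / 2

theorem one_div_sqrt_two : 0 < 1 / Real.sqrt 2 ∧ 1 / Real.sqrt 2 ≤ 1 := by
  have h : 1 ≤ Real.sqrt 2 := Real.one_le_sqrt.2 (by norm_num)
  exact ⟨by positivity, (div_le_one (by positivity)).2 h⟩

theorem invSqrtTwoDesc_denotes : invSqrtTwoDesc.Denotes (1 / (Real.sqrt 2 : ℂ)) := by
  refine ⟨⟨-1, by simp [invSqrtTwoDesc], by norm_num⟩, ?_⟩
  obtain ⟨h0, h1⟩ := one_div_sqrt_two
  have hc : (1 / (Real.sqrt 2 : ℂ)) = ((1 / Real.sqrt 2 : ℝ) : ℂ) := by push_cast; rfl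
  have h2 : (1 / (Real.sqrt 2 : ℂ)) ^ 2 = 1 / 2 := by
    rw [div_pow, ← Complex.ofReal_pow, Real.sq_sqrt (by norm_num)]; norm_num
  ext w
  simp only [Set.mem_ofPred_eq, Set.mem_singleton_iff]
  constructor
  · rintro ⟨h, hw, -⟩
    rcases sqrtDesc_eval rfl h with h | h
    · exact h
    · rw [h, hc, Complex.neg_re, Complex.ofReal_re] at hw
      simp only [invSqrtTwoDesc, Rat.cast_zero] at hw
      linarith
  · rintro rfl
    refine ⟨?_, ?_⟩
    · simp only [EntryDesc.eval, invSqrtTwoDesc, List.foldr_cons, List.foldr_nil]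
      push_cast
      linear_combination 2 * h2
    · rw [hc, Complex.ofReal_re, Complex.ofReal_im]
      simp only [invSqrtTwoDesc, Rat.cast_zero, Rat.cast_one]
      exact ⟨h0.le, h1, le_rfl, zero_le_one⟩

theorem negInvSqrtTwoDesc_denotes : negInvSqrtTwoDesc.Denotes (-(1 / (Real.sqrt 2 : ℂ))) := by
  refine ⟨⟨-1, by simp [negInvSqrtTwoDesc], by norm_num⟩, ?_⟩
  obtain ⟨h0, h1⟩ := one_div_sqrt_two
  have hc : (1 / (Real.sqrt 2 : ℂ)) = ((1 / Real.sqrt 2 : ℝ) : ℂ) := by push_cast; rfl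
  have h2 : (1 / (Real.sqrt 2 : ℂ)) ^ 2 = 1 / 2 := by
    rw [div_pow, ← Complex.ofReal_pow, Real.sq_sqrt (by norm_num)]; norm_num
  ext w
  simp only [Set.mem_ofPred_eq, Set.mem_singleton_iff]
  constructor
  · rintro ⟨h, -, hw, -⟩
    rcases sqrtDesc_eval rfl h with h | h
    · rw [h, hc, Complex.ofReal_re] at hw
      simp only [negInvSqrtTwoDesc, Rat.cast_zero] at hw
      linarith
    · exact h
  · rintro rfl
    refine ⟨?_, ?_⟩
    · simp only [EntryDesc.eval, negInvSqrtTwoDesc, List.foldr_cons, List.foldr_nil]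
      push_cast
      linear_combination 2 * h2
    · rw [hc, Complex.neg_re, Complex.neg_im, Complex.ofReal_re, Complex.ofReal_im]
      simp only [negInvSqrtTwoDesc, Rat.cast_zero, Rat.cast_one, Rat.cast_neg]
      exact ⟨by linarith, by linarith, by norm_num, by norm_num⟩

/-- The description of a NOT gate with controls. -/
def Op.desc (o : Op) : GateDesc :=
  ⟨o.1, o.2, zeroDesc, unitDesc 1 (-2), unitDesc 1 (-2), zeroDesc⟩

/-- The description of a phase rotation with controls. -/
def phaseDesc (cs : List ℕ) (t : ℕ) (a b : ℤ) : GateDesc :=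
  ⟨cs, t, unitDesc 1 (-2), zeroDesc, zeroDesc, unitDesc a b⟩

def hadamardDesc (t : ℕ) : GateDesc :=
  ⟨[], t, invSqrtTwoDesc, invSqrtTwoDesc, invSqrtTwoDesc, negInvSqrtTwoDesc⟩

theorem Op.desc_denotes (o : Op) : o.desc.Denotes o.toGate := by
  refine ⟨rfl, rfl, ?_, ?_, ?_, ?_⟩ <;> simp only [Op.toGate, Op.desc, notMatrix]
  · simpa using zeroDesc_denotes
  · simpa using oneDesc_denotes
  · simpa using oneDesc_denotes
  · simpa using zeroDesc_denotes

theorem phaseDesc_denotes (cs : List ℕ) (t : ℕ) {a b : ℤ} {φ : ℝ} (him : 0 ≤ Real.sin φ)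
    (ha : a ≠ 0) (hb : (b : ℝ) = -2 * a * Real.cos φ) :
    (phaseDesc cs t a b).Denotes ⟨cs, t, phaseMatrix φ⟩ := by
  refine ⟨rfl, rfl, ?_, ?_, ?_, ?_⟩ <;> simp only [phaseDesc, phaseMatrix]
  · simpa using oneDesc_denotes
  · simpa using zeroDesc_denotes
  · simpa using zeroDesc_denotes
  · simp only [if_true]
    rw [mul_comm]
    refine unitDesc_denotes (Complex.norm_exp_ofReal_mul_I φ) ?_ ha ?_
    · rwa [Complex.exp_ofReal_mul_I_im]
    · rwa [Complex.exp_ofReal_mul_I_re]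

theorem hadamardDesc_denotes (t : ℕ) : (hadamardDesc t).Denotes ⟨[], t, hadamardMatrix⟩ := by
  refine ⟨rfl, rfl, ?_, ?_, ?_, ?_⟩ <;> simp only [hadamardDesc, hadamardMatrix]
  · simpa using invSqrtTwoDesc_denotes
  · simpa using invSqrtTwoDesc_denotes
  · simpa using invSqrtTwoDesc_denotes
  · simpa using negInvSqrtTwoDesc_denotes

/-- The middle coefficient for the rotation by `θ`, where `N = 2 ^ n` and `p` is odd. -/
def coeffOne (p n : ℕ) : ℤ := 2 * (2 ^ (n - 1) - (p / 2 : ℕ))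

/-- The middle coefficient for the rotation by `-2 * θ`. -/
def coeffTwo (p n : ℕ) : ℤ := 2 * (p / 2 : ℕ) ^ 2 - (coeffOne p n) ^ 2

def hadamardDescs (n : ℕ) : List GateDesc := (List.range n).map hadamardDesc

def jacobiOps (p n : ℕ) : List Op :=
  computeCopy (slpOps (jacobiSlp p n)) (wire n (2 * n) 11 0) n

def comparatorOps (p n : ℕ) : List Op :=
  computeCopy (slpOps (comparatorSlp p n)) (n + 2 + n) (n + 1)

/-- The description of the algorithm. -/
def algorithmDescs (p n : ℕ) : List GateDesc :=
  hadamardDescs n ++ (jacobiOps p n).map Op.desc ++ (comparatorOps p n).map Op.desc ++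
    [phaseDesc [n, n + 1] 0 ((p / 2 : ℕ) ^ 2) (coeffTwo p n),
      phaseDesc [n + 1] n (p / 2 : ℕ) (coeffOne p n)] ++
    (comparatorOps p n).reverse.map Op.desc ++ (jacobiOps p n).reverse.map Op.desc ++
    hadamardDescs n ++
    ((slpOps (zeroTestSlp n)).map Op.desc ++ ([phaseDesc [] (n + 2 + n) 1 2] ++
      (slpOps (zeroTestSlp n)).reverse.map Op.desc)) ++
    hadamardDescs n

theorem forall₂_ops (l : List Op) :
    List.Forall₂ GateDesc.Denotes (l.map Op.desc) (l.map Op.toGate) := by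
  rw [List.forall₂_map_left_iff, List.forall₂_map_right_iff, List.forall₂_same]
  exact fun o _ => o.desc_denotes

theorem forall₂_hadamards (n : ℕ) :
    List.Forall₂ GateDesc.Denotes (hadamardDescs n) (hadamards n) := by
  rw [hadamardDescs, hadamards, List.forall₂_map_left_iff, List.forall₂_map_right_iff,
    List.forall₂_same]
  exact fun t _ => hadamardDesc_denotes t

/-- Put `r = p / 2 = (p - 1) / 2`. Then `r cos θ = r - 2 ^ (n - 1)` is an integer, so `coeffOne` is
`-2 r cos θ`, and by the double angle formula `-2 r² cos 2θ = 2 r² - (2 r cos θ)²` is `coeffTwo`. -/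
theorem algorithmDescs_denotes {p n : ℕ} (hp : Admissible p n) :
    List.Forall₂ GateDesc.Denotes (algorithmDescs p n)
      (algorithm p n (jacobiCircuit p n) (comparator p n) (zeroFlip n)) := by
  have happ : ∀ {l l' : List GateDesc} {m m' : Circuit}, List.Forall₂ GateDesc.Denotes l m →
      List.Forall₂ GateDesc.Denotes l' m' → List.Forall₂ GateDesc.Denotes (l ++ l') (m ++ m') :=
    fun h h' => List.rel_append h h'
  have h17 := hp.two_le
  have h8 := hp.2.1
  have hn := hp.pos
  have hcos := hp.cos_angle
  obtain ⟨r, hr⟩ : ∃ r, r = p / 2 := ⟨_, rfl⟩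
  have e1 : coeffOne p n = 2 * (2 ^ (n - 1) - (r : ℤ)) := by rw [coeffOne, hr]
  have e2 : coeffTwo p n = 2 * (r : ℤ) ^ 2 - (coeffOne p n) ^ 2 := by rw [coeffTwo, hr]
  have hp2 : p = 2 * r + 1 := by omega
  have hr0 : (0 : ℝ) < r := by
    have : 0 < r := by omega
    exact_mod_cast this
  have hN : (2 : ℝ) ^ n = 2 * 2 ^ (n - 1) := by
    rw [← pow_succ']; congr 1; omega
  have hcos' : Real.cos (angle p n) * r = r - 2 ^ (n - 1) := by
    rw [hcos, hN, hp2]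
    push_cast
    field_simp
    ring
  have hMr : (r : ℝ) ≤ 2 ^ (n - 1) := by
    have h3 := hp.2.2.2
    have : 2 ^ n = 2 * 2 ^ (n - 1) := by rw [← pow_succ']; congr 1; omega
    have : r ≤ 2 ^ (n - 1) := by omega
    exact_mod_cast this
  have hsin : 0 ≤ Real.sin (angle p n) :=
    Real.sin_nonneg_of_nonneg_of_le_pi (Real.arccos_nonneg _) (Real.arccos_le_pi _)
  -- This is where `p < 2 ^ n` enters. It makes `sin (-2θ) = -2 sin θ cos θ` nonnegative, so the
  -- rotation by `-2θ` also has its entry in the upper half plane.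
  have hcos0 : Real.cos (angle p n) ≤ 0 := by
    by_contra h
    have := mul_pos (not_le.1 h) hr0
    linarith
  have hr0' : (r : ℤ) ≠ 0 := by
    have : 0 < r := by omega
    exact_mod_cast this.ne'
  unfold algorithmDescs algorithm
  rw [← hr]
  refine happ (happ (happ (happ (happ (happ (happ (happ (forall₂_hadamards n)
    (forall₂_ops _)) (forall₂_ops _)) ?_) ?_) ?_) (forall₂_hadamards n)) ?_) (forall₂_hadamards n)
  · refine .cons (phaseDesc_denotes _ _ ?_ (pow_ne_zero _ hr0') ?_)
      (.cons (phaseDesc_denotes _ _ hsin hr0' ?_) .nil)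
    · rw [neg_mul, Real.sin_neg, Real.sin_two_mul]
      nlinarith
    · rw [neg_mul 2 (angle p n), Real.cos_neg, Real.cos_two_mul, e2, e1]
      push_cast
      linear_combination (4 * Real.cos (angle p n) * r + 4 * (r - 2 ^ (n - 1))) * hcos'
    · rw [e1]
      push_cast
      linear_combination 2 * hcos'
  · rw [comparator, slpCircuit, inverse_ops]
    exact forall₂_ops _
  · rw [jacobiCircuit, slpCircuit, inverse_ops]
    exact forall₂_ops _
  · refine happ (forall₂_ops _) (happ ?_ (forall₂_ops _))
    -- For the phase `π` the quadratic is `(w + 1)²`.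
    exact .cons (phaseDesc_denotes _ _ (by simp) one_ne_zero (by simp)) .nil

/-! ### Writing down circuits -/

/-- The list of gates, and the reversed list, are written in polynomial time. -/
def PTG (C : Ctx α) (L : α → List GateDesc) : Prop :=
  (PT C fun x => (L x).flatMap GateDesc.encode) ∧
    PT C fun x => (L x).reverse.flatMap GateDesc.encode

theorem PTG.congr {L L' : α → List GateDesc} (h : PTG C L) (hL : ∀ x, L x = L' x) : PTG C L' := by
  rwa [← funext hL]

theorem PTG.nil : PTG C fun _ => [] := ⟨.nil, .nil⟩

theorem PTG.singleton {g : α → GateDesc} (h : PT C fun x => (g x).encode) :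
    PTG C fun x => [g x] := by
  refine ⟨?_, ?_⟩ <;> simpa using h

theorem PTG.append {L L' : α → List GateDesc} (h : PTG C L) (h' : PTG C L') :
    PTG C fun x => L x ++ L' x := by
  refine ⟨?_, ?_⟩
  · simpa using h.1.append h'.1
  · simpa using h'.2.append h.2

/-- Keeping track of both orders makes the class closed under reversal, as the uncomputation parts
of the circuits require. -/
theorem PTG.reverse {L : α → List GateDesc} (h : PTG C L) : PTG C fun x => (L x).reverse :=
  ⟨h.2, by simpa using h.1⟩

theorem PTG.ite {P : α → Prop} [DecidablePred P] {L L' : α → List GateDesc}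
    (hP : PTB C fun x => decide (P x)) (h : PTG C L) (h' : PTG C L') :
    PTG C fun x => if P x then L x else L' x := by
  refine ⟨(hP.ite h.1 h'.1).congr fun x _ => ?_, (hP.ite h.2 h'.2).congr fun x _ => ?_⟩ <;>
    by_cases hx : P x <;> simp [hx]

theorem PTG.flatMap {n : α → ℕ} {F : α → ℕ → List GateDesc} (hn : PTU C n)
    (hF : PTG (C.upto n) fun y => F y.1 y.2) : PTG C fun x => (List.range (n x)).flatMap (F x) := by
  refine ⟨(hn.flatMap (f := fun x i => (F x i).flatMap GateDesc.encode) hF.1).congr fun x _ => ?_,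
    (hn.flatMap_reverse (f := fun x i => (F x i).reverse.flatMap GateDesc.encode) hF.2).congr
      fun x _ => ?_⟩
  · rw [List.flatMap_assoc]
  · rw [List.reverse_flatMap, List.flatMap_assoc]
    rfl

theorem PTG.flatMap_const {F : α → ℕ → List GateDesc} {l : List ℕ}
    (h : ∀ r ∈ l, PTG C fun x => F x r) : PTG C fun x => l.flatMap (F x) := by
  induction l with
  | nil => exact .nil
  | cons r l ih =>
    exact (h r List.mem_cons_self).append (ih fun r' hr' => h r' (List.mem_cons_of_mem _ hr'))

theorem PTU.encodeUnary {f : α → ℕ} (h : PTU C f) : PT C fun x => encodeUnary (f x) :=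
  PT.append h (PT.const _)

/-- A list of qubits is written in polynomial time. -/
def PTM (C : Ctx α) (m : α → List ℕ) : Prop := PT C fun x => encodeList QNR.encodeUnary (m x)

theorem PTM.nil : PTM C fun _ => [] := PT.const _

theorem PTM.one {a : α → ℕ} (ha : PTU C a) : PTM C fun x => [a x] := by
  have := ((PT.const [Γ'.bra]).append ha.encodeUnary).append (PT.const (C := C) [Γ'.ket])
  simpa [PTM, encodeList] using this

theorem PTM.two {a b : α → ℕ} (ha : PTU C a) (hb : PTU C b) : PTM C fun x => [a x, b x] := by
  have := ((PT.const [Γ'.bra]).append (ha.encodeUnary.append hb.encodeUnary)).append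
    (PT.const (C := C) [Γ'.ket])
  simpa [PTM, encodeList] using this

theorem PTM.desc {m : α → List ℕ} {t : α → ℕ} (hm : PTM C m) (ht : PTU C t) :
    PT C fun x => (Op.desc (m x, t x)).encode := by
  have := ((((PT.append hm ht.encodeUnary).append (.const zeroDesc.encode)).append
    (.const (unitDesc 1 (-2)).encode)).append (.const (unitDesc 1 (-2)).encode)).append
    (.const zeroDesc.encode)
  refine this.congr fun x _ => ?_
  simp only [GateDesc.encode, Op.desc]

/-- The operations for the given products are written in polynomial time, for any target. -/
def PTT (C : Ctx α) (T : α → List (List ℕ)) : Prop :=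
  ∀ t, PTU C t → PTG C fun x => (T x).map fun m => Op.desc (m, t x)

theorem PTT.nil : PTT C fun _ => [] := fun _ _ => .nil

theorem PTT.cons {m : α → List ℕ} {T : α → List (List ℕ)} (hm : PTM C m) (hT : PTT C T) :
    PTT C fun x => m x :: T x := fun t ht =>
  (PTG.singleton (hm.desc ht)).append (hT t ht)

theorem PTT.append {T T' : α → List (List ℕ)} (hT : PTT C T) (hT' : PTT C T') :
    PTT C fun x => T x ++ T' x := fun t ht =>
  ((hT t ht).append (hT' t ht)).congr fun x => by simp

theorem PTT.ite {P : α → Prop} [DecidablePred P] {T T' : α → List (List ℕ)}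
    (hP : PTB C fun x => decide (P x)) (h : PTT C T) (h' : PTT C T') :
    PTT C fun x => if P x then T x else T' x := fun t ht =>
  (PTG.ite hP (h t ht) (h' t ht)).congr fun x => by
    by_cases hx : P x <;> simp only [hx, if_true, if_false]

theorem PTB.decide_eq_true {b : α → Bool} (h : PTB C b) : PTB C fun x => decide (b x = true) :=
  h.congr fun x _ => by simp

/-! ### Writing down the Jacobi symbol circuit -/

theorem PTU.wire {n k i : α → ℕ} (hn : PTU C n) (hk : PTU C k) (r : ℕ) (hi : PTU C i) :
    PTU C fun x => wire (n x) (k x) r (i x) :=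
  ((hn.add (.const 2)).add (((hk.mul (.const 12)).add (.const r)).mul (hn.add (.const 1)))).add hi

theorem PTT.borrowTerms {a b c : α → ℕ} (ha : PTU C a) (hb : PTU C b) (hc : PTU C c) :
    PTT C fun x => borrowTerms (a x) (b x) (c x) :=
  .cons (.one hb) (.cons (.two ha hb) (.cons (.one hc) (.cons (.two ha hc)
    (.cons (.two hb hc) .nil))))

/-- The register number `r` is fixed, so each of the twelve cases is a concrete list of products;
only the width, the stage and the bit position are computed by the machine. -/
theorem PTT.jacobiTerms {p n k i : α → ℕ} (hp : PTN C p) (hn : PTU C n) (hk : PTU C k)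
    (hi : PTU C i) {r : ℕ} (hr : r < 12) :
    PTT C fun x => jacobiTerms (p x) (n x) (k x) r (i x) := by
  have hk' := hk.sub (.const 1)
  have hi' := hi.sub (.const 1)
  have h0 : PTU C fun _ => 0 := .const 0
  have h1 : PTU C fun _ => 1 := .const 1
  have h2 : PTU C fun _ => 2 := .const 2
  have hpos := PTU.pos hi
  refine .append (.ite (PTU.pos hk) ?_ ?_) ?_
  · interval_cases r <;> simp only [nextTerms]
    case _ => exact .ite (PTU.lt hi hn) (.cons (.one (hn.wire hk' 8 (hi.add h1))) .nil) .nil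
    case _ => exact .cons (.one (hn.wire hk' 5 hi)) .nil
    all_goals try exact .nil
    exact .cons (.one (hn.wire hk' 10 hi)) (.cons (.two (hn.wire hk' 3 h0) (hn.wire hk' 9 h0))
      (.cons (.one (hn.wire hk' 5 h1)) (.cons (.one (hn.wire hk' 5 h2)) .nil)))
  · interval_cases r <;> simp only [initTerms]
    case _ => exact .ite (PTU.lt hi hn) (.cons (.one hi) .nil) .nil
    case _ => exact .ite (hp.testBit hi).decide_eq_true (.cons .nil .nil) .nil
    all_goals exact .nil
  · interval_cases r <;> simp only [stageTerms]
    case _ => exact .nil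
    case _ => exact .nil
    case _ => exact .ite hpos (.borrowTerms (hn.wire hk 0 hi') (hn.wire hk 1 hi')
        (hn.wire hk 2 hi')) .nil
    case _ => exact .cons (.two (hn.wire hk 0 h0) (hn.wire hk 2 hn)) .nil
    case _ => exact .cons (.one (hn.wire hk 0 hi)) (.cons (.two (hn.wire hk 3 hi) (hn.wire hk 0 hi))
        (.cons (.two (hn.wire hk 3 hi) (hn.wire hk 1 hi)) .nil))
    case _ => exact .cons (.one (hn.wire hk 1 hi)) (.cons (.two (hn.wire hk 3 hi) (hn.wire hk 0 hi))
        (.cons (.two (hn.wire hk 3 hi) (hn.wire hk 1 hi)) .nil))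
    case _ => exact .cons (.two (hn.wire hk 0 h0) (hn.wire hk 5 hi)) .nil
    case _ => exact .ite hpos (.borrowTerms (hn.wire hk 4 hi') (hn.wire hk 6 hi')
        (hn.wire hk 7 hi')) .nil
    case _ => exact .cons (.one (hn.wire hk 4 hi)) (.cons (.one (hn.wire hk 6 hi))
        (.cons (.one (hn.wire hk 7 hi)) .nil))
    case _ => exact .cons (.two (hn.wire hk 0 h1) (hn.wire hk 1 h1)) .nil
    case _ => exact .nil
    case _ => exact .cons (.one (hn.wire hk 10 hi)) (.cons (.two (hn.wire hk 10 hi)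
        (hn.wire hk 1 (hn.sub h1))) .nil)

/-- Stages and bit positions are loops of the machine, whereas the twelve registers of a stage are
unrolled. -/
theorem PTG.jacobiSlp {p n : α → ℕ} (hp : PTN C p) (hn : PTU C n) :
    PTG C fun x => (slpOps (jacobiSlp (p x) (n x))).map Op.desc := by
  have hk := (hn.add hn).add (.const 1)
  have key : PTG C fun x => (List.range (n x + n x + 1)).flatMap fun k =>
      (List.range 12).flatMap fun r => (List.range (n x + 1)).flatMap fun i =>
        (QNR.jacobiTerms (p x) (n x) k r i).map fun m => Op.desc (m, QNR.wire (n x) k r i) := by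
    refine .flatMap hk (.flatMap_const fun r hr => ?_)
    have hi := (hn.up (n := fun x => n x + n x + 1)).add (.const 1)
    refine .flatMap hi (PTT.jacobiTerms hp.up.up hn.up.up hk.index.up hi.index
      (List.mem_range.1 hr) _ (hn.up.up.wire hk.index.up r hi.index))
  refine key.congr fun x => ?_
  simp only [slpOps, QNR.jacobiSlp, List.map_flatMap, List.flatMap_assoc, List.flatMap_map,
    Instr.ops, List.map_map, two_mul]
  rfl

theorem PTG.computeCopy {l : α → List Op} {r k : α → ℕ} (hl : PTG C fun x => (l x).map Op.desc)
    (hr : PTU C r) (hk : PTU C k) : PTG C fun x => (computeCopy (l x) (r x) (k x)).map Op.desc :=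
  (hl.append ((PTG.singleton ((PTM.one hr).desc hk)).append hl.reverse)).congr fun x => by
    simp [QNR.computeCopy]

theorem PTG.map_range {n : α → ℕ} {F : α → ℕ → Instr} (hn : PTU C n)
    (ht : PTU (C.upto n) fun y => (F y.1 y.2).1) (hF : PTT (C.upto n) fun y => (F y.1 y.2).2) :
    PTG C fun x => (slpOps ((List.range (n x)).map (F x))).map Op.desc := by
  refine (PTG.flatMap hn (F := fun x i => (F x i).2.map fun m => Op.desc (m, (F x i).1))
    (hF _ ht)).congr fun x => ?_
  simp only [slpOps, List.map_flatMap, List.flatMap_map, Instr.ops, List.map_map]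
  rfl

theorem PTG.comparatorSlp {p n : α → ℕ} (hp : PTN C p) (hn : PTU C n) :
    PTG C fun x => (slpOps (comparatorSlp (p x) (n x))).map Op.desc := by
  have hi := hn.index
  have hw := (hn.up.add (.const 2)).add hi
  exact .map_range hn ((hn.up.add (.const 3)).add hi) (.append (.ite (hp.up.testBit hi).decide_eq_true
    (.cons .nil (.cons (.one hi) .nil)) (.cons (.one hw) .nil)) (.cons (.two hi hw) .nil))

theorem PTG.zeroTestSlp {n : α → ℕ} (hn : PTU C n) :
    PTG C fun x => (slpOps (zeroTestSlp (n x))).map Op.desc := by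
  have hi := hn.index
  have hw := (hn.up.add (.const 2)).add hi
  have h := PTG.map_range (F := fun x i => (n x + 3 + i, [[n x + 2 + i], [i, n x + 2 + i]])) hn
    ((hn.up.add (.const 3)).add hi) (.cons (.one hw) (.cons (.two hi hw) .nil))
  exact ((PTG.singleton (PTM.nil.desc (hn.add (.const 2)))).append h).congr fun x => by
    simp [slpOps, QNR.zeroTestSlp, Instr.ops]

/-- A list of assignments of constants. -/
def constSlp (a n : ℕ) : List Instr :=
  (List.range n).map fun i => (i, if a.testBit i = true then [[]] else [])

theorem PTG.constSlp {a n : α → ℕ} (ha : PTN C a) (hn : PTU C n) :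
    PTG C fun x => (slpOps (constSlp (a x) (n x))).map Op.desc :=
  .map_range hn hn.index (.ite (ha.up.testBit hn.index).decide_eq_true (.cons .nil .nil) .nil)

theorem PTG.hadamardDescs {n : α → ℕ} (hn : PTU C n) : PTG C fun x => hadamardDescs (n x) := by
  have h : PT (C.upto n) fun y => (hadamardDesc y.2).encode := by
    have := ((((PT.append PTM.nil hn.index.encodeUnary).append (.const invSqrtTwoDesc.encode)).append
      (.const invSqrtTwoDesc.encode)).append (.const invSqrtTwoDesc.encode)).append
      (.const negInvSqrtTwoDesc.encode)
    refine this.congr fun x _ => ?_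
    simp only [GateDesc.encode, hadamardDesc]
  refine (PTG.flatMap hn (F := fun _ i => [hadamardDesc i]) (.singleton h)).congr fun x => ?_
  rw [QNR.hadamardDescs, List.map_eq_flatMap]

/-! ### Writing down the rotations -/

theorem PTN.const (m : ℕ) : PTN C fun _ => m := PT.const _

theorem PTN.half {f : α → ℕ} (hf : PTN C f) : PTN C fun x => f x / 2 := by
  refine .of_testBit hf.size (fun x _ => (Nat.div_le_self _ _).trans_lt (Nat.lt_size_self _)) ?_
  exact (hf.up.testBit (hf.size.index.add (.const 1))).congr fun y _ => by
    rw [Nat.testBit_div_two]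

theorem PTN.encodeInt {f : α → ℕ} (hf : PTN C f) : PT C fun x => encodeInt (f x) :=
  (PT.append hf (.const [Γ'.comma])).congr fun x _ => by simp [QNR.encodeInt]

/-- Branch on the sign: in each branch one of the two natural subtractions does not truncate. -/
theorem PTN.encodeInt_sub {f g : α → ℕ} (hf : PTN C f) (hg : PTN C g) :
    PT C fun x => QNR.encodeInt ((f x : ℤ) - g x) := by
  have h1 : PTN (C.res {x | decide (f x < g x) = true}) fun x => g x - f x :=
    (hg.res _).sub (hf.res _) fun x hx => by
      have : f x < g x := by simpa using hx.2
      exact this.le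
  have h2 : PTN (C.res {x | decide (f x < g x) = false}) fun x => f x - g x :=
    (hf.res _).sub (hg.res _) fun x hx => by
      simpa using hx.2
  have h1' := (PT.append h1 (.const [Γ'.comma])).cons Γ'.blank
  refine ((hf.lt hg).cond h1' h2.encodeInt).congr fun x _ => ?_
  by_cases h : f x < g x
  · have e : ((f x : ℤ) - g x).natAbs = g x - f x := by omega
    have h' : (f x : ℤ) - g x < 0 := by omega
    simp [h, QNR.encodeInt, e, h']
  · have e : ((f x : ℤ) - g x) = ((f x - g x : ℕ) : ℤ) := by omega
    simp [h, e]

theorem PT.unitDesc {a b : α → ℤ} (ha : PT C fun x => encodeInt (a x))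
    (hb : PT C fun x => encodeInt (b x)) : PT C fun x => (unitDesc (a x) (b x)).encode := by
  have := (((PT.const [Γ'.bra]).append (ha.append (hb.append ha))).append
    (PT.const (C := C) [Γ'.ket])).append (.const (encodeRat (-1) ++ (encodeRat 1 ++
      (encodeRat 0 ++ encodeRat 1))))
  refine this.congr fun x _ => ?_
  simp [EntryDesc.encode, QNR.unitDesc, encodeList]

theorem PT.phaseDesc {cs : α → List ℕ} {t : α → ℕ} {a b : α → ℤ} (hcs : PTM C cs) (ht : PTU C t)
    (ha : PT C fun x => encodeInt (a x)) (hb : PT C fun x => encodeInt (b x)) :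
    PT C fun x => (phaseDesc (cs x) (t x) (a x) (b x)).encode := by
  have := ((((PT.append hcs ht.encodeUnary).append
    (.const (QNR.unitDesc 1 (-2)).encode)).append (.const zeroDesc.encode)).append
    (.const zeroDesc.encode)).append (PT.unitDesc ha hb)
  refine this.congr fun x _ => ?_
  simp only [GateDesc.encode, QNR.phaseDesc]

/-- Shows that `coeffOne` is nonnegative for `n = p.size`, so that it, and hence its square inside
`coeffTwo`, can be computed with natural numbers. -/
theorem half_le_two_pow (p : ℕ) : 2 * (p / 2) ≤ 2 * 2 ^ (p.size - 1) := by
  have h := Nat.lt_size_self p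
  rcases Nat.eq_zero_or_pos p.size with h0 | h0
  · have := Nat.size_eq_zero.1 h0
    subst this
    simp
  · have : 2 ^ p.size = 2 * 2 ^ (p.size - 1) := by rw [← pow_succ']; congr 1; omega
    omega

/-- The description makes sense for every number `p`, with `n` its binary length; the machine never
tests primality. -/
theorem PTG.algorithmDescs {p : α → ℕ} (hp : PTN C p) :
    PTG C fun x => algorithmDescs (p x) (p x).size := by
  have hn := hp.size
  have h0 : PTU C fun _ => 0 := .const 0
  have hH := PTG.hadamardDescs hn
  have hJ := (PTG.jacobiSlp hp hn).computeCopy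
    (hn.wire ((PTU.const 2).mul hn) 11 h0) hn
  have hK := (PTG.comparatorSlp hp hn).computeCopy
    ((hn.add (.const 2)).add hn) (hn.add (.const 1))
  have hZ := PTG.zeroTestSlp hn
  have hr := hp.half
  have hA : PTN C fun x => 2 * 2 ^ ((p x).size - 1) :=
    (PTN.const 2).mul (.of_unary (hn.sub (.const 1)))
  have hB : PTN C fun x => 2 * (p x / 2) := (PTN.const 2).mul hr
  have hAB := hA.sub hB fun x _ => half_le_two_pow (p x)
  have e1 : ∀ x, coeffOne (p x) (p x).size =
      ((2 * 2 ^ ((p x).size - 1) : ℕ) : ℤ) - (2 * (p x / 2) : ℕ) := fun x => by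
    rw [coeffOne]; push_cast; ring
  have hc1 : PT C fun x => encodeInt (coeffOne (p x) (p x).size) :=
    (hA.encodeInt_sub hB).congr fun x _ => by rw [e1]
  have hc2 : PT C fun x => encodeInt (coeffTwo (p x) (p x).size) := by
    refine (PTN.encodeInt_sub ((PTN.const 2).mul (hr.mul hr)) (hAB.mul hAB)).congr fun x _ => ?_
    rw [coeffTwo, e1, ← Nat.cast_sub (half_le_two_pow (p x))]
    congr 1
    generalize p x / 2 = r
    generalize 2 * 2 ^ ((p x).size - 1) - 2 * r = m
    push_cast
    ring
  have hr2 : PT C fun x => encodeInt (((p x / 2 : ℕ) : ℤ) ^ 2) :=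
    (hr.mul hr).encodeInt.congr fun x _ => by
      generalize p x / 2 = r
      congr 1
      push_cast
      ring
  have hph1 := PT.phaseDesc (PTM.two hn (hn.add (.const 1))) h0 hr2 hc2
  have hph2 := PT.phaseDesc (PTM.one (hn.add (.const 1))) hn hr.encodeInt hc1
  have hph3 := PT.phaseDesc (C := C) (PTM.nil) ((hn.add (.const 2)).add hn) (a := fun _ => 1)
    (b := fun _ => 2) (.const _) (.const _)
  refine ((((((((hH.append hJ).append hK).append ((PTG.singleton hph1).append
    (.singleton hph2))).append hK.reverse).append hJ.reverse).append hH).append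
      (hZ.append ((PTG.singleton hph3).append hZ.reverse))).append hH).congr fun x => ?_
  simp only [QNR.algorithmDescs, jacobiOps, comparatorOps, List.map_reverse, List.singleton_append]

/-! ### The uniform family of circuits -/

/-- A nonresidue modulo a prime `p` with `p % 8 ≠ 1`. -/
def easyNonresidue (p : ℕ) : ℕ := if p.testBit 1 = true then 2 * (p / 2) else 2

theorem easyNonresidue_lt {p : ℕ} (hp : 2 < p) (h2 : p % 2 = 1) : easyNonresidue p < p := by
  unfold easyNonresidue
  split_ifs <;> omega

/-- For p ≡ 3 mod 4 the value is p - 1, congruent to the nonresidue -1; for p ≡ 5 mod 8 it is 2, by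
the second supplementary law. -/
theorem isNonresidue_easyNonresidue {p : ℕ} (hp : p.Prime) (h2 : p ≠ 2) (h8 : p % 8 ≠ 1) :
    IsNonresidue p (easyNonresidue p) := by
  have := Fact.mk hp
  have hodd := hp.eq_two_or_odd.resolve_left h2
  refine ⟨easyNonresidue_lt (by have := hp.two_le; omega) hodd, ?_⟩
  rw [easyNonresidue, testBit_one_eq]
  by_cases h : p / 2 % 2 = 1
  · rw [decide_eq_true h, if_pos rfl]
    have e : ((2 * (p / 2) : ℕ) : ZMod p) = -1 := by
      rw [eq_neg_iff_add_eq_zero]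
      have : ((2 * (p / 2) + 1 : ℕ) : ZMod p) = 0 := by
        rw [show 2 * (p / 2) + 1 = p by omega, ZMod.natCast_self]
      exact_mod_cast this
    rw [e, ZMod.exists_sq_eq_neg_one_iff]
    omega
  · rw [decide_eq_false h, if_neg (by simp)]
    have := (ZMod.exists_sq_eq_two_iff (p := p) h2).not
    rw [Nat.cast_ofNat, this]
    omega

/-- An empty product is a NOT gate, an empty sum no gate at all, so the digits of `a` are written
onto zeros. -/
theorem run_constSlp {a n : ℕ} (ha : a < 2 ^ n) :
    Circuit.WellFormed n ((slpOps (constSlp a n)).map Op.toGate) ∧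
      Circuit.run n ((slpOps (constSlp a n)).map Op.toGate) (ket n 0) = ket n a := by
  have hlt : ∀ i ∈ constSlp a n, ∀ m ∈ i.2, m = [] := by
    intro i hi m hm
    obtain ⟨i, -, rfl⟩ := List.mem_map.1 hi
    simp only at hm
    split_ifs at hm <;> simp at hm
    exact hm
  have hc : ∀ i ∈ constSlp a n, ∀ m ∈ i.2, ∀ c ∈ m, c < i.1 := by
    intro i hi m hm c hc
    rw [hlt i hi m hm] at hc
    simp at hc
  have hok : ∀ o ∈ slpOps (constSlp a n), o.Ok n := by
    refine slpOps_ok hc (fun i hi => ?_) fun i hi m hm => by rw [hlt i hi m hm]; simp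
    obtain ⟨i, hi', rfl⟩ := List.mem_map.1 hi
    exact List.mem_range.1 hi'
  refine ⟨(reversible_ops hok).1, ?_⟩
  rw [ket_eq_basis, run_ops hok, ket_eq_basis]
  have h := (actAll_slpOps (pairwise_map_range (fun i j hij => hij) n) hc
    (s := (0 : ℕ).testBit) fun i _ => Nat.zero_testBit _).2
  congr 1
  funext j
  by_cases hj : j < n
  · have := h _ (List.mem_map.2 ⟨j, List.mem_range.2 hj, rfl⟩)
    simp only at this
    rw [constSlp, this]
    cases a.testBit j <;> simp [xorSum]
  · rw [Nat.testBit_lt_two_pow (ha.trans_le (Nat.pow_le_pow_right (by norm_num) (not_lt.1 hj))),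
      actAll_of_not_mem, Nat.zero_testBit]
    intro o ho
    have := (hok o ho).1
    omega

/-- The circuit written for `p`. -/
def circuitDesc (p : ℕ) : CircuitDesc :=
  if p % 8 = 1 then ⟨wire p.size (2 * p.size + 1) 0 0, p.size, algorithmDescs p p.size⟩
  else ⟨p.size, p.size, (slpOps (constSlp (easyNonresidue p) p.size)).map Op.desc⟩

/-- The context of a machine whose input is a number in binary. -/
def inputCtx : Ctx ℕ := ⟨Set.univ, fun p => (Computability.encodeNat p).length,
  [fun p => ((Computability.encodeNat p).map Γ'.bit).reverse]⟩

/-- The machine receives its input reversed in a register, so digit `j` is read at position `size -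
1 - j` and the numeral is rebuilt from its digits. -/
theorem PTN.input : PTN inputCtx fun p => p := by
  have hv : PT inputCtx fun p => (Computability.encodeNat p).reverse.map Γ'.bit :=
    (PT.var (v := fun p => ((Computability.encodeNat p).map Γ'.bit).reverse) (by simp [inputCtx])
      ⟨Polynomial.X, fun x _ => by simp [inputCtx]⟩).congr fun p _ => by simp
  have hL : PTU inputCtx fun p => p.size := (PT.length hv).congr fun p _ => by
    simp [length_encodeNat]
  refine .of_testBit hL (fun p _ => Nat.lt_size_self p) ?_
  refine (PTB.getD (l := fun y => (Computability.encodeNat y.1).reverse)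
    (PT.up (n := fun p => p.size) hv) ((hL.up.sub (.const 1)).sub hL.index)).congr fun y hy => ?_
  have hlt : y.2 < y.1.size := (Ctx.mem_upto.1 hy).2
  rw [← getD_encodeNat, List.getD_eq_getElem?_getD, List.getD_eq_getElem?_getD,
    List.getElem?_reverse (by rw [length_encodeNat]; omega), length_encodeNat]
  congr 2
  omega

theorem PT.circuitDesc : PT inputCtx fun p => (circuitDesc p).encode := by
  have hp := PTN.input
  have hn := hp.size
  have hb : PTB inputCtx fun p => decide (p % 8 = 1) := by
    refine (PTB.comp₃ (fun x y z => x && !y && !z) (hp.testBit (.const 0)) (hp.testBit (.const 1))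
      (hp.testBit (.const 2))).congr fun p _ => ?_
    rw [Nat.testBit_zero, testBit_one_eq, testBit_two_eq, Bool.eq_iff_iff]
    simp only [Bool.and_eq_true, decide_eq_true_eq, Bool.not_eq_true', decide_eq_false_iff_not]
    omega
  have ha : PTN inputCtx easyNonresidue :=
    ((hp.testBit (.const 1)).ite ((PTN.const 2).mul hp.half) (PTN.const 2)).congr fun p _ => by
      unfold easyNonresidue
      split_ifs <;> rfl
  have hw := hn.wire (((PTU.const 2).mul hn).add (.const 1)) 0 (.const 0)
  have h1 := (PT.append hw.encodeUnary hn.encodeUnary).append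
    (((PT.const [Γ'.bra]).append (PTG.algorithmDescs hp).1).append (.const [Γ'.ket]))
  have h2 := (PT.append hn.encodeUnary hn.encodeUnary).append
    (((PT.const [Γ'.bra]).append (PTG.constSlp ha hn).1).append (.const [Γ'.ket]))
  refine (hb.ite h1 h2).congr fun p _ => ?_
  by_cases h : p % 8 = 1
  · simp only [h, decide_true, if_true, CircuitDesc.encode, QNR.circuitDesc, encodeList]
  · simp only [h, decide_false, if_false, CircuitDesc.encode, QNR.circuitDesc, encodeList,
      Bool.false_eq_true]

/-- A `PT` program preserves its input register, while a halting configuration must have all stacks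
but the output empty; hence the final clearing of register `0`. -/
theorem polyTimeUniform_of_PT {D : ℕ → CircuitDesc} (h : PT inputCtx fun p => (D p).encode) :
    PolyTimeUniform D := by
  obtain ⟨P, hP⟩ := h
  obtain ⟨c, m, hm, hc⟩ := hP [0] 1 2 rfl (by simp) (by norm_num)
  refine polyTime_of_exec _ _ (.seq c (.clear 0)) (P + (2 * Polynomial.X + 1)) (fun p => ?_)
    (max m 1) ⟨hm.mono (le_max_left _ _), by omega, fun _ => trivial⟩
  set S : Store := Function.update (fun _ => []) 0 ((Computability.encodeNat p).map Γ'.bit).reverse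
    with hS
  obtain ⟨t, ht, hex⟩ := hc S p trivial (by simp [hS])
    (fun k hk => by rw [hS, Function.update_of_ne (by omega)])
    (.cons (by simp [hS]) .nil)
  refine ⟨_, ?_, (hex.seq (exec_clear 0 _)).of_eq ?_ rfl⟩
  · rw [Function.update_of_ne (by norm_num), hS, Function.update_self]
    simp only [List.length_reverse, List.length_map, Polynomial.eval_add, Polynomial.eval_mul,
      Polynomial.eval_ofNat, Polynomial.eval_X, Polynomial.eval_one]
    exact Nat.add_le_add_right ht _
  · rw [Function.update_comm (by norm_num), hS, Function.update_idem]
    congr 1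
    exact Function.update_eq_self 0 _

/-- The inequalities `2 ^ n < 2 * p` and `p < 2 ^ n` force `n` to be the binary length of `p`, which
is the value the machine uses. -/
theorem circuitDesc_admissible {p n : ℕ} (hp : Admissible p n) :
    ∃ J K Z : Circuit, IsInstance p n (circuitDesc p).width J K Z ∧ (circuitDesc p).outputs = n ∧
      (circuitDesc p).Denotes Set.univ (algorithm p n J K Z) := by
  have hn := hp.pos
  have hsize : p.size = n := by
    refine le_antisymm (Nat.size_le.2 hp.2.2.2) ?_
    by_contra h
    have h1 := Nat.size_le.1 (show p.size ≤ n - 1 by omega)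
    have h2 := hp.2.2.1
    have : 2 ^ n = 2 * 2 ^ (n - 1) := by rw [← pow_succ']; congr 1; omega
    omega
  have e : circuitDesc p = ⟨wire n (2 * n + 1) 0 0, n, algorithmDescs p n⟩ := by
    rw [circuitDesc, if_pos hp.2.1, hsize]
  rw [e]
  have hW : 2 * n + 3 ≤ wire n (2 * n + 1) 0 0 := by
    have : 12 * (n + 1) ≤ ((2 * n + 1) * 12 + 0) * (n + 1) := Nat.mul_le_mul_right _ (by omega)
    unfold wire
    omega
  have hI : IsInstance p n (wire n (2 * n + 1) 0 0) (jacobiCircuit p n) (comparator p n)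
      (zeroFlip n) := ⟨le_wire _ _ _ _, jacobiCircuit_isJacobiCircuit hp le_rfl,
    comparator_isComparatorCircuit hp.2.2.2 hW, zeroFlip_isZeroFlipCircuit hW⟩
  exact ⟨_, _, _, hI, rfl, by simp only; omega, algorithmDescs_denotes hp,
    algorithm_wellFormed (by omega) hI, fun _ _ _ _ => Set.mem_univ _⟩

/-- Only the strictness of `2 ^ n < 2 * p` needs an argument: an odd number greater than 1 is not a
power of 2. -/
theorem admissible_size {p : ℕ} (hp : p.Prime) (h8 : p % 8 = 1) : Admissible p p.size := by
  refine ⟨hp, h8, ?_, Nat.lt_size_self p⟩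
  have h2 := hp.two_le
  have hs : 0 < p.size := Nat.size_pos.2 hp.pos
  have h1 : 2 ^ (p.size - 1) ≤ p := Nat.lt_size.1 (by omega)
  have e : 2 ^ p.size = 2 * 2 ^ (p.size - 1) := by rw [← pow_succ']; congr 1; omega
  rcases h1.lt_or_eq with h | h
  · omega
  · rcases Nat.eq_zero_or_pos (p.size - 1) with h0 | h0
    · rw [h0] at h; omega
    · have : 2 ∣ 2 ^ (p.size - 1) := dvd_pow_self 2 (by omega)
      omega

theorem nonresidueProblem_mem_EQP : nonresidueProblem ∈ EQP Set.univ := by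
  refine ⟨circuitDesc, polyTimeUniform_of_PT PT.circuitDesc, fun p hp => ?_⟩
  obtain ⟨hp, h2⟩ : p.Prime ∧ p ≠ 2 := hp
  by_cases h8 : p % 8 = 1
  · have hA := admissible_size hp h8
    obtain ⟨J, K, Z, hI, hout, hD⟩ := circuitDesc_admissible hA
    refine ⟨_, hD, ?_⟩
    rw [hout]
    exact (outputProb_algorithm hA hI).1
  · have hx := isNonresidue_easyNonresidue hp h2 h8
    have e : circuitDesc p = ⟨p.size, p.size,
        (slpOps (constSlp (easyNonresidue p) p.size)).map Op.desc⟩ := by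
      rw [circuitDesc, if_neg h8]
    have hlt : easyNonresidue p < 2 ^ p.size := hx.1.trans (Nat.lt_size_self p)
    obtain ⟨hwf, hrun⟩ := run_constSlp hlt
    rw [e]
    refine ⟨_, ⟨le_rfl, forall₂_ops _, hwf, fun _ _ _ _ => Set.mem_univ _⟩, ?_⟩
    simp only
    rw [hrun]
    -- The basis state is written as a superposition with one nonzero coefficient so that
    -- `outputProb_sum` covers it too.
    have hket : ket p.size (easyNonresidue p) = ∑ x ∈ Finset.range (2 ^ p.size),
        (if x = easyNonresidue p then (1 : ℂ) else 0) • ket p.size x := by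
      simp only [ite_smul, one_smul, zero_smul]
      rw [Finset.sum_ite_eq' , if_pos (Finset.mem_range.2 hlt)]
    rw [hket, outputProb_sum le_rfl, Finset.sum_eq_single (easyNonresidue p)]
    · rw [if_pos (show easyNonresidue p ∈ {y | nonresidueProblem.solution p y} from hx)]
      simp
    · intro y _ hy
      simp [hy]
    · intro h
      exact absurd (Finset.mem_range.2 hlt) h

end QNR
end

theorem mainTheorem1 :
    -- the amplitudes
    (∀ p n : ℕ, QNR.Admissible p n →
      QNR.mean n (QNR.rotateNonresidues p n (QNR.angle p n) (QNR.uniformState n)) =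
          1 / (2 * (Real.sqrt (2 ^ n) : ℂ)) ∧
      (∀ x : Fin (2 ^ n),
        QNR.invertAboutMean n
            (QNR.rotateNonresidues p n (QNR.angle p n) (QNR.uniformState n)) x =
          QNR.finalAmplitude p n x) ∧
      (∀ x : ℕ, QNR.IsNonresidue p x → ‖QNR.finalAmplitude p n x‖ ^ 2 = 2 / ((p : ℝ) - 1)) ∧
      (∀ x : ℕ, ¬ QNR.IsNonresidue p x → QNR.finalAmplitude p n x = 0) ∧
      2 * Set.ncard {x : ℕ | QNR.IsNonresidue p x} = p - 1) ∧
    -- the circuit, up to the global phase `-1`, and its measurement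
    (∀ p n W : ℕ, ∀ J K Z : QNR.Circuit, QNR.Admissible p n → QNR.IsInstance p n W J K Z →
      (QNR.algorithm p n J K Z).WellFormed W ∧
      (QNR.algorithm p n J K Z).run W (QNR.ket W 0) =
        (-1 : ℂ) • ∑ x ∈ Finset.range (2 ^ n), QNR.finalAmplitude p n x • QNR.ket W x ∧
      QNR.outputProb W n ((QNR.algorithm p n J K Z).run W (QNR.ket W 0))
        {y | QNR.IsNonresidue p y} = 1 ∧
      ∀ y : ℕ, QNR.IsNonresidue p y →
        QNR.outputProb W n ((QNR.algorithm p n J K Z).run W (QNR.ket W 0)) {y} =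
          2 / ((p : ℝ) - 1)) ∧
    -- the number of gates, relative to the Jacobi symbol circuit
    (∃ c : ℕ, ∀ p n W : ℕ, ∀ J : QNR.Circuit, QNR.Admissible p n → n + 2 ≤ W →
      QNR.IsJacobiCircuit p n W J → ∃ (W' : ℕ) (K Z : QNR.Circuit),
        QNR.IsInstance p n W' J K Z ∧
        (QNR.algorithm p n J K Z).length ≤ 2 * J.length + c * n) ∧
    (∀ M : ℕ → ℝ, (∀ n : ℕ, (n : ℝ) ≤ M n) →
      (∃ c : ℝ, ∀ p n : ℕ, QNR.Admissible p n → ∃ (W : ℕ) (J : QNR.Circuit), n + 2 ≤ W ∧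
        QNR.IsJacobiCircuit p n W J ∧ (J.length : ℝ) ≤ c * (M n * Real.log n)) →
      ∃ c : ℝ, ∀ p n : ℕ, QNR.Admissible p n → ∃ (W : ℕ) (J K Z : QNR.Circuit),
        QNR.IsInstance p n W J K Z ∧
        ((QNR.algorithm p n J K Z).length : ℝ) ≤ c * (M n * Real.log n)) ∧
    -- the algorithm is a polynomial-time uniform exact quantum algorithm
    (∃ D : ℕ → QNR.CircuitDesc, QNR.PolyTimeUniform D ∧
      ∀ p n : ℕ, QNR.Admissible p n → ∃ J K Z : QNR.Circuit,
        QNR.IsInstance p n (D p).width J K Z ∧ (D p).outputs = n ∧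
        (D p).Denotes Set.univ (QNR.algorithm p n J K Z)) ∧
    QNR.nonresidueProblem ∈ QNR.EQP Set.univ := by
  refine ⟨fun p n hp => ⟨QNR.mean_rotateNonresidues hp,
      QNR.invertAboutMean_rotateNonresidues hp,
      fun x hx => QNR.norm_finalAmplitude_sq hp hx,
      fun x hx => QNR.finalAmplitude_eq_zero hp.1 hx,
      QNR.ncard_nonresidues hp.1 (by have := hp.two_le; omega)⟩,
    fun p n W J K Z hp hI => ⟨QNR.algorithm_wellFormed (by have := hp.pos; omega) hI,
      QNR.run_algorithm hp hI, QNR.outputProb_algorithm hp hI⟩,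
    ⟨28, fun p n W J hp hW hJ => QNR.exists_instance_length_le hp hW hJ⟩,
    QNR.exists_instance_length_le_mul_log,
    ⟨QNR.circuitDesc, QNR.polyTimeUniform_of_PT QNR.PT.circuitDesc,
      fun p n hp => QNR.circuitDesc_admissible hp⟩,
    QNR.nonresidueProblem_mem_EQP⟩
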